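/- Let $\alpha>0$. A $(1+\alpha)$-diagonally dominant (DD) matrix is a symmetric $M\in\mathbb R^{n\times n}$ with non-positive off-diagonal entries and $M_{uu}\ge(1+\alpha)\sum_{v\ne u}|M_{uv}|$ for all $u$. Its completion $L_M$ is the Laplacian obtained from $M$ by adding one row and one column, indexed by a new vertex $x$, so that all row and column sums vanish. It represents a weighted graph $G_M$ on $\{1,\dots,n\}\cup\{x\}$: the edges are the pairs $i\ne j$ with $(L_M)_{ij}\neq 0$, and the edge $ij$ has weight $-(L_M)_{ij}$. Let $m$ be the number of edges of $G_M$. Assume throughout that $n\ge 1$ and that $G_M$ is connected. The effective resistance is $R(u,v)=(\mathbf 1_u-\mathbf 1_v)^\top L_M^+(\mathbf 1_u-\mathbf 1_v)$, where $L_M^+$ is the pseudoinverse. Algorithms are single finite programs, independent of the input, for a random access machine with exact real arithmetic and with integer words. Each arithmetic operation on words or reals, comparison, array access, draw of a uniform real in $[0,1]$, or draw of a uniform element of $\{0,\dots,k-1\}$ for a word $k$ costs one step, and arrays are initially zero outside the input. The input is $n$, $\alpha$, $\varepsilon$ and the non-zero entries of $M$ in compressed sparse row format. **(1)** For every $c\in\mathbb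 N$ there are a randomized program *Build*, a program *Query* and a constant $K$, depending only on $c$, such that the following holds for all $n\ge1$, $\alpha>0$, $0<\varepsilon\le 1$, $W$, and every $(1+\alpha)$-DD matrix $M\in\mathbb R^{n\times n}$ with $G_M$ connected such that any two edge weights of $G_M$ differ by a factor of at most $W$. Put $$T=m+n\,\varepsilon^{-2}(1+\alpha^{-3})\,\log n\,\log^3\frac{nW}{\varepsilon}.$$ Suppose that the words are the integers in $[0,\lceil K\,T^{K}\rceil)$. Then, for every outcome of the random draws, *Build* halts after at most $K\,T$ steps with a data structure from which *Query*, given any two original vertices $u,v\in\{1,\dots,n\}$ (not $x$), halts after at most $K(1+\log n)^K$ steps, leaving the data structure unchanged; no word overflows. With probability at least $1-n^{-c}$ over the random draws of *Build*, the answer $r$ of *Query* satisfies $$\frac{R(u,v)}{1+\varepsilon}\le r\le(1+\varepsilon)R(u,v)$$ for all $u,v\in\{1,\dots,n\}$ simultaneously, regardless of any random draws that *Query* may make. **(2)** Let $n\ge2$, $\alpha>0$, and let $M\in\mathbb R^{n\times n}$ be a $(1+\alpha)$-DD matrix with $G_M$ connected. Let $S$ be the Schur complement of $L_M$ onto the original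 vertices $\{1,\dots,n\}$ (the vertex $x$ is eliminated), and let $D$ be the diagonal of $S$. Then the second smallest eigenvalue of the normalized Laplacian $D^{-1/2}SD^{-1/2}$ is at least $\alpha/(1+\alpha)$. -/

import Mathlib

open MeasureTheory

/-! ## Laplacians, effective resistances, Schur complements -/

section Laplacians

/-- A real matrix `M` is `(1 + α)`-diagonally dominant: it is symmetric, its off-diagonal entries
are non-positive, and `M u u ≥ (1 + α) * ∑_{v ≠ u} |M u v|` for every `u`. -/
def IsDiagDominant {n : ℕ} (α : ℝ) (M : Matrix (Fin n) (Fin n) ℝ) : Prop :=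
  M.IsSymm ∧ (∀ u v, u ≠ v → M u v ≤ 0) ∧
    ∀ u, (1 + α) * ∑ v ∈ Finset.univ.erase u, |M u v| ≤ M u u

/-- The completion `L_M` of `M` into a Laplacian. The vertex `Sum.inr ()` is the added vertex `x`;
its row and column are the ones that make all row sums and column sums vanish. -/
def laplacianCompletion {n : ℕ} (M : Matrix (Fin n) (Fin n) ℝ) :
    Matrix (Fin n ⊕ Unit) (Fin n ⊕ Unit) ℝ :=
  Matrix.fromBlocks M (Matrix.of fun u _ => -∑ v, M u v) (Matrix.of fun _ v => -∑ u, M u v)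
    (Matrix.of fun _ _ => ∑ u, ∑ v, M u v)

/-- The graph represented by a Laplacian: distinct vertices are adjacent when the corresponding
entry is non-zero. The edge `{i, j}` has weight `-L i j`. -/
def laplacianGraph {V : Type*} (L : Matrix V V ℝ) : SimpleGraph V :=
  SimpleGraph.fromRel (fun i j => L i j ≠ 0)

/-- The number of edges of the graph represented by a Laplacian. -/
noncomputable def edgeCount {V : Type*} (L : Matrix V V ℝ) : ℕ :=
  (laplacianGraph L).edgeSet.ncard

/-- Any two edge weights of the graph represented by `L` differ by a factor of at most `W`. -/
def WeightRatioLE {V : Type*} (L : Matrix V V ℝ) (W : ℝ) : Prop :=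
  ∀ i j k l, (laplacianGraph L).Adj i j → (laplacianGraph L).Adj k l →
    -L i j ≤ W * -L k l

open Classical in
/-- The pseudoinverse `∑_{λ_i ≠ 0} λ_i⁻¹ ψ_i ψ_iᵀ` of a symmetric real matrix with orthonormal
eigenvectors `ψ_i` and eigenvalues `λ_i`; terms with `λ_i = 0` vanish because `0⁻¹ = 0`.
(The value at a matrix that is not symmetric is irrelevant.) -/
noncomputable def pseudoInverse {V : Type*} [Fintype V] [DecidableEq V] (L : Matrix V V ℝ) :
    Matrix V V ℝ :=
  if h : L.IsHermitian then
    ∑ i, (h.eigenvalues i)⁻¹ •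
      Matrix.vecMulVec (fun a => h.eigenvectorBasis i a) (fun a => h.eigenvectorBasis i a)
  else 0

/-- The effective resistance `(1_u - 1_v)ᵀ L⁺ (1_u - 1_v)`. -/
noncomputable def effectiveResistance {V : Type*} [Fintype V] [DecidableEq V]
    (L : Matrix V V ℝ) (u v : V) : ℝ :=
  (Pi.single u (1 : ℝ) - Pi.single v (1 : ℝ)) ⬝ᵥ
    Matrix.mulVec (pseudoInverse L) (Pi.single u (1 : ℝ) - Pi.single v (1 : ℝ))

/-- The Schur complement of a matrix onto its first block of indices (the second block is
eliminated). -/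
noncomputable def schurOntoLeft {V X : Type*} [Fintype X] [DecidableEq X]
    (L : Matrix (V ⊕ X) (V ⊕ X) ℝ) : Matrix V V ℝ :=
  L.toBlocks₁₁ - L.toBlocks₁₂ * (L.toBlocks₂₂)⁻¹ * L.toBlocks₂₁

/-- The normalized Laplacian `D^{-1/2} L D^{-1/2}`, where the matrix `D` of weighted degrees is the
diagonal of `L`. -/
noncomputable def normalizedLaplacian {V : Type*} [Fintype V] [DecidableEq V]
    (L : Matrix V V ℝ) : Matrix V V ℝ :=
  Matrix.diagonal (fun i => (Real.sqrt (L i i))⁻¹) * L *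
    Matrix.diagonal (fun i => (Real.sqrt (L i i))⁻¹)

/-- The second smallest eigenvalue, counted with multiplicity, of a symmetric real `n × n` matrix
with `2 ≤ n`. (Mathlib lists `eigenvalues₀` in decreasing order.) -/
noncomputable def secondSmallestEigenvalue {n : ℕ} (hn : 2 ≤ n)
    {A : Matrix (Fin n) (Fin n) ℝ} (hA : A.IsHermitian) : ℝ :=
  hA.eigenvalues₀ ⟨n - 2, by rw [Fintype.card_fin]; omega⟩

/-- `r'` is a `(1 + ε)`-approximation to `r`. -/
def IsApprox (ε r r' : ℝ) : Prop :=
  r / (1 + ε) ≤ r' ∧ r' ≤ (1 + ε) * r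

end Laplacians

/-! ## Randomized real random access machines -/

namespace RealRAM

/-- A configuration: integer registers, real registers, integer arrays, real arrays (an array is
given by its name and is indexed by addresses), and the number of random variates drawn so far. -/
structure State where
  nreg : ℕ → ℕ
  rreg : ℕ → ℝ
  narr : ℕ → ℕ → ℕ
  rarr : ℕ → ℕ → ℝ
  pos : ℕ

/-- Elementary instructions. Registers and arrays are named by constants; only the address of an
array cell is computed at run time. `d` is the register that receives the result. -/
inductive Op where
  | nconst (d c : ℕ)
  | nadd (d a b : ℕ)
  | nsub (d a b : ℕ)
  | nmul (d a b : ℕ)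
  | ndiv (d a b : ℕ)
  | nload (d arr i : ℕ)
  | nstore (arr i a : ℕ)
  | rofNat (d a : ℕ)
  | radd (d a b : ℕ)
  | rsub (d a b : ℕ)
  | rmul (d a b : ℕ)
  | rdiv (d a b : ℕ)
  | rload (d arr i : ℕ)
  | rstore (arr i a : ℕ)
  | randReal (d : ℕ)
  | randNat (d a : ℕ)

/-- Comparisons of two integer registers or of two real registers. -/
inductive Test where
  | nlt (a b : ℕ)
  | nle (a b : ℕ)
  | rlt (a b : ℕ)
  | rle (a b : ℕ)

/-- Programs: finite syntax trees, which do not depend on the input. -/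
inductive Prog where
  | skip
  | op (o : Op)
  | seq (p q : Prog)
  | ite (t : Test) (p q : Prog)
  | loop (t : Test) (p : Prog)

/-- Write the integer `x` to register `d`; the machine fails if `x` is not a word, that is, if `x`
is not below the word bound `B`. -/
def State.setN (B : ℕ) (s : State) (d x : ℕ) : Option State :=
  if x < B then some { s with nreg := Function.update s.nreg d x } else none

/-- Write the real number `x` to register `d`. -/
def State.setR (s : State) (d : ℕ) (x : ℝ) : State :=
  { s with rreg := Function.update s.rreg d x }

/-- The effect of an elementary instruction with word bound `B` and random tape `ω`. Integer
subtraction is truncated, integer division rounds down, division by zero gives zero. There is no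
rounding of real numbers. `randReal` draws a uniform number in `[0, 1]`, and `randNat` draws a
uniform integer in `{0, …, k - 1}`, where `k` is the content of register `a`. -/
noncomputable def Op.eval (B : ℕ) (ω : ℕ → unitInterval) : Op → State → Option State
  | .nconst d c, s => s.setN B d c
  | .nadd d a b, s => s.setN B d (s.nreg a + s.nreg b)
  | .nsub d a b, s => s.setN B d (s.nreg a - s.nreg b)
  | .nmul d a b, s => s.setN B d (s.nreg a * s.nreg b)
  | .ndiv d a b, s => s.setN B d (s.nreg a / s.nreg b)
  | .nload d arr i, s => s.setN B d (s.narr arr (s.nreg i))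
  | .nstore arr i a, s =>
      some { s with
        narr := Function.update s.narr arr
          (Function.update (s.narr arr) (s.nreg i) (s.nreg a)) }
  | .rofNat d a, s => some (s.setR d (s.nreg a : ℝ))
  | .radd d a b, s => some (s.setR d (s.rreg a + s.rreg b))
  | .rsub d a b, s => some (s.setR d (s.rreg a - s.rreg b))
  | .rmul d a b, s => some (s.setR d (s.rreg a * s.rreg b))
  | .rdiv d a b, s => some (s.setR d (s.rreg a / s.rreg b))
  | .rload d arr i, s => some (s.setR d (s.rarr arr (s.nreg i)))
  | .rstore arr i a, s =>
      some { s with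
        rarr := Function.update s.rarr arr
          (Function.update (s.rarr arr) (s.nreg i) (s.rreg a)) }
  | .randReal d, s => some { s.setR d (ω s.pos : ℝ) with pos := s.pos + 1 }
  | .randNat d a, s =>
      State.setN B { s with pos := s.pos + 1 } d
        (min ⌊(ω s.pos : ℝ) * (s.nreg a : ℝ)⌋₊ (s.nreg a - 1))

/-- The outcome of a comparison. -/
def Test.holds : Test → State → Prop
  | .nlt a b, s => s.nreg a < s.nreg b
  | .nle a b, s => s.nreg a ≤ s.nreg b
  | .rlt a b, s => s.rreg a < s.rreg b
  | .rle a b, s => s.rreg a ≤ s.rreg b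

/-- `Exec B ω p s t s'`: with word bound `B` and random tape `ω`, the program `p` started in `s`
halts without failure in `s'` after exactly `t` steps. Every elementary instruction and every
comparison takes one step. -/
inductive Exec (B : ℕ) (ω : ℕ → unitInterval) : Prog → State → ℕ → State → Prop where
  | skip (s : State) : Exec B ω .skip s 1 s
  | op (o : Op) (s s' : State) (h : o.eval B ω s = some s') : Exec B ω (.op o) s 1 s'
  | seq (p q : Prog) (s s₁ s₂ : State) (t₁ t₂ : ℕ) (hp : Exec B ω p s t₁ s₁)
      (hq : Exec B ω q s₁ t₂ s₂) : Exec B ω (.seq p q) s (t₁ + t₂) s₂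
  | ite_true (c : Test) (p q : Prog) (s s' : State) (t : ℕ) (hc : c.holds s)
      (hp : Exec B ω p s t s') : Exec B ω (.ite c p q) s (t + 1) s'
  | ite_false (c : Test) (p q : Prog) (s s' : State) (t : ℕ) (hc : ¬ c.holds s)
      (hq : Exec B ω q s t s') : Exec B ω (.ite c p q) s (t + 1) s'
  | loop_true (c : Test) (p : Prog) (s s₁ s₂ : State) (t₁ t₂ : ℕ) (hc : c.holds s)
      (hp : Exec B ω p s t₁ s₁) (hl : Exec B ω (.loop c p) s₁ t₂ s₂) :
      Exec B ω (.loop c p) s (t₁ + t₂ + 1) s₂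
  | loop_false (c : Test) (p : Prog) (s : State) (hc : ¬ c.holds s) :
      Exec B ω (.loop c p) s 1 s

/-- The law of the random tape: independent uniform variates in `[0, 1]`. -/
noncomputable def tapeLaw : Measure (ℕ → unitInterval) :=
  Measure.infinitePi (fun _ => (volume : Measure unitInterval))

/-- The arrays `ptr`, `col`, `val` store `M` in compressed sparse row format: the non-zero entries
of row `u` (including the diagonal one) are stored, each once and in any order, at the addresses
`k` with `ptr u ≤ k < ptr (u + 1)`, where `col k` is the column and `val k` the value. -/
def IsSparseRowFormat {n : ℕ} (M : Matrix (Fin n) (Fin n) ℝ) (ptr col : ℕ → ℕ) (val : ℕ → ℝ) :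
    Prop :=
  ptr 0 = 0 ∧ ∀ u : Fin n,
    ptr u ≤ ptr (u + 1) ∧
    Set.BijOn col (Set.Ico (ptr u) (ptr (u + 1))) {j | ∃ v : Fin n, (v : ℕ) = j ∧ M u v ≠ 0} ∧
    ∀ v : Fin n, ∀ k ∈ Set.Ico (ptr u) (ptr (u + 1)), col k = (v : ℕ) → val k = M u v

/-- The initial configuration: the dimension `n` in integer register `0`, the parameters `α` and `ε`
in the real registers `0` and `1`, the matrix in the integer arrays `0` and `1` and the real array
`0`, and zeros elsewhere. -/
def inputState (n : ℕ) (ptr col : ℕ → ℕ) (val : ℕ → ℝ) (α ε : ℝ) : State where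
  nreg := fun i => if i = 0 then n else 0
  rreg := fun i => if i = 0 then α else if i = 1 then ε else 0
  narr := fun i => if i = 0 then ptr else if i = 1 then col else fun _ => 0
  rarr := fun i => if i = 0 then val else fun _ => 0
  pos := 0

/-- The configuration in which a query for the pair `u, v` starts: the arrays are those of the data
structure `s`, the integer registers `0` and `1` hold `u` and `v`, all other registers are zero. -/
def queryState (s : State) (u v : ℕ) : State where
  nreg := fun i => if i = 0 then u else if i = 1 then v else 0
  rreg := fun _ => 0
  narr := s.narr
  rarr := s.rarr
  pos := 0

end RealRAM

/-- The quantity `m + n ε⁻² (1 + α⁻³) log n log³(n W / ε)`. -/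
noncomputable def buildBound (n m : ℕ) (α ε W : ℝ) : ℝ :=
  m + n * (ε ^ 2)⁻¹ * (1 + (α ^ 3)⁻¹) * Real.log n * Real.log (n * W / ε) ^ 3

/-- The word bound: integers that are polynomially bounded in `T`, with constant and exponent `K`,
fit into a word. -/
noncomputable def wordBound (K : ℕ) (T : ℝ) : ℕ := ⌈K * T ^ K⌉₊

/-! ### Grounded Laplacians: nonnegative inverse and effective resistance. -/

section LinearAlgebra

open Matrix

/-! Let s_u be the row sums of M, that is, the weights of the edges to x. Connectedness makes them
positive (`IsDiagDominant.sum_row_pos`), so M is invertible with nonnegative inverse, and grounding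
x turns R(u,v) into the quadratic form of M⁻¹ at 1_u - 1_v (`effectiveResistance_eq_dotProduct`).
Consider the walk that moves from u to v with probability -M_uv/M_uu and is killed, by stepping to
x, with probability s_u/M_uu. Then M⁻¹_uv s_v is the probability that the walk from u is killed at
v. So R(u,v) is a signed sum of four killing probabilities, each divided by a row sum, and these
probabilities can be estimated by simulation.

Let q be the least of 1 and the killing probabilities s_u/M_uu, and let δ = qε/16. A walk survives l
steps with probability at most (1-q)^l, so stopping at the first l with (1-q)^l ≤ δ costs an error
of at most δ (`abs_inv_mul_sum_sub_killedAt_le`). By Hoeffding's inequality and a union bound over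
the pairs, N = ⌈(c+3)⌈log₂ n⌉/δ²⌉ walks per vertex give all frequencies up to δ with the required
probability (`tapeLaw_exists_killFrequency`). Dividing the total error qε/8 by s_v ≥ q M_vv leaves
ε/(8 M_vv) ≤ εR/8, because R(u,v) is at least 1/M_uu and 1/M_vv (`inv_diag_le_effectiveResistance`).
Four such terms amount to εR/2 (`isApprox_effectiveResistance`).

Time: one pass over the O(m) stored entries yields prefix sums, and each move is then a binary
search with O(log n) steps. The walks need n·N·l moves with l of order log(1/δ)/q. Here q ≥ α/(1+α)
bounds q⁻³ by 4(1+α⁻³), and q ≥ 1/(nW) bounds log(1/δ) by 5 log(nW/ε) (`walkTime_le`). The table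
with n² cells costs nothing to create since arrays start at zero. Killed walks keep drawing
variates, so each walk owns a fixed block of the tape, and disjoint blocks are independent
(`iIndepFun_walk`). The programs are verified by loop invariants that compare the machine with the
function `walk` (`runs_buildProg`).

For the eigenvalue bound, S = M - ssᵀ/σ with σ = ∑ s_u. On vectors z orthogonal to s the form of S
is that of M, which is at least ∑ s_u z_u², hence at least α/(1+α) ∑ M_uu z_u², and M_uu ≥ S_uu. The
min-max principle finishes the proof (`le_secondSmallestEigenvalue`). -/

lemma pseudoInverse_quadraticForm {V : Type*} [Fintype V] [DecidableEq V] {L : Matrix V V ℝ}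
    (hL : L.IsHermitian) (z : V → ℝ) :
    (L *ᵥ z) ⬝ᵥ (pseudoInverse L *ᵥ (L *ᵥ z)) = z ⬝ᵥ (L *ᵥ z) := by
  set b := L *ᵥ z with hb
  have hsym : Lᵀ = L := by
    have h := hL.eq
    rwa [Matrix.conjTranspose_eq_transpose_of_trivial] at h
  let ψ : V → V → ℝ := fun i a => hL.eigenvectorBasis i a
  have hψ : ∀ i, L *ᵥ ψ i = hL.eigenvalues i • ψ i := fun i => hL.mulVec_eigenvectorBasis i
  have hbψ : ∀ i, ψ i ⬝ᵥ b = hL.eigenvalues i * (ψ i ⬝ᵥ z) := by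
    intro i
    rw [hb, Matrix.dotProduct_mulVec, ← Matrix.mulVec_transpose, hsym, hψ, smul_dotProduct,
      smul_eq_mul]
  have hpar : z ⬝ᵥ b = ∑ i, (ψ i ⬝ᵥ z) * (ψ i ⬝ᵥ b) := by
    have h := (hL.eigenvectorBasis).sum_inner_mul_inner (WithLp.toLp 2 z) (WithLp.toLp 2 b)
    simp only [EuclideanSpace.inner_eq_star_dotProduct, star_trivial] at h
    rw [dotProduct_comm z b, ← h]
    refine Finset.sum_congr rfl fun i _ => ?_
    rw [dotProduct_comm b]
  rw [hpar, pseudoInverse, dif_pos hL, Matrix.sum_mulVec, dotProduct_sum]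
  refine Finset.sum_congr rfl fun i _ => ?_
  have : vecMulVec (ψ i) (ψ i) *ᵥ b = (ψ i ⬝ᵥ b) • ψ i := by
    ext a
    simp [Matrix.vecMulVec_mulVec, mul_comm]
  change b ⬝ᵥ (((hL.eigenvalues i)⁻¹ • vecMulVec (ψ i) (ψ i)) *ᵥ b) = _
  rw [Matrix.smul_mulVec, this, dotProduct_smul, dotProduct_smul, dotProduct_comm b, hbψ]
  simp only [smul_eq_mul]
  -- On the kernel both sides vanish: b = L z has no component along an eigenvector with eigenvalue
  -- 0.
  by_cases h0 : hL.eigenvalues i = 0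
  · simp [h0]
  · field_simp

variable {n : ℕ} {M : Matrix (Fin n) (Fin n) ℝ}

lemma sum_row_eq_diag_sub {u : Fin n} (hoff : ∀ u v, u ≠ v → M u v ≤ 0) :
    ∑ v, M u v = M u u - ∑ v ∈ Finset.univ.erase u, |M u v| := by
  rw [← Finset.add_sum_erase _ _ (Finset.mem_univ u), sub_eq_add_neg, ← Finset.sum_neg_distrib]
  congr 1
  refine Finset.sum_congr rfl fun v hv => ?_
  rw [abs_of_nonpos (hoff u v (Finset.ne_of_mem_erase hv).symm), neg_neg]

lemma laplacianGraph_adj_inl_inr {u : Fin n} (h : (∑ v, M u v) ≠ 0) :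
    (laplacianGraph (laplacianCompletion M)).Adj (Sum.inl u) (Sum.inr ()) := by
  simp [laplacianGraph, laplacianCompletion, h]

lemma laplacianGraph_adj_inl_inl {u v : Fin n} (huv : u ≠ v) (h : M u v ≠ 0) :
    (laplacianGraph (laplacianCompletion M)).Adj (Sum.inl u) (Sum.inl v) := by
  simp [laplacianGraph, laplacianCompletion, h, huv]

/-- Dominance gives a row sum of at least α times the sum of the off-diagonal absolute values. If
the latter is zero, a zero row sum would make u isolated, against connectedness. -/
lemma IsDiagDominant.sum_row_pos {α : ℝ} (hα : 0 < α) (hM : IsDiagDominant α M)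
    (hc : (laplacianGraph (laplacianCompletion M)).Connected) (u : Fin n) :
    0 < ∑ v, M u v := by
  obtain ⟨hsymm, hoff, hdd⟩ := hM
  have habs : ∀ v, 0 ≤ |M u v| := fun v => abs_nonneg _
  have hsum : 0 ≤ ∑ v ∈ Finset.univ.erase u, |M u v| := Finset.sum_nonneg fun v _ => habs v
  have hrow := sum_row_eq_diag_sub (u := u) hoff
  have hge : α * ∑ v ∈ Finset.univ.erase u, |M u v| ≤ ∑ v, M u v := by
    rw [hrow]; linarith [hdd u]
  rcases hsum.eq_or_lt with h0 | hpos
  · refine lt_of_le_of_ne (le_trans (by positivity) hge) fun hz => ?_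
    have hzero : ∀ v, u ≠ v → M u v = 0 := by
      intro v hv
      have := (Finset.sum_eq_zero_iff_of_nonneg fun v _ => habs v).1 h0.symm v
        (Finset.mem_erase.2 ⟨hv.symm, Finset.mem_univ _⟩)
      exact abs_eq_zero.1 this
    have : Nontrivial (Fin n ⊕ Unit) := ⟨Sum.inl u, Sum.inr (), by simp⟩
    obtain ⟨w, hw⟩ := hc.preconnected.exists_adj_of_nontrivial (Sum.inl u)
    rcases w with v | x
    · simp only [laplacianGraph, laplacianCompletion, SimpleGraph.fromRel_adj, ne_eq,
        Matrix.fromBlocks_apply₁₁, Sum.inl.injEq] at hw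
      rcases hw.2 with h | h
      · exact h (hzero v hw.1)
      · exact h (by rw [hsymm.apply]; exact hzero v hw.1)
    · have hcol : ∑ v, M v u = 0 := by
        rw [hz]; exact Finset.sum_congr rfl fun v _ => hsymm.apply u v
      simp only [laplacianGraph, laplacianCompletion, SimpleGraph.fromRel_adj, ne_eq,
        Matrix.fromBlocks_apply₁₂, Matrix.fromBlocks_apply₂₁, Matrix.of_apply, ← hz, hcol] at hw
      simp at hw
  · exact lt_of_lt_of_le (mul_pos hα hpos) hge

/-- A symmetric matrix with non-positive off-diagonal entries and positive row sums. -/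
structure IsGroundedLaplacian (M : Matrix (Fin n) (Fin n) ℝ) : Prop where
  symm : ∀ u v, M v u = M u v
  off : ∀ u v, u ≠ v → M u v ≤ 0
  sum_pos : ∀ u, 0 < ∑ v, M u v

lemma IsDiagDominant.isGroundedLaplacian {α : ℝ} (hα : 0 < α) (hM : IsDiagDominant α M)
    (hc : (laplacianGraph (laplacianCompletion M)).Connected) : IsGroundedLaplacian M :=
  ⟨fun u v => hM.1.apply u v, hM.2.1, hM.sum_row_pos hα hc⟩

namespace IsGroundedLaplacian

lemma sum_le_diag (h : IsGroundedLaplacian M) (u : Fin n) : ∑ v, M u v ≤ M u u := by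
  rw [sum_row_eq_diag_sub h.off]
  have : 0 ≤ ∑ v ∈ Finset.univ.erase u, |M u v| := Finset.sum_nonneg fun v _ => abs_nonneg _
  linarith

lemma diag_pos (h : IsGroundedLaplacian M) (u : Fin n) : 0 < M u u :=
  (h.sum_pos u).trans_le (h.sum_le_diag u)

/-- Minimum principle: at a minimiser w of z with z w < 0, the value (M z)_w = s_w z_w + ∑ M_wv (z_v
- z_w) would be negative. -/
lemma mulVec_nonneg_imp (h : IsGroundedLaplacian M) {z : Fin n → ℝ}
    (hz : ∀ u, 0 ≤ (M *ᵥ z) u) (u : Fin n) : 0 ≤ z u := by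
  have : Nonempty (Fin n) := ⟨u⟩
  obtain ⟨w, hw⟩ := Finite.exists_min z
  refine le_trans ?_ (hw u)
  by_contra! hneg
  have h1 : (M *ᵥ z) w = (∑ v, M w v) * z w + ∑ v, M w v * (z v - z w) := by
    simp only [Matrix.mulVec, dotProduct, Finset.sum_mul, ← Finset.sum_add_distrib]
    exact Finset.sum_congr rfl fun v _ => by ring
  have h2 : ∑ v, M w v * (z v - z w) ≤ 0 := by
    refine Finset.sum_nonpos fun v _ => ?_
    rcases eq_or_ne w v with rfl | hv
    · simp
    · exact mul_nonpos_of_nonpos_of_nonneg (h.off w v hv) (sub_nonneg.2 (hw v))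
  have h3 := hz w
  have h4 := mul_neg_of_pos_of_neg (h.sum_pos w) hneg
  linarith

lemma isUnit (h : IsGroundedLaplacian M) : IsUnit M := by
  rw [← Matrix.mulVec_injective_iff_isUnit]
  refine (injective_iff_map_eq_zero M.mulVecLin).2 fun z hz => ?_
  replace hz : M *ᵥ z = 0 := hz
  ext u
  refine le_antisymm ?_ (h.mulVec_nonneg_imp (z := z) (by simp [hz]) u)
  have := h.mulVec_nonneg_imp (z := -z) (by simp [Matrix.mulVec_neg, hz]) u
  simpa using this

lemma isUnit_det (h : IsGroundedLaplacian M) : IsUnit M.det :=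
  (Matrix.isUnit_iff_isUnit_det _).1 h.isUnit

lemma mulVec_inv_mulVec (h : IsGroundedLaplacian M) (b : Fin n → ℝ) : M *ᵥ (M⁻¹ *ᵥ b) = b := by
  rw [Matrix.mulVec_mulVec, Matrix.mul_nonsing_inv _ h.isUnit_det, Matrix.one_mulVec]

lemma inv_nonneg (h : IsGroundedLaplacian M) (u v : Fin n) : 0 ≤ M⁻¹ u v := by
  have := h.mulVec_nonneg_imp (z := M⁻¹ *ᵥ Pi.single v 1)
    (by rw [h.mulVec_inv_mulVec]; intro w; by_cases hw : w = v <;> simp [hw]) u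
  simpa using this

/-- M maps the all-ones vector to the row sums. In terms of the walk: it is killed somewhere with
probability 1. -/
lemma sum_inv_mul_sum (h : IsGroundedLaplacian M) (u : Fin n) :
    ∑ v, M⁻¹ u v * ∑ w, M v w = 1 := by
  have h1 : M *ᵥ (fun _ => 1) = fun v => ∑ w, M v w := by
    ext v; simp [Matrix.mulVec, dotProduct]
  have h2 : M⁻¹ *ᵥ (M *ᵥ (fun _ => 1)) = fun _ => 1 := by
    rw [Matrix.mulVec_mulVec, Matrix.nonsing_inv_mul _ h.isUnit_det, Matrix.one_mulVec]
  rw [h1] at h2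
  exact congrFun h2 u

lemma inv_mul_sum_le_one (h : IsGroundedLaplacian M) (u v : Fin n) :
    M⁻¹ u v * ∑ w, M v w ≤ 1 := by
  rw [← h.sum_inv_mul_sum u]
  exact Finset.single_le_sum (f := fun v => M⁻¹ u v * ∑ w, M v w)
    (fun v _ => mul_nonneg (h.inv_nonneg u v) (h.sum_pos v).le) (Finset.mem_univ v)

lemma isHermitian_laplacianCompletion (h : IsGroundedLaplacian M) :
    (laplacianCompletion M).IsHermitian := by
  refine Matrix.IsHermitian.ext fun i j => ?_
  rcases i with u | u <;> rcases j with v | v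
  · simpa [laplacianCompletion] using h.symm u v
  · simp only [laplacianCompletion, Matrix.fromBlocks_apply₁₂, Matrix.fromBlocks_apply₂₁,
      Matrix.of_apply, star_trivial, neg_inj]
    exact Finset.sum_congr rfl fun v _ => h.symm u v
  · simp only [laplacianCompletion, Matrix.fromBlocks_apply₁₂, Matrix.fromBlocks_apply₂₁,
      Matrix.of_apply, star_trivial, neg_inj]
    exact Finset.sum_congr rfl fun u _ => h.symm u v
  · simp [laplacianCompletion]

/-- Fixing the potential of x at 0 solves the Laplacian system; the equation at x holds because the
currents b sum to zero. -/
lemma laplacianCompletion_mulVec (h : IsGroundedLaplacian M) {b : Fin n → ℝ}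
    (hb : ∑ u, b u = 0) :
    laplacianCompletion M *ᵥ Sum.elim (M⁻¹ *ᵥ b) (fun _ => 0) = Sum.elim b (fun _ => 0) := by
  rw [laplacianCompletion, Matrix.fromBlocks_mulVec]
  ext i
  rcases i with u | u
  · simp only [Sum.elim_comp_inl, Sum.elim_comp_inr, Sum.elim_inl, Pi.add_apply,
      h.mulVec_inv_mulVec]
    simp [Matrix.mulVec, dotProduct]
  · simp only [Sum.elim_comp_inl, Sum.elim_comp_inr, Sum.elim_inr, Pi.add_apply]
    have h1 : ∑ v, (∑ u, M u v) * (M⁻¹ *ᵥ b) v = ∑ u, (M *ᵥ (M⁻¹ *ᵥ b)) u := by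
      simp only [Finset.sum_mul]
      rw [Finset.sum_comm]
      simp only [Matrix.mulVec, dotProduct]
    rw [h.mulVec_inv_mulVec, hb] at h1
    simp only [Matrix.mulVec, dotProduct, Matrix.of_apply, neg_mul, Finset.sum_neg_distrib,
      mul_zero, Finset.sum_const_zero, add_zero, neg_eq_zero] at h1 ⊢
    exact h1

lemma effectiveResistance_eq_dotProduct (h : IsGroundedLaplacian M) (u v : Fin n) :
    effectiveResistance (laplacianCompletion M) (Sum.inl u) (Sum.inl v) =
      (Pi.single u 1 - Pi.single v 1) ⬝ᵥ (M⁻¹ *ᵥ (Pi.single u 1 - Pi.single v 1)) := by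
  set b : Fin n → ℝ := Pi.single u 1 - Pi.single v 1 with hb
  have hsum : ∑ w, b w = 0 := by simp [hb]
  have hb' : (Pi.single (Sum.inl u) (1 : ℝ) - Pi.single (Sum.inl v) (1 : ℝ) : Fin n ⊕ Unit → ℝ) =
      Sum.elim b (fun _ => 0) := by
    ext i
    rcases i with w | w <;> simp [hb, Pi.single_apply]
  rw [effectiveResistance, hb', ← h.laplacianCompletion_mulVec hsum,
    pseudoInverse_quadraticForm h.isHermitian_laplacianCompletion,
    h.laplacianCompletion_mulVec hsum]
  simp [dotProduct, Fintype.sum_sum_type, mul_comm]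

lemma effectiveResistance_eq (h : IsGroundedLaplacian M) (u v : Fin n) :
    effectiveResistance (laplacianCompletion M) (Sum.inl u) (Sum.inl v) =
      M⁻¹ u u + M⁻¹ v v - M⁻¹ u v - M⁻¹ v u := by
  rw [h.effectiveResistance_eq_dotProduct]
  simp only [Matrix.mulVec_sub, Matrix.mulVec_single_one, sub_dotProduct, dotProduct_sub,
    single_dotProduct, one_mul, Matrix.col_apply]
  ring

/-- `M` dominates the diagonal matrix with entries `M u u - ∑_{v ≠ u} |M u v|`. -/
lemma sum_mul_sq_le (h : IsGroundedLaplacian M) (z : Fin n → ℝ) :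
    ∑ u, (∑ v, M u v) * z u ^ 2 ≤ z ⬝ᵥ (M *ᵥ z) := by
  have h1 : ∑ u, ∑ v, M u v * (z u ^ 2 - z u * z v) = ∑ u, ∑ v, M u v * (z v ^ 2 - z u * z v) := by
    rw [Finset.sum_comm]
    exact Finset.sum_congr rfl fun u _ => Finset.sum_congr rfl fun v _ => by rw [h.symm u v]; ring
  -- The two sums are equal by symmetry, and they add up to ∑ M_uv (z_u - z_v)², whose terms are
  -- nonpositive.
  have h2 : ∑ u, ∑ v, M u v * (z u ^ 2 - z u * z v) +
      ∑ u, ∑ v, M u v * (z v ^ 2 - z u * z v) ≤ 0 := by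
    simp only [← Finset.sum_add_distrib]
    refine Finset.sum_nonpos fun u _ => Finset.sum_nonpos fun v _ => ?_
    rcases eq_or_ne u v with rfl | huv
    · ring_nf; rfl
    · nlinarith [h.off u v huv, sq_nonneg (z u - z v)]
  have h3 : ∑ u, ∑ v, M u v * (z u ^ 2 - z u * z v) =
      ∑ u, (∑ v, M u v) * z u ^ 2 - z ⬝ᵥ (M *ᵥ z) := by
    simp only [dotProduct, Matrix.mulVec, Finset.sum_mul, Finset.mul_sum,
      ← Finset.sum_sub_distrib]
    exact Finset.sum_congr rfl fun u _ => Finset.sum_congr rfl fun v _ => by ring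
  linarith

lemma dotProduct_mulVec_nonneg (h : IsGroundedLaplacian M) (z : Fin n → ℝ) :
    0 ≤ z ⬝ᵥ (M *ᵥ z) :=
  le_trans (Finset.sum_nonneg fun u _ => mul_nonneg (h.sum_pos u).le (sq_nonneg _))
    (h.sum_mul_sq_le z)

/-- This lower bound turns additive errors in killing probabilities into a relative error in R. It
comes from the dual characterisation of the energy: bᵀM⁻¹b ≥ 2c b_w - c² M_ww for every c, with the
optimal choice c = b_w / M_ww. -/
lemma inv_diag_le_effectiveResistance (h : IsGroundedLaplacian M) {u v : Fin n} (huv : u ≠ v) :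
    (M u u)⁻¹ ≤ effectiveResistance (laplacianCompletion M) (Sum.inl u) (Sum.inl v) ∧
    (M v v)⁻¹ ≤ effectiveResistance (laplacianCompletion M) (Sum.inl u) (Sum.inl v) := by
  rw [h.effectiveResistance_eq_dotProduct]
  set b : Fin n → ℝ := Pi.single u 1 - Pi.single v 1 with hb
  set z := M⁻¹ *ᵥ b with hz
  have hMz : M *ᵥ z = b := h.mulVec_inv_mulVec b
  have hsymm : Mᵀ = M := by ext i j; exact h.symm i j
  have key : ∀ (w : Fin n) (c : ℝ), 2 * c * b w - c ^ 2 * M w w ≤ b ⬝ᵥ z := by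
    -- Expand the nonnegative form of M at M⁻¹b - c 1_w.
    intro w c
    have h0 := h.dotProduct_mulVec_nonneg (z - c • Pi.single w 1)
    have h1 : z ⬝ᵥ M.col w = b w := by
      rw [← hMz]
      simp only [Matrix.mulVec, dotProduct, Matrix.col_apply]
      exact Finset.sum_congr rfl fun x _ => by rw [h.symm x w]; ring
    simp only [Matrix.mulVec_sub, Matrix.mulVec_smul, hMz, Matrix.mulVec_single_one,
      sub_dotProduct, dotProduct_sub, dotProduct_smul, smul_dotProduct, single_dotProduct,
      one_mul, smul_eq_mul, h1, Matrix.col_apply, dotProduct_comm z b] at h0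
    nlinarith
  constructor
  · have hd := h.diag_pos u
    have := key u (M u u)⁻¹
    have hbu : b u = 1 := by simp [hb, huv]
    rw [hbu] at this
    field_simp at this ⊢
    linarith
  · have hd := h.diag_pos v
    have := key v (-(M v v)⁻¹)
    have hbv : b v = -1 := by simp [hb, huv.symm]
    rw [hbv] at this
    field_simp at this ⊢
    linarith

end IsGroundedLaplacian
end LinearAlgebra

/-! ### The killed walk and its truncation. -/

section Walks

open Matrix

variable {n : ℕ} {M : Matrix (Fin n) (Fin n) ℝ}

/-- The substochastic transition matrix of the walk on the original vertices that is killed when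
it moves to the added vertex. -/
noncomputable def killedTransition (M : Matrix (Fin n) (Fin n) ℝ) : Matrix (Fin n) (Fin n) ℝ :=
  Matrix.of fun u v => if u = v then 0 else -M u v / M u u

/-- The probability that the killed walk from `u` is killed at `v` within `l` steps. -/
noncomputable def killedAt (M : Matrix (Fin n) (Fin n) ℝ) (l : ℕ) (u v : Fin n) : ℝ :=
  ∑ k ∈ Finset.range l, (killedTransition M ^ k) u v * ((∑ w, M v w) / M v v)

namespace IsGroundedLaplacian

lemma killedTransition_nonneg (h : IsGroundedLaplacian M) (u v : Fin n) :
    0 ≤ killedTransition M u v := by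
  by_cases huv : u = v
  · simp [killedTransition, huv]
  · simp only [killedTransition, Matrix.of_apply, if_neg huv]
    exact div_nonneg (neg_nonneg.2 (h.off u v huv)) (h.diag_pos u).le

lemma one_sub_killedTransition (h : IsGroundedLaplacian M) (u v : Fin n) :
    (1 - killedTransition M) u v = (M u u)⁻¹ * M u v := by
  have hd := (h.diag_pos u).ne'
  by_cases huv : u = v
  · subst huv; simp [killedTransition, hd]
  · simp [killedTransition, huv]; field_simp

lemma sum_killedTransition (h : IsGroundedLaplacian M) (u : Fin n) :
    ∑ v, killedTransition M u v = 1 - (∑ v, M u v) / M u u := by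
  have h1 : ∑ v, (1 - killedTransition M) u v = (∑ v, M u v) / M u u := by
    simp only [h.one_sub_killedTransition, ← Finset.mul_sum]
    rw [div_eq_mul_inv, mul_comm]
  simp only [Matrix.sub_apply, Finset.sum_sub_distrib, Matrix.one_apply, Finset.sum_ite_eq,
    Finset.mem_univ, if_true] at h1
  linarith

lemma killedTransition_pow_nonneg (h : IsGroundedLaplacian M) (l : ℕ) (u v : Fin n) :
    0 ≤ (killedTransition M ^ l) u v := by
  induction l generalizing u v with
  | zero => rw [pow_zero, Matrix.one_apply]; split_ifs <;> norm_num
  | succ l ih =>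
    rw [pow_succ, Matrix.mul_apply]
    exact Finset.sum_nonneg fun w _ => mul_nonneg (ih u w) (h.killedTransition_nonneg w v)

/-- Each step kills the walk with probability at least q, wherever it is. -/
lemma sum_killedTransition_pow_le (h : IsGroundedLaplacian M) {q : ℝ}
    (hq : ∀ u, q ≤ (∑ v, M u v) / M u u) (l : ℕ) (u : Fin n) :
    ∑ v, (killedTransition M ^ l) u v ≤ (1 - q) ^ l := by
  have hq1 : 0 ≤ 1 - q := by
    have := (hq u).trans (div_le_one_of_le₀ (h.sum_le_diag u) (h.diag_pos u).le)
    linarith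
  induction l generalizing u with
  | zero => simp [Matrix.one_apply]
  | succ l ih =>
    simp only [pow_succ (killedTransition M), Matrix.mul_apply]
    rw [Finset.sum_comm]
    calc ∑ w, ∑ v, (killedTransition M ^ l) u w * killedTransition M w v
        ≤ ∑ w, (killedTransition M ^ l) u w * (1 - q) := by
          refine Finset.sum_le_sum fun w _ => ?_
          rw [← Finset.mul_sum, h.sum_killedTransition]
          exact mul_le_mul_of_nonneg_left (by linarith [hq w])
            (h.killedTransition_pow_nonneg l u w)
      _ ≤ (1 - q) ^ (l + 1) := by
          rw [← Finset.sum_mul, pow_succ]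
          exact mul_le_mul_of_nonneg_right (ih u) hq1

/-- With D the diagonal of M and P the transition matrix, (1 - P) M⁻¹ = D⁻¹. Multiplying by the
geometric sum gives ∑_{k<l} Pᵏ D⁻¹ = M⁻¹ - Pˡ M⁻¹: the truncation error is the chance of surviving l
steps and being killed at v later. -/
lemma inv_mul_sum_sub_killedAt (h : IsGroundedLaplacian M) (l : ℕ) (u v : Fin n) :
    M⁻¹ u v * ∑ w, M v w - killedAt M l u v =
      ∑ w, (killedTransition M ^ l) u w * (M⁻¹ w v * ∑ x, M v x) := by
  set P := killedTransition M
  have h1 : (1 - P) * M⁻¹ = Matrix.diagonal fun v => (M v v)⁻¹ := by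
    ext a b
    rw [Matrix.mul_apply]
    simp only [P, h.one_sub_killedTransition, mul_assoc]
    rw [← Finset.mul_sum, ← Matrix.mul_apply, Matrix.mul_nonsing_inv _ h.isUnit_det]
    by_cases hab : a = b <;> simp [hab, Matrix.one_apply]
  have h2 : (∑ k ∈ Finset.range l, P ^ k) * Matrix.diagonal (fun v => (M v v)⁻¹) =
      M⁻¹ - P ^ l * M⁻¹ := by
    rw [← h1, ← Matrix.mul_assoc, geom_sum_mul_neg, Matrix.sub_mul, Matrix.one_mul]
  have h3 := congrFun (congrFun h2 u) v
  rw [Matrix.mul_diagonal, Matrix.sum_apply, Matrix.sub_apply, Matrix.mul_apply] at h3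
  have h4 : killedAt M l u v = (∑ k ∈ Finset.range l, (P ^ k) u v) * (M v v)⁻¹ * ∑ w, M v w := by
    rw [killedAt, ← Finset.sum_mul]; ring
  rw [h4, h3, sub_mul, Finset.sum_mul, sub_sub_cancel]
  exact Finset.sum_congr rfl fun w _ => by ring

lemma abs_inv_mul_sum_sub_killedAt_le (h : IsGroundedLaplacian M) {q : ℝ}
    (hq : ∀ u, q ≤ (∑ v, M u v) / M u u) (l : ℕ) (u v : Fin n) :
    |M⁻¹ u v * ∑ w, M v w - killedAt M l u v| ≤ (1 - q) ^ l := by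
  rw [h.inv_mul_sum_sub_killedAt, abs_of_nonneg]
  · refine le_trans (Finset.sum_le_sum fun w _ => ?_) (h.sum_killedTransition_pow_le hq l u)
    exact mul_le_of_le_one_right (h.killedTransition_pow_nonneg l u w)
      (h.inv_mul_sum_le_one w v)
  · exact Finset.sum_nonneg fun w _ => mul_nonneg (h.killedTransition_pow_nonneg l u w)
      (mul_nonneg (h.inv_nonneg w v) (h.sum_pos v).le)

/-- Approximate killing probabilities yield approximate effective resistances. -/
lemma isApprox_effectiveResistance (h : IsGroundedLaplacian M) {q ε : ℝ} (hq0 : 0 < q)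
    (hq : ∀ u, q ≤ (∑ v, M u v) / M u u) (hε : 0 < ε) (hε1 : ε ≤ 1) {l : ℕ}
    (hl : (1 - q) ^ l ≤ q * ε / 16) {p : Fin n → Fin n → ℝ}
    (hp : ∀ u v, |p u v - killedAt M l u v| ≤ q * ε / 16) (u v : Fin n) :
    IsApprox ε (effectiveResistance (laplacianCompletion M) (Sum.inl u) (Sum.inl v))
      (p u u / (∑ w, M u w) + p v v / (∑ w, M v w) - p u v / (∑ w, M v w)
        - p v u / (∑ w, M u w)) := by
  rcases eq_or_ne u v with rfl | huv
  · rw [h.effectiveResistance_eq]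
    constructor <;> simp
  obtain ⟨hRu, hRv⟩ := h.inv_diag_le_effectiveResistance huv
  have hReq := h.effectiveResistance_eq u v
  set R := effectiveResistance (laplacianCompletion M) (Sum.inl u) (Sum.inl v)
  have hR : 0 < R := lt_of_lt_of_le (inv_pos.2 (h.diag_pos u)) hRu
  have err : ∀ a b, (M b b)⁻¹ ≤ R → |p a b / (∑ w, M b w) - M⁻¹ a b| ≤ ε / 8 * R := by
    intro a b hb
    have hs := h.sum_pos b
    have hd := h.diag_pos b
    -- Truncation and sampling contribute qε/16 each.
    have h1 : |p a b - M⁻¹ a b * ∑ w, M b w| ≤ q * ε / 8 := by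
      have h2 := h.abs_inv_mul_sum_sub_killedAt_le hq l a b
      have h3 := hp a b
      rw [abs_le] at h2 h3 ⊢
      constructor <;> linarith
    have h4 : p a b / (∑ w, M b w) - M⁻¹ a b = (p a b - M⁻¹ a b * ∑ w, M b w) / ∑ w, M b w := by
      field_simp
    rw [h4, abs_div, abs_of_pos hs, div_le_iff₀ hs]
    have h5 : q * M b b ≤ ∑ w, M b w := (le_div_iff₀ hd).1 (hq b)
    have h6 : 1 ≤ R * M b b := by
      rw [inv_le_iff_one_le_mul₀ hd] at hb; linarith
    calc _ ≤ q * ε / 8 := h1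
      _ ≤ q * ε / 8 * (R * M b b) := le_mul_of_one_le_right (by positivity) h6
      _ = ε / 8 * R * (q * M b b) := by ring
      _ ≤ _ := by gcongr
  have e1 := abs_le.1 (err u u hRu)
  have e2 := abs_le.1 (err v v hRv)
  have e3 := abs_le.1 (err u v hRv)
  have e4 := abs_le.1 (err v u hRu)
  -- The four errors sum to at most εR/2, and (1 - ε/2)(1 + ε) ≥ 1 because ε ≤ 1.
  constructor
  · rw [div_le_iff₀ (by linarith)]
    nlinarith [mul_nonneg hε.le hR.le, mul_nonneg (mul_nonneg hε.le hR.le) (sub_nonneg.2 hε1)]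
  · nlinarith [mul_nonneg hε.le hR.le]

end IsGroundedLaplacian

/-! ### The spectral gap of the Schur complement. -/

/-- The second smallest eigenvalue is at least `c` if the quadratic form is at least `c` times the
squared norm on a hyperplane. -/
lemma le_secondSmallestEigenvalue {n : ℕ} (hn : 2 ≤ n) {A : Matrix (Fin n) (Fin n) ℝ}
    (hA : A.IsHermitian) (c : ℝ) (w : Fin n → ℝ)
    (h : ∀ y : Fin n → ℝ, w ⬝ᵥ y = 0 → c * (y ⬝ᵥ y) ≤ y ⬝ᵥ (A *ᵥ y)) :
    c ≤ secondSmallestEigenvalue hn hA := by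
  by_contra! hlt
  set e : Fin n ≃ Fin (Fintype.card (Fin n)) :=
    (Fintype.equivOfCardEq (Fintype.card_fin (Fintype.card (Fin n)))).symm with he
  have hev : ∀ j, hA.eigenvalues (e.symm j) = hA.eigenvalues₀ j := by
    intro j; simp [Matrix.IsHermitian.eigenvalues, he]
  set j1 : Fin (Fintype.card (Fin n)) := ⟨n - 2, by rw [Fintype.card_fin]; omega⟩ with hj1
  set j2 : Fin (Fintype.card (Fin n)) := ⟨n - 1, by rw [Fintype.card_fin]; omega⟩ with hj2
  have hj : j1 ≠ j2 := by simp [hj1, hj2]; omega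
  have hl1 : hA.eigenvalues (e.symm j1) < c := by rw [hev]; exact hlt
  have hl2 : hA.eigenvalues (e.symm j2) < c := by
    rw [hev]
    refine lt_of_le_of_lt (hA.eigenvalues₀_antitone ?_) hlt
    simp [hj2, Fin.le_def]; omega
  set i1 := e.symm j1
  set i2 := e.symm j2
  have hi : i1 ≠ i2 := fun h => hj (e.symm.injective h)
  let ψ : Fin n → Fin n → ℝ := fun i a => hA.eigenvectorBasis i a
  have hψ : ∀ i, A *ᵥ ψ i = hA.eigenvalues i • ψ i := fun i => hA.mulVec_eigenvectorBasis i
  have horth : ∀ i j, ψ i ⬝ᵥ ψ j = if i = j then 1 else 0 := by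
    intro i j
    have := (orthonormal_iff_ite.1 hA.eigenvectorBasis.orthonormal) j i
    rw [EuclideanSpace.inner_eq_star_dotProduct, star_trivial] at this
    rw [show ψ i ⬝ᵥ ψ j = _ from this]
    simp [eq_comm]
  -- The two eigenvectors of the smallest eigenvalues span a plane, which meets the hyperplane in a
  -- nonzero vector; if both eigenvalues were below c, the form there would be too small.
  obtain ⟨a, b, hab, hw⟩ : ∃ a b : ℝ, (0 < a ^ 2 + b ^ 2) ∧
      a * (w ⬝ᵥ ψ i1) + b * (w ⬝ᵥ ψ i2) = 0 := by
    by_cases h0 : w ⬝ᵥ ψ i1 = 0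
    · exact ⟨1, 0, by norm_num, by simp [h0]⟩
    · exact ⟨w ⬝ᵥ ψ i2, -(w ⬝ᵥ ψ i1),
        add_pos_of_nonneg_of_pos (sq_nonneg _) (sq_pos_iff.2 (neg_ne_zero.2 h0)), by ring⟩
  have h1 := h (a • ψ i1 + b • ψ i2) (by simpa [dotProduct_add] using hw)
  simp only [Matrix.mulVec_add, Matrix.mulVec_smul, hψ, dotProduct_add, add_dotProduct,
    smul_dotProduct, dotProduct_smul, horth, smul_eq_mul, hi, hi.symm, if_true, if_false] at h1
  rcases eq_or_ne a 0 with rfl | ha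
  · have hb : 0 < b ^ 2 := by simpa using hab
    nlinarith [mul_lt_mul_of_pos_left hl2 hb]
  · have ha : 0 < a ^ 2 := by positivity
    nlinarith [mul_lt_mul_of_pos_left hl1 ha, mul_le_mul_of_nonneg_left hl2.le (sq_nonneg b)]

lemma schurOntoLeft_laplacianCompletion_apply (u v : Fin n) :
    schurOntoLeft (laplacianCompletion M) u v =
      M u v - (∑ w, M u w) * (∑ a, ∑ b, M a b)⁻¹ * ∑ w, M w v := by
  have hinv : ((laplacianCompletion M).toBlocks₂₂)⁻¹ =
      Matrix.of fun _ _ => (∑ a, ∑ b, M a b)⁻¹ := by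
    rw [Matrix.inv_subsingleton]
    ext i j
    simp [laplacianCompletion, Ring.inverse_eq_inv']
  rw [schurOntoLeft, Matrix.sub_apply, hinv]
  simp [laplacianCompletion, Matrix.mul_apply, Matrix.toBlocks₁₁, Matrix.toBlocks₁₂,
    Matrix.toBlocks₂₁]

theorem IsDiagDominant.div_le_secondSmallestEigenvalue (hn : 2 ≤ n) {α : ℝ} (hα : 0 < α)
    (hM : IsDiagDominant α M) (hc : (laplacianGraph (laplacianCompletion M)).Connected) :
    ∃ h : (normalizedLaplacian (schurOntoLeft (laplacianCompletion M))).IsHermitian,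
      α / (1 + α) ≤ secondSmallestEigenvalue hn h := by
  have hG := hM.isGroundedLaplacian hα hc
  set S := schurOntoLeft (laplacianCompletion M) with hS
  set s : Fin n → ℝ := fun u => ∑ w, M u w with hs
  set σ : ℝ := ∑ u, s u with hσ
  have hcol : ∀ v, ∑ w, M w v = s v := fun v =>
    Finset.sum_congr rfl fun w _ => hG.symm v w
  have hSa : ∀ u v, S u v = M u v - s u * s v / σ := by
    intro u v
    rw [hS, schurOntoLeft_laplacianCompletion_apply, hcol]
    change M u v - s u * σ⁻¹ * s v = _
    ring
  have hspos : ∀ u, 0 < s u := hG.sum_pos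
  have hslt : ∀ u, s u < σ := by
    intro u
    have : Nontrivial (Fin n) := Fin.nontrivial_iff_two_le.2 hn
    obtain ⟨v, hv⟩ := exists_ne u
    have := Finset.sum_le_sum_of_subset_of_nonneg (f := s) (Finset.subset_univ {u, v})
      fun i _ _ => (hspos i).le
    rw [Finset.sum_pair hv.symm] at this
    linarith [hspos v]
  have hSpos : ∀ u, 0 < S u u := by
    intro u
    have hσ0 := (hspos u).trans (hslt u)
    rw [hSa, sub_pos, div_lt_iff₀ hσ0]
    have h1 : s u ≤ M u u := hG.sum_le_diag u
    nlinarith [hspos u, hslt u, hG.diag_pos u]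
  have hSle : ∀ u, S u u ≤ M u u := by
    intro u
    have hσ0 := (hspos u).trans (hslt u)
    rw [hSa]
    have := hspos u
    have : 0 ≤ s u * s u / σ := by positivity
    linarith
  set r : Fin n → ℝ := fun i => (Real.sqrt (S i i))⁻¹ with hr
  have hN : ∀ u v, normalizedLaplacian S u v = r u * S u v * r v := by
    intro u v
    simp [normalizedLaplacian, hr]
  have hherm : (normalizedLaplacian S).IsHermitian := by
    refine Matrix.IsHermitian.ext fun u v => ?_
    rw [hN, hN, hSa, hSa, hG.symm u v, star_trivial]
    ring
  -- The hyperplane is chosen so that z = D^{-1/2} y is orthogonal to the row sums s, which kills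
  -- the rank-one part of S = M - ssᵀ/σ.
  refine ⟨hherm, le_secondSmallestEigenvalue hn hherm _ (fun u => s u * r u) fun y hy => ?_⟩
  set z : Fin n → ℝ := fun u => r u * y u with hz
  have hsz : ∑ u, s u * z u = 0 := by
    rw [← hy]; exact Finset.sum_congr rfl fun u _ => by simp [hz]; ring
  have hyz : ∀ u, y u ^ 2 = S u u * z u ^ 2 := by
    intro u
    have := hSpos u
    have h2 := Real.sq_sqrt this.le
    have h3 : r u ^ 2 = (S u u)⁻¹ := by rw [hr]; simp only [inv_pow, h2]
    rw [hz]; simp only [mul_pow, h3]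
    field_simp
  have hform : y ⬝ᵥ (normalizedLaplacian S *ᵥ y) = z ⬝ᵥ (M *ᵥ z) := by
    have h1 : y ⬝ᵥ (normalizedLaplacian S *ᵥ y) =
        ∑ u, ∑ v, (z u * M u v * z v - (s u * z u) * (s v * z v) / σ) := by
      simp only [dotProduct, Matrix.mulVec, Finset.mul_sum, hN, hSa]
      exact Finset.sum_congr rfl fun u _ => Finset.sum_congr rfl fun v _ => by
        simp only [hz]; ring
    rw [h1]
    simp only [Finset.sum_sub_distrib, ← Finset.sum_div, ← Finset.mul_sum, hsz]
    simp only [dotProduct, Matrix.mulVec, Finset.mul_sum, mul_zero, Finset.sum_const_zero,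
      zero_div, sub_zero]
    exact Finset.sum_congr rfl fun u _ => Finset.sum_congr rfl fun v _ => by ring
  rw [hform]
  refine le_trans ?_ (hG.sum_mul_sq_le z)
  simp only [dotProduct, ← pow_two, hyz, Finset.mul_sum]
  refine Finset.sum_le_sum fun u _ => ?_
  rw [← mul_assoc]
  refine mul_le_mul_of_nonneg_right ?_ (sq_nonneg _)
  have h1 := hM.2.2 u
  have h2 := sum_row_eq_diag_sub (M := M) (u := u) hM.2.1
  refine (mul_le_mul_of_nonneg_left (hSle u) (by positivity)).trans ?_
  rw [h2, div_mul_eq_mul_div, div_le_iff₀ (by linarith)]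
  linarith

end Walks

/-! ### The law of the simulated walks and concentration of frequencies. -/

section RandomWalk

open ProbabilityTheory Measure

variable {n : ℕ}

/-- One step of a walk with a flag telling whether it has been killed; `f v U` is the move of a
walk at `v` that has not been killed, where `U` is the random variate. -/
def walkStep (f : Fin n → unitInterval → Fin n × Bool) (x : Fin n × Bool) (U : unitInterval) :
    Fin n × Bool :=
  if x.2 then x else f x.1 U

/-- The walk with starting point `u` that is driven by the variates `τ`. -/
def walk (f : Fin n → unitInterval → Fin n × Bool) (u : Fin n) (τ : ℕ → unitInterval) :
    ℕ → Fin n × Bool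
  | 0 => (u, false)
  | k + 1 => walkStep f (walk f u τ k) (τ k)

lemma walk_congr (f : Fin n → unitInterval → Fin n × Bool) (u : Fin n) {τ τ' : ℕ → unitInterval}
    (k : ℕ) (h : ∀ j < k, τ j = τ' j) : walk f u τ k = walk f u τ' k := by
  induction k with
  | zero => rfl
  | succ k ih => rw [walk, walk, ih fun j hj => h j (hj.trans k.lt_succ_self), h k k.lt_succ_self]

lemma measurable_walkStep {f : Fin n → unitInterval → Fin n × Bool} (hf : ∀ u, Measurable (f u))
    (x : Fin n × Bool) : Measurable (walkStep f x) := by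
  unfold walkStep
  by_cases hx : x.2 = true
  · simp [hx]
  · simpa [hx] using hf x.1

lemma measurable_walk {f : Fin n → unitInterval → Fin n × Bool} (hf : ∀ u, Measurable (f u))
    (u : Fin n) (k : ℕ) : Measurable fun τ => walk f u τ k := by
  induction k with
  | zero => exact measurable_const
  | succ k ih =>
    have h : Measurable fun p : (Fin n × Bool) × unitInterval => walkStep f p.1 p.2 :=
      measurable_from_prod_countable_right fun x => measurable_walkStep hf x
    exact h.comp (ih.prodMk (measurable_pi_apply k))

instance : IsProbabilityMeasure RealRAM.tapeLaw := by
  unfold RealRAM.tapeLaw; infer_instance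

lemma tapeLaw_map_eval (k : ℕ) :
    RealRAM.tapeLaw.map (fun τ => τ k) = (volume : Measure unitInterval) :=
  infinitePi_map_eval (fun _ : ℕ => (volume : Measure unitInterval)) k

lemma tapeLaw_map_comp {g : ℕ → ℕ} (hg : Function.Injective g) :
    RealRAM.tapeLaw.map (fun τ k => τ (g k)) = RealRAM.tapeLaw :=
  map_infinitePi_infinitePi_of_inj (P := fun _ : ℕ => (volume : Measure unitInterval)) hg

lemma iIndepFun_tapeLaw : iIndepFun (fun (k : ℕ) (τ : ℕ → unitInterval) => τ k) RealRAM.tapeLaw :=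
  iIndepFun_infinitePi (P := fun _ : ℕ => (volume : Measure unitInterval))
    (X := fun _ x => x) fun _ => measurable_id

/-- Extend a finite sequence of variates by zeros. -/
noncomputable def extendTape {l : ℕ} (t : Fin l → unitInterval) (j : ℕ) : unitInterval :=
  if h : j < l then t ⟨j, h⟩ else 0

lemma measurable_extendTape (l : ℕ) :
    Measurable (extendTape : (Fin l → unitInterval) → ℕ → unitInterval) := by
  refine measurable_pi_iff.2 fun j => ?_
  unfold extendTape
  by_cases h : j < l
  · simp only [h, dite_true]; exact measurable_pi_apply _
  · simp [h]

lemma walk_extendTape (f : Fin n → unitInterval → Fin n × Bool) (u : Fin n)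
    (τ : ℕ → unitInterval) (l : ℕ) :
    walk f u (extendTape fun j : Fin l => τ j) l = walk f u τ l :=
  walk_congr f u l fun j hj => by simp [extendTape, hj]

/-- The state after k steps is a function of the variates before position k. -/
lemma indepFun_walk_eval {f : Fin n → unitInterval → Fin n × Bool} (hf : ∀ u, Measurable (f u))
    (u : Fin n) (k : ℕ) :
    IndepFun (fun τ => walk f u τ k) (fun τ => τ k) RealRAM.tapeLaw := by
  have h := iIndepFun_tapeLaw.indepFun_finset (Finset.range k) {k} (by simp)
    fun i => measurable_pi_apply i
  have h1 : Measurable fun t : (Finset.range k → unitInterval) =>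
      walk f u (extendTape fun j : Fin k => t ⟨j, Finset.mem_range.2 j.2⟩) k :=
    (measurable_walk hf u k).comp ((measurable_extendTape k).comp
      (measurable_pi_iff.2 fun j => measurable_pi_apply _))
  have h2 : Measurable fun t : (({k} : Finset ℕ) → unitInterval) =>
      t ⟨k, Finset.mem_singleton_self k⟩ := measurable_pi_apply _
  have h3 := h.comp h1 h2
  have e : (fun t : (Finset.range k → unitInterval) =>
      walk f u (extendTape fun j : Fin k => t ⟨j, Finset.mem_range.2 j.2⟩) k) ∘
      (fun (a : ℕ → unitInterval) (i : Finset.range k) => a i) = fun τ => walk f u τ k := by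
    funext τ
    exact walk_extendTape f u τ k
  rw [e] at h3
  exact h3

/-- The Markov property: condition on the state after k steps, which is independent of the next
variate. -/
lemma tapeLaw_walk_succ {f : Fin n → unitInterval → Fin n × Bool} (hf : ∀ u, Measurable (f u))
    (u : Fin n) (k : ℕ) (x : Fin n × Bool) :
    RealRAM.tapeLaw.real {τ | walk f u τ (k + 1) = x} =
      ∑ y, RealRAM.tapeLaw.real {τ | walk f u τ k = y} *
        (volume : Measure unitInterval).real {U | walkStep f y U = x} := by
  have hset : {τ | walk f u τ (k + 1) = x} =
      ⋃ y ∈ (Finset.univ : Finset (Fin n × Bool)),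
        ({τ | walk f u τ k = y} ∩ {τ | walkStep f y (τ k) = x}) := by
    ext τ; simp [walk]
  have hm1 : ∀ y, MeasurableSet {τ | walk f u τ k = y} := fun y =>
    measurable_walk hf u k (measurableSet_singleton y)
  have hm2 : ∀ y, MeasurableSet {U | walkStep f y U = x} := fun y =>
    measurable_walkStep hf y (measurableSet_singleton x)
  rw [hset, measureReal_biUnion_finset]
  · refine Finset.sum_congr rfl fun y _ => ?_
    have h := (indepFun_walk_eval hf u k).measure_inter_preimage_eq_mul {y}
      {U | walkStep f y U = x} (measurableSet_singleton y) (hm2 y)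
    rw [← tapeLaw_map_eval k, map_measureReal_apply (measurable_pi_apply k) (hm2 y)]
    simp only [measureReal_def]
    rw [← ENNReal.toReal_mul]
    exact congrArg ENNReal.toReal h
  · intro y _ y' _ hne
    refine Set.disjoint_left.2 fun τ h1 h2 => hne ?_
    exact h1.1.symm.trans h2.1
  · intro y _
    exact (hm1 y).inter ((hm2 y).preimage (measurable_pi_apply k))

/-- The law of the walk whose moves have the law of the walk killed when it leaves the original
vertices. -/
lemma tapeLaw_walk {M : Matrix (Fin n) (Fin n) ℝ} {f : Fin n → unitInterval → Fin n × Bool}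
    (hf : ∀ u, Measurable (f u))
    (hmove : ∀ u w, (volume : Measure unitInterval).real {U | f u U = (w, false)} =
      killedTransition M u w)
    (hkill : ∀ u w, (volume : Measure unitInterval).real {U | f u U = (w, true)} =
      if u = w then (∑ x, M w x) / M w w else 0)
    (u : Fin n) (k : ℕ) (v : Fin n) :
    RealRAM.tapeLaw.real {τ | walk f u τ k = (v, false)} = (killedTransition M ^ k) u v ∧
    RealRAM.tapeLaw.real {τ | walk f u τ k = (v, true)} = killedAt M k u v := by
  have h1 : ∀ y x : Fin n, (volume : Measure unitInterval).real
      {U | walkStep f (y, true) U = (x, false)} = 0 := by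
    intro y x; simp [walkStep]
  have h2 : ∀ y x : Fin n, (volume : Measure unitInterval).real
      {U | walkStep f (y, true) U = (x, true)} = if y = x then 1 else 0 := by
    intro y x
    by_cases h : y = x <;> simp [walkStep, h]
  have h3 : ∀ y x : Fin n, (volume : Measure unitInterval).real
      {U | walkStep f (y, false) U = (x, false)} = killedTransition M y x := by
    intro y x; simpa [walkStep] using hmove y x
  have h4 : ∀ y x : Fin n, (volume : Measure unitInterval).real
      {U | walkStep f (y, false) U = (x, true)} =
      if y = x then (∑ w, M x w) / M x x else 0 := by
    intro y x; simpa [walkStep] using hkill y x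
  induction k generalizing v with
  | zero =>
    constructor
    · by_cases h : u = v <;> simp [walk, h]
    · simp [walk, killedAt]
  | succ k ih =>
    constructor
    · rw [tapeLaw_walk_succ hf, Fintype.sum_prod_type]
      simp only [Fintype.sum_bool, h1, h3, mul_zero, zero_add, (ih _).1]
      rw [pow_succ, Matrix.mul_apply]
    · rw [tapeLaw_walk_succ hf, Fintype.sum_prod_type]
      simp only [Fintype.sum_bool, h2, h4, (ih _).1, (ih _).2, mul_ite, mul_one, mul_zero,
        Finset.sum_add_distrib, Finset.sum_ite_eq', Finset.mem_univ, if_true]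
      rw [killedAt, killedAt, Finset.sum_range_succ]

/-- The walks read disjoint blocks of the tape: (i, j) ↦ b + i l + j is injective for j < l, so the
blocks form an independent family by currying the product measure. -/
lemma iIndepFun_walk {f : Fin n → unitInterval → Fin n × Bool} (hf : ∀ u, Measurable (f u))
    (u : Fin n) (b l : ℕ) :
    iIndepFun (fun (i : ℕ) (τ : ℕ → unitInterval) => walk f u (fun j => τ (b + i * l + j)) l)
      RealRAM.tapeLaw := by
  have hinj : Function.Injective fun p : ℕ × Fin l => b + p.1 * l + p.2 := by
    rintro ⟨i, j⟩ ⟨i', j'⟩ h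
    have h0 : (j : ℕ) + l * i = j' + l * i' := by
      simp only at h; rw [mul_comm l, mul_comm l]; omega
    have hl : 0 < l := j.pos
    have h1 := congrArg (· / l) h0
    have h2 := congrArg (· % l) h0
    simp only [Nat.add_mul_div_left _ _ hl, Nat.div_eq_of_lt j.2, Nat.div_eq_of_lt j'.2,
      zero_add, Nat.add_mul_mod_self_left, Nat.mod_eq_of_lt j.2, Nat.mod_eq_of_lt j'.2] at h1 h2
    exact Prod.ext h1 (Fin.ext h2)
  have hlaw : RealRAM.tapeLaw.map (fun τ (i : ℕ) (j : Fin l) => τ (b + i * l + j)) =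
      infinitePi fun _ : ℕ => infinitePi fun _ : Fin l => (volume : Measure unitInterval) := by
    have h1 := map_infinitePi_infinitePi_of_inj
      (P := fun _ : ℕ => (volume : Measure unitInterval)) hinj
    have h2 := infinitePi_map_curry
      (fun (_ : ℕ) (_ : Fin l) => (volume : Measure unitInterval))
    rw [← h2]
    change _ = map _ (infinitePi fun _ : ℕ × Fin l => (volume : Measure unitInterval))
    rw [← h1, map_map (by fun_prop) (by fun_prop)]
    rfl
  have hind : iIndepFun (fun (i : ℕ) (τ : ℕ → unitInterval) (j : Fin l) => τ (b + i * l + j))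
      RealRAM.tapeLaw := by
    rw [iIndepFun_iff_map_fun_eq_infinitePi_map (by fun_prop), hlaw]
    congr 1
    funext i
    refine (map_infinitePi_infinitePi_of_inj
      (P := fun _ : ℕ => (volume : Measure unitInterval))
      (f := fun j : Fin l => b + i * l + j) ?_).symm
    intro j j' h
    simp only at h
    exact Fin.ext (by omega)
  have h := hind.comp (fun _ t => walk f u (extendTape t) l)
    fun _ => (measurable_walk hf u l).comp (measurable_extendTape l)
  have e : (fun (i : ℕ) => (fun t : Fin l → unitInterval => walk f u (extendTape t) l) ∘
      fun (τ : ℕ → unitInterval) (j : Fin l) => τ (b + i * l + j)) =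
      fun i τ => walk f u (fun j => τ (b + i * l + j)) l := by
    funext i τ
    exact walk_extendTape f u (fun j => τ (b + i * l + j)) l
  rw [e] at h
  exact h

/-- Hoeffding's inequality for frequencies. -/
lemma measureReal_abs_frequency_sub_le {Ω : Type*} [MeasurableSpace Ω] {μ : Measure Ω}
    [IsProbabilityMeasure μ] {Y : ℕ → Ω → ℝ} (hind : iIndepFun Y μ) (hm : ∀ i, Measurable (Y i))
    (h01 : ∀ i ω, Y i ω ∈ Set.Icc 0 1) {p : ℝ} (hp : ∀ i, μ[Y i] = p) {N : ℕ} (hN : 0 < N)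
    {δ : ℝ} (hδ : 0 ≤ δ) :
    μ.real {ω | δ < |(∑ i ∈ Finset.range N, Y i ω) / N - p|} ≤
      2 * Real.exp (-(2 * N * δ ^ 2)) := by
  have hN' : (0 : ℝ) < N := by exact_mod_cast hN
  have hsub : ∀ i, HasSubgaussianMGF (fun ω => Y i ω - p) ((‖(1 : ℝ) - 0‖₊ / 2) ^ 2) μ := by
    intro i
    have := hasSubgaussianMGF_of_mem_Icc (hm i).aemeasurable (ae_of_all μ (h01 i))
    simpa only [hp] using this
  have hind1 : iIndepFun (fun i ω => Y i ω - p) μ :=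
    hind.comp (fun _ x => x - p) fun _ => by fun_prop
  have hind2 : iIndepFun (fun i ω => -(Y i ω - p)) μ :=
    hind.comp (fun _ x => -(x - p)) fun _ => by fun_prop
  -- A variable in [0, 1] is sub-Gaussian with variance proxy 1/4, so the exponent for N of them is
  -- -(Nδ)²/(N/2).
  have hc : -(N * δ) ^ 2 / (2 * N * (((‖(1 : ℝ) - 0‖₊ / 2) ^ 2 : NNReal) : ℝ)) =
      -(2 * N * δ ^ 2) := by
    simp; field_simp
  have b1 := HasSubgaussianMGF.measure_sum_range_ge_le_of_iIndepFun hind1 (n := N)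
    (fun i _ => hsub i) (mul_nonneg hN'.le hδ)
  have b2 := HasSubgaussianMGF.measure_sum_range_ge_le_of_iIndepFun hind2 (n := N)
    (fun i _ => (hsub i).neg) (mul_nonneg hN'.le hδ)
  rw [hc] at b1 b2
  refine le_trans (measureReal_mono (s₂ := {ω | N * δ ≤ ∑ i ∈ Finset.range N, (Y i ω - p)} ∪
    {ω | N * δ ≤ ∑ i ∈ Finset.range N, -(Y i ω - p)}) ?_) ?_
  · intro ω hω
    have hS : ∑ i ∈ Finset.range N, (Y i ω - p) =
        N * ((∑ i ∈ Finset.range N, Y i ω) / N - p) := by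
      rw [Finset.sum_sub_distrib]; simp; field_simp
    rcases lt_abs.1 (show δ < _ from hω) with h | h
    · left
      rw [Set.mem_ofPred_eq, hS]
      exact mul_le_mul_of_nonneg_left h.le hN'.le
    · right
      rw [Set.mem_ofPred_eq, Finset.sum_neg_distrib, hS, ← mul_neg]
      exact mul_le_mul_of_nonneg_left h.le hN'.le
  · exact (measureReal_union_le _ _).trans (by linarith)

/-- The frequency with which `N` walks from `u`, driven by consecutive blocks of `l` variates from
position `b` on, have been killed at `v`. -/
noncomputable def killFrequency (f : Fin n → unitInterval → Fin n × Bool) (b l N : ℕ) (u v : Fin n)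
    (τ : ℕ → unitInterval) : ℝ :=
  (∑ i ∈ Finset.range N,
    if walk f u (fun j => τ (b + i * l + j)) l = (v, true) then (1 : ℝ) else 0) / N

lemma tapeLaw_killFrequency {M : Matrix (Fin n) (Fin n) ℝ}
    {f : Fin n → unitInterval → Fin n × Bool}
    (hf : ∀ u, Measurable (f u))
    (hmove : ∀ u w, (volume : Measure unitInterval).real {U | f u U = (w, false)} =
      killedTransition M u w)
    (hkill : ∀ u w, (volume : Measure unitInterval).real {U | f u U = (w, true)} =
      if u = w then (∑ x, M w x) / M w w else 0)
    (b l : ℕ) {N : ℕ} (hN : 0 < N) (u v : Fin n) {δ : ℝ} (hδ : 0 ≤ δ) :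
    RealRAM.tapeLaw.real {τ | δ < |killFrequency f b l N u v τ - killedAt M l u v|} ≤
      2 * Real.exp (-(2 * N * δ ^ 2)) := by
  have hw : ∀ i, Measurable fun τ : ℕ → unitInterval => walk f u (fun j => τ (b + i * l + j)) l :=
    fun i => (measurable_walk hf u l).comp (by fun_prop)
  let g : Fin n × Bool → ℝ := fun x => if x = (v, true) then 1 else 0
  have hg : Measurable g := measurable_of_countable _
  let Y : ℕ → (ℕ → unitInterval) → ℝ := fun i τ => g (walk f u (fun j => τ (b + i * l + j)) l)
  have hind : iIndepFun Y RealRAM.tapeLaw := (iIndepFun_walk hf u b l).comp (fun _ => g) fun _ => hg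
  refine measureReal_abs_frequency_sub_le (Y := Y) hind (fun i => hg.comp (hw i))
    (fun i τ => ?_) (fun i => ?_) hN hδ
  · simp only [Y, g]
    split_ifs <;> simp
  -- The i-th walk has the law of a walk started at tape position 0, since shifting positions
  -- preserves the law of the tape.
  · have hinj : Function.Injective fun j : ℕ => b + i * l + j := fun x y h => by simpa using h
    have hs : MeasurableSet {τ | walk f u τ l = (v, true)} :=
      measurable_walk hf u l (measurableSet_singleton (v, true))
    have hshift : Measurable fun (τ : ℕ → unitInterval) (j : ℕ) => τ (b + i * l + j) := by fun_prop
    have h1 : RealRAM.tapeLaw.real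
        ((fun (τ : ℕ → unitInterval) (j : ℕ) => τ (b + i * l + j)) ⁻¹'
          {τ | walk f u τ l = (v, true)}) = killedAt M l u v := by
      rw [← map_measureReal_apply hshift hs, tapeLaw_map_comp hinj]
      exact (tapeLaw_walk hf hmove hkill u l v).2
    rw [← h1, ← integral_indicator_one (hs.preimage hshift)]
    refine integral_congr_ae (ae_of_all _ fun τ => ?_)
    simp [Y, g, Set.indicator_apply]

end RandomWalk

/-! ### Sampling a move by inverting prefix sums of a sparse row. -/

section SparseRows

open RealRAM

/-- The sum of the absolute values of the negative entries of row `u` that are stored before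
address `k`. -/
noncomputable def offPrefix (ptr : ℕ → ℕ) (val : ℕ → ℝ) (u k : ℕ) : ℝ :=
  ∑ j ∈ Finset.Ico (ptr u) k, max (-val j) 0

/-- The sum of the positive entries of row `u` that are stored before address `k`. -/
noncomputable def posPrefix (ptr : ℕ → ℕ) (val : ℕ → ℝ) (u k : ℕ) : ℝ :=
  ∑ j ∈ Finset.Ico (ptr u) k, max (val j) 0

/-- The first address of row `u` at which the prefix sum of the absolute values of the negative
entries exceeds `x`. -/
noncomputable def searchRow (ptr : ℕ → ℕ) (val : ℕ → ℝ) (u : ℕ) (x : ℝ) : ℕ :=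
  sInf {k | ptr u ≤ k ∧ x < offPrefix ptr val u (k + 1)}

/-- The move of the walk from `u` that is determined by the variate `U`: to a neighbour, or to the
added vertex. -/
noncomputable def rowMove (n : ℕ) (ptr col : ℕ → ℕ) (val : ℕ → ℝ) (u : Fin n)
    (U : unitInterval) : Fin n × Bool :=
  if (U : ℝ) * posPrefix ptr val u (ptr (u + 1)) < offPrefix ptr val u (ptr (u + 1)) then
    (⟨col (searchRow ptr val u ((U : ℝ) * posPrefix ptr val u (ptr (u + 1)))) % n,
      Nat.mod_lt _ u.pos⟩, false)
  else (u, true)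

variable {n : ℕ} {M : Matrix (Fin n) (Fin n) ℝ} {ptr col : ℕ → ℕ} {val : ℕ → ℝ}

lemma offPrefix_mono (u : ℕ) {k k' : ℕ} (h : k ≤ k') :
    offPrefix ptr val u k ≤ offPrefix ptr val u k' :=
  Finset.sum_le_sum_of_subset_of_nonneg (Finset.Ico_subset_Ico_right h)
    fun _ _ _ => le_max_right _ _

lemma offPrefix_nonneg (u k : ℕ) : 0 ≤ offPrefix ptr val u k :=
  Finset.sum_nonneg fun _ _ => le_max_right _ _

lemma offPrefix_succ {u k : ℕ} (h : ptr u ≤ k) :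
    offPrefix ptr val u (k + 1) = offPrefix ptr val u k + max (-val k) 0 :=
  Finset.sum_Ico_succ_top h _

lemma posPrefix_succ {u k : ℕ} (h : ptr u ≤ k) :
    posPrefix ptr val u (k + 1) = posPrefix ptr val u k + max (val k) 0 :=
  Finset.sum_Ico_succ_top h _

lemma searchRow_spec {u : ℕ} {x : ℝ} (hx : 0 ≤ x)
    (hlt : x < offPrefix ptr val u (ptr (u + 1))) :
    searchRow ptr val u x ∈ Set.Ico (ptr u) (ptr (u + 1)) ∧
      offPrefix ptr val u (searchRow ptr val u x) ≤ x ∧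
      x < offPrefix ptr val u (searchRow ptr val u x + 1) := by
  have hlast : ptr u < ptr (u + 1) := by
    by_contra! h
    rw [offPrefix, Finset.Ico_eq_empty_of_le h, Finset.sum_empty] at hlt
    linarith
  have hmem : ptr (u + 1) - 1 ∈ {k | ptr u ≤ k ∧ x < offPrefix ptr val u (k + 1)} :=
    ⟨by omega, by rwa [Nat.sub_add_cancel (by omega)]⟩
  have hin := Nat.sInf_mem ⟨_, hmem⟩
  have hle := Nat.sInf_le hmem
  refine ⟨⟨hin.1, ?_⟩, ?_, hin.2⟩
  · change sInf _ < _
    omega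
  -- If the prefix sum before the found address already exceeded x, the preceding address would
  -- qualify.
  · by_contra! h
    have h1 : ptr u < searchRow ptr val u x := by
      refine lt_of_le_of_ne hin.1 fun he => ?_
      rw [← show ptr u = searchRow ptr val u x from he, offPrefix, Finset.Ico_self,
        Finset.sum_empty] at h
      linarith
    refine Nat.notMem_of_lt_sInf (m := searchRow ptr val u x - 1) (Nat.sub_lt (by omega) one_pos)
      ⟨by omega, ?_⟩
    rwa [Nat.sub_add_cancel (by omega)]

lemma searchRow_eq {u k : ℕ} {x : ℝ} (hk : ptr u ≤ k) (h1 : offPrefix ptr val u k ≤ x)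
    (h2 : x < offPrefix ptr val u (k + 1)) : searchRow ptr val u x = k := by
  refine le_antisymm (Nat.sInf_le ⟨hk, h2⟩) (le_csInf ⟨k, hk, h2⟩ fun j hj => ?_)
  by_contra! h
  exact absurd (hj.2.trans_le (offPrefix_mono u h)) (not_lt.2 h1)

namespace RealRAM.IsSparseRowFormat

lemma col_lt (hF : IsSparseRowFormat M ptr col val) (u : Fin n) {k : ℕ}
    (hk : k ∈ Set.Ico (ptr u) (ptr (u + 1))) : col k < n := by
  obtain ⟨v, hv, -⟩ := (hF.2 u).2.1.mapsTo hk
  omega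

lemma val_eq (hF : IsSparseRowFormat M ptr col val) (u : Fin n) {k : ℕ}
    (hk : k ∈ Set.Ico (ptr u) (ptr (u + 1))) : val k = M u ⟨col k, hF.col_lt u hk⟩ :=
  (hF.2 u).2.2 _ k hk rfl

lemma exists_index (hF : IsSparseRowFormat M ptr col val) (u : Fin n) {v : Fin n}
    (hv : M u v ≠ 0) : ∃ k ∈ Set.Ico (ptr u) (ptr (u + 1)), col k = v ∧ val k = M u v := by
  obtain ⟨k, hk, hkv⟩ := (hF.2 u).2.1.surjOn ⟨v, rfl, hv⟩
  exact ⟨k, hk, hkv, (hF.2 u).2.2 v k hk hkv⟩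

/-- Entries that are not stored are zero and do not contribute. -/
lemma sum_row (hF : IsSparseRowFormat M ptr col val) (u : Fin n) {φ : ℝ → ℝ} (hφ : φ 0 = 0) :
    ∑ k ∈ Finset.Ico (ptr u) (ptr (u + 1)), φ (val k) = ∑ v, φ (M u v) := by
  rw [← Finset.sum_filter_of_ne (s := Finset.univ) (p := fun v => M u v ≠ 0)
    (fun v _ h h0 => h (by rw [h0, hφ]))]
  refine Finset.sum_nbij (fun k => ⟨col k % n, Nat.mod_lt _ u.pos⟩) ?_ ?_ ?_ ?_
  · intro k hk
    have hk' := Finset.mem_Ico.1 hk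
    obtain ⟨v, hv, hne⟩ := (hF.2 u).2.1.mapsTo hk'
    simp only [Finset.mem_filter, Finset.mem_univ, true_and]
    convert hne using 2
    exact Fin.ext (by simp [← hv, Nat.mod_eq_of_lt v.2])
  · intro k hk k' hk' h
    have hk := Finset.mem_Ico.1 hk
    have hk' := Finset.mem_Ico.1 hk'
    refine (hF.2 u).2.1.injOn hk hk' ?_
    simpa [Nat.mod_eq_of_lt (hF.col_lt u hk), Nat.mod_eq_of_lt (hF.col_lt u hk')] using h
  · intro v hv
    simp only [Finset.coe_filter, Finset.mem_univ, true_and] at hv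
    obtain ⟨k, hk, hkv, -⟩ := hF.exists_index u (v := v) hv
    exact ⟨k, by simpa using hk, Fin.ext (by simp [hkv, Nat.mod_eq_of_lt v.2])⟩
  · intro k hk
    have hk' := Finset.mem_Ico.1 hk
    rw [hF.val_eq u hk']
    congr 2
    exact Fin.ext (Nat.mod_eq_of_lt (hF.col_lt u hk')).symm

/-- The diagonal entry is the only positive entry of its row, so the scan finds it without comparing
columns. -/
lemma posPrefix_eq (hF : IsSparseRowFormat M ptr col val) (h : IsGroundedLaplacian M)
    (u : Fin n) : posPrefix ptr val u (ptr (u + 1)) = M u u := by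
  rw [posPrefix, hF.sum_row u (φ := fun x => max x 0) (by simp),
    ← Finset.add_sum_erase _ _ (Finset.mem_univ u), Finset.sum_eq_zero]
  · simp [(h.diag_pos u).le]
  · intro v hv
    exact max_eq_right (h.off u v (Finset.ne_of_mem_erase hv).symm)

lemma offPrefix_eq (hF : IsSparseRowFormat M ptr col val) (h : IsGroundedLaplacian M)
    (u : Fin n) : offPrefix ptr val u (ptr (u + 1)) = M u u - ∑ v, M u v := by
  rw [offPrefix, hF.sum_row u (φ := fun x => max (-x) 0) (by simp),
    ← hF.posPrefix_eq h, posPrefix, hF.sum_row u (φ := fun x => max x 0) (by simp),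
    ← Finset.sum_sub_distrib]
  refine Finset.sum_congr rfl fun v _ => ?_
  rcases le_total (M u v) 0 with h0 | h0
  · simp [h0]
  · simp [h0]

/-- The prefix sums cut [0, M_uu) into intervals of length |M_uw| for the neighbours w, followed by
one of length s_u for being killed; U · M_uu selects the interval. -/
lemma rowMove_eq_move_iff (hF : IsSparseRowFormat M ptr col val) (h : IsGroundedLaplacian M)
    (u w : Fin n) (U : unitInterval) :
    rowMove n ptr col val u U = (w, false) ↔
      ∃ k ∈ Set.Ico (ptr u) (ptr (u + 1)), col k = w ∧
        offPrefix ptr val u k ≤ U * M u u ∧ U * M u u < offPrefix ptr val u (k + 1) := by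
  simp only [rowMove, hF.posPrefix_eq h]
  have hx : 0 ≤ (U : ℝ) * M u u := mul_nonneg U.2.1 (h.diag_pos u).le
  split_ifs with hlt
  · obtain ⟨h1, h2, h3⟩ := searchRow_spec hx hlt
    have h4 := Nat.mod_eq_of_lt (hF.col_lt u h1)
    simp only [Prod.mk.injEq, and_true, Fin.ext_iff, h4]
    constructor
    · intro hw
      exact ⟨_, h1, hw, h2, h3⟩
    · rintro ⟨k, hk, hkw, ha, hb⟩
      rw [searchRow_eq hk.1 ha hb, hkw]
  · simp only [Prod.mk.injEq, Bool.true_eq_false, and_false, false_iff]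
    rintro ⟨k, hk, -, -, hb⟩
    exact hlt (hb.trans_le (offPrefix_mono _ hk.2))

lemma rowMove_eq_kill_iff (hF : IsSparseRowFormat M ptr col val) (h : IsGroundedLaplacian M)
    (u w : Fin n) (U : unitInterval) :
    rowMove n ptr col val u U = (w, true) ↔ u = w ∧ M u u - ∑ v, M u v ≤ U * M u u := by
  simp only [rowMove, hF.posPrefix_eq h, hF.offPrefix_eq h]
  split_ifs with hlt
  · simp only [Prod.mk.injEq, Bool.false_eq_true, and_false, false_iff, not_and, not_le]
    exact fun _ => hlt
  · simp [not_lt.1 hlt]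

end RealRAM.IsSparseRowFormat

lemma unitInterval_volume_real_Ico {a b : ℝ} (ha : 0 ≤ a) (hab : a ≤ b) (hb : b ≤ 1) :
    (volume : Measure unitInterval).real {U | a ≤ U ∧ (U : ℝ) < b} = b - a := by
  have : {U : unitInterval | a ≤ U ∧ (U : ℝ) < b} =
      Set.Ico (⟨a, ha, hab.trans hb⟩ : unitInterval) ⟨b, ha.trans hab, hb⟩ := rfl
  rw [this, measureReal_def, unitInterval.volume_Ico, ENNReal.toReal_ofReal (sub_nonneg.2 hab)]

lemma unitInterval_volume_real_Ici {a : ℝ} (ha : 0 ≤ a) (hb : a ≤ 1) :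
    (volume : Measure unitInterval).real {U | a ≤ U} = 1 - a := by
  have : {U : unitInterval | a ≤ U} = Set.Ici (⟨a, ha, hb⟩ : unitInterval) := rfl
  rw [this, measureReal_def, unitInterval.volume_Ici, ENNReal.toReal_ofReal (sub_nonneg.2 hb)]

namespace RealRAM.IsSparseRowFormat

lemma measurable_rowMove (hF : IsSparseRowFormat M ptr col val) (h : IsGroundedLaplacian M)
    (u : Fin n) : Measurable (rowMove n ptr col val u) := by
  refine measurable_to_countable' fun ⟨w, b⟩ => ?_
  have hU : Measurable fun U : unitInterval => (U : ℝ) * M u u :=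
    measurable_subtype_coe.mul_const _
  cases b
  · have : rowMove n ptr col val u ⁻¹' {(w, false)} =
        ⋃ k ∈ {k | k ∈ Set.Ico (ptr u) (ptr (u + 1)) ∧ col k = w},
          (fun U : unitInterval => (U : ℝ) * M u u) ⁻¹'
            Set.Ico (offPrefix ptr val u k) (offPrefix ptr val u (k + 1)) := by
      ext U
      simp only [Set.mem_preimage, Set.mem_singleton_iff, hF.rowMove_eq_move_iff h,
        Set.mem_iUnion, Set.mem_Ico, exists_prop, Set.mem_ofPred_eq, and_assoc]
    rw [this]
    exact MeasurableSet.biUnion (Set.to_countable _) fun k _ => measurableSet_Ico.preimage hU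
  · have : rowMove n ptr col val u ⁻¹' {(w, true)} =
        {U | u = w} ∩ (fun U : unitInterval => (U : ℝ) * M u u) ⁻¹'
          Set.Ici (M u u - ∑ v, M u v) := by
      ext U
      exact hF.rowMove_eq_kill_iff h u w U
    rw [this]
    exact (MeasurableSet.const _).inter (measurableSet_Ici.preimage hU)

lemma volume_rowMove_move (hF : IsSparseRowFormat M ptr col val) (h : IsGroundedLaplacian M)
    (u w : Fin n) :
    (volume : Measure unitInterval).real {U | rowMove n ptr col val u U = (w, false)} =
      killedTransition M u w := by
  have hd := h.diag_pos u
  by_cases hw : M u w = 0 ∨ u = w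
  · have h0 : killedTransition M u w = 0 := by
      rcases hw with hw | hw <;> simp [killedTransition, hw]
    rw [h0]
    convert measureReal_empty using 2
    ext U
    simp only [Set.mem_ofPred_eq, Set.mem_empty_iff_false, iff_false, hF.rowMove_eq_move_iff h]
    rintro ⟨k, hk, hkw, h1, h2⟩
    have hval := (hF.2 u).2.2 w k hk hkw
    have : 0 ≤ val k := by
      rcases hw with hw | rfl
      · rw [hval, hw]
      · rw [hval]; exact hd.le
    rw [offPrefix_succ hk.1, max_eq_right (by linarith), add_zero] at h2
    linarith
  · push Not at hw
    obtain ⟨k, hk, hkw, hval⟩ := hF.exists_index u hw.1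
    have hneg := h.off u w hw.2
    have hsucc : offPrefix ptr val u (k + 1) = offPrefix ptr val u k - M u w := by
      rw [offPrefix_succ hk.1, hval, max_eq_left (by linarith)]; ring
    have hset : {U | rowMove n ptr col val u U = (w, false)} =
        {U : unitInterval | offPrefix ptr val u k / M u u ≤ U ∧
          (U : ℝ) < offPrefix ptr val u (k + 1) / M u u} := by
      ext U
      simp only [Set.mem_ofPred_eq, hF.rowMove_eq_move_iff h, div_le_iff₀ hd, lt_div_iff₀ hd]
      constructor
      · rintro ⟨k', hk', hkw', h1⟩
        rwa [← (hF.2 u).2.1.injOn hk' hk (hkw'.trans hkw.symm)]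
      · intro h1
        exact ⟨k, hk, hkw, h1⟩
    rw [hset, unitInterval_volume_real_Ico (div_nonneg (offPrefix_nonneg _ _) hd.le)
      (div_le_div_of_nonneg_right (offPrefix_mono _ (Nat.le_succ k)) hd.le), hsucc]
    · simp only [killedTransition, Matrix.of_apply, if_neg hw.2]; ring
    · rw [div_le_one hd]
      refine (offPrefix_mono (u : ℕ) (show k + 1 ≤ ptr (u + 1) from hk.2)).trans ?_
      rw [hF.offPrefix_eq h]
      linarith [h.sum_pos u]

lemma volume_rowMove_kill (hF : IsSparseRowFormat M ptr col val) (h : IsGroundedLaplacian M)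
    (u w : Fin n) :
    (volume : Measure unitInterval).real {U | rowMove n ptr col val u U = (w, true)} =
      if u = w then (∑ x, M w x) / M w w else 0 := by
  have hd := h.diag_pos u
  simp only [hF.rowMove_eq_kill_iff h]
  split_ifs with huw
  · subst huw
    have hset : {U : unitInterval | u = u ∧ M u u - ∑ v, M u v ≤ U * M u u} =
        {U : unitInterval | (M u u - ∑ v, M u v) / M u u ≤ U} := by
      ext U
      simp [div_le_iff₀ hd]
    rw [hset, unitInterval_volume_real_Ici
      (div_nonneg (sub_nonneg.2 (h.sum_le_diag u)) hd.le)
      ((div_le_one hd).2 (by linarith [h.sum_pos u]))]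
    field_simp
    ring
  · simp [huw]

end RealRAM.IsSparseRowFormat

lemma ptr_mono (hF : IsSparseRowFormat M ptr col val) {a b : ℕ} (hab : a ≤ b) (hb : b ≤ n) :
    ptr a ≤ ptr b := by
  induction b, hab using Nat.le_induction with
  | base => exact le_rfl
  | succ b _ ih => exact (ih (by omega)).trans (hF.2 ⟨b, by omega⟩).1

/-- Bounds the binary search in a row by ⌈log₂ n⌉ rounds. -/
lemma row_length_le (hF : IsSparseRowFormat M ptr col val) (u : Fin n) :
    ptr (u + 1) - ptr u ≤ n := by
  have h1 : Set.Ico (ptr u) (ptr (u + 1)) = (Finset.Ico (ptr u) (ptr (u + 1)) : Set ℕ) := by simp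
  have h2 := Finset.card_le_card_of_injOn (s := Finset.Ico (ptr u) (ptr (u + 1)))
    (t := Finset.range n) col
    (fun k hk => Finset.mem_coe.2 (Finset.mem_range.2 (hF.col_lt u (by simpa using hk))))
    (by rw [← h1]; exact (hF.2 u).2.1.injOn)
  simpa using h2

lemma ptr_last_eq_card (hF : IsSparseRowFormat M ptr col val) :
    ptr n = ∑ u : Fin n, (Finset.univ.filter fun v => M u v ≠ 0).card := by
  have h1 : ∀ u : Fin n, ptr (u + 1) - ptr u = (Finset.univ.filter fun v => M u v ≠ 0).card := by
    intro u
    rw [← Nat.card_Ico]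
    refine Finset.card_nbij (fun k => ⟨col k % n, Nat.mod_lt _ u.pos⟩) ?_ ?_ ?_
    · intro k hk
      have hk' := Finset.mem_Ico.1 hk
      obtain ⟨v, hv, hne⟩ := (hF.2 u).2.1.mapsTo hk'
      simp only [Finset.coe_filter, Finset.mem_univ, true_and, Set.mem_ofPred_eq]
      convert hne using 2
      exact Fin.ext (by simp [← hv, Nat.mod_eq_of_lt v.2])
    · intro k hk k' hk' h
      have hk := Finset.mem_Ico.1 hk
      have hk' := Finset.mem_Ico.1 hk'
      refine (hF.2 u).2.1.injOn hk hk' ?_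
      simpa [Nat.mod_eq_of_lt (hF.col_lt u hk), Nat.mod_eq_of_lt (hF.col_lt u hk')] using h
    · intro v hv
      simp only [Finset.coe_filter, Finset.mem_univ, true_and] at hv
      obtain ⟨k, hk, hkv, -⟩ := hF.exists_index u (v := v) hv
      exact ⟨k, by simpa using hk, Fin.ext (by simp [hkv, Nat.mod_eq_of_lt v.2])⟩
  simp only [← h1]
  rw [Fin.sum_univ_eq_sum_range (fun u => ptr (u + 1) - ptr u) n]
  have h2 : ∀ k ≤ n, ∑ u ∈ Finset.range k, (ptr (u + 1) - ptr u) = ptr k := by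
    intro k hk
    induction k with
    | zero => simp [hF.1]
    | succ k ih =>
      rw [Finset.sum_range_succ, ih (by omega)]
      have : ptr k ≤ ptr (k + 1) := ptr_mono hF (Nat.le_succ k) hk
      omega
  exact (h2 n le_rfl).symm

open Classical in
-- The stored entries inject into the oriented edges: an off-diagonal entry (u, v) goes to the edge
-- from u to v, and a diagonal one to the edge from u to x.
lemma ptr_last_le (hF : IsSparseRowFormat M ptr col val) (h : IsGroundedLaplacian M) :
    ptr n ≤ 2 * edgeCount (laplacianCompletion M) := by
  set G := laplacianGraph (laplacianCompletion M) with hG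
  have h1 : edgeCount (laplacianCompletion M) = G.edgeFinset.card := by
    rw [edgeCount, ← SimpleGraph.coe_edgeFinset, Set.ncard_coe_finset]
  rw [h1, ← SimpleGraph.dart_card_eq_twice_card_edges, ptr_last_eq_card hF,
    ← Finset.card_sigma, ← Finset.card_univ]
  refine le_trans (Finset.card_le_card_of_injOn
    (t := (Finset.univ : Finset G.Dart).image SimpleGraph.Dart.toProd)
    (fun p : (_ : Fin n) × Fin n =>
      ((Sum.inl p.1 : Fin n ⊕ Unit), if p.1 = p.2 then Sum.inr () else Sum.inl p.2)) ?_ ?_)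
    Finset.card_image_le
  · rintro ⟨u, v⟩ hp
    have hp : M u v ≠ 0 := by simpa using hp
    simp only [Finset.coe_image, Finset.coe_univ, Set.image_univ, Set.mem_range]
    by_cases huv : u = v
    · exact ⟨⟨(Sum.inl u, Sum.inr ()), laplacianGraph_adj_inl_inr (h.sum_pos u).ne'⟩, by
        simp [huv]⟩
    · exact ⟨⟨(Sum.inl u, Sum.inl v), laplacianGraph_adj_inl_inl huv hp⟩, by simp [huv]⟩
  · rintro ⟨u, v⟩ - ⟨u', v'⟩ - hp
    simp only [Prod.mk.injEq, Sum.inl.injEq] at hp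
    obtain ⟨rfl, hp⟩ := hp
    by_cases h1 : u = v <;> by_cases h2 : u = v' <;> simp_all

/-- A connected graph on n + 1 vertices has at least n edges, so work linear in n is covered by m.
-/
lemma card_le_edgeCount (h : (laplacianGraph (laplacianCompletion M)).Connected) :
    n ≤ edgeCount (laplacianCompletion M) := by
  have h1 := h.card_vert_le_card_edgeSet_add_one
  rw [Nat.card_eq_fintype_card, Fintype.card_sum, Fintype.card_fin, Fintype.card_unit,
    Nat.card_coe_set_eq] at h1
  unfold edgeCount
  omega

end SparseRows

namespace RealRAM

/-! ### Total correctness with time bounds -/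

/-- With word bound `B` and tape `ω`, the program `p` started in `s` halts without failure within
`T` steps in a configuration that satisfies `Q`. -/
def Runs (B : ℕ) (ω : ℕ → unitInterval) (p : Prog) (s : State) (T : ℕ) (Q : State → Prop) : Prop :=
  ∃ t s', Exec B ω p s t s' ∧ t ≤ T ∧ Q s'

/-- A sequence of elementary instructions. -/
def block : List Op → Prog
  | [] => .skip
  | o :: os => .seq (.op o) (block os)

/-- The weakest precondition of a sequence of elementary instructions. -/
def blockPre (B : ℕ) (ω : ℕ → unitInterval) : List Op → (State → Prop) → State → Prop
  | [], Q, s => Q s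
  | o :: os, Q, s => ∃ s', o.eval B ω s = some s' ∧ blockPre B ω os Q s'

variable {B : ℕ} {ω : ℕ → unitInterval}

lemma Runs.mono {p : Prog} {s : State} {T T' : ℕ} {Q Q' : State → Prop}
    (h : Runs B ω p s T Q) (hT : T ≤ T') (hQ : ∀ s, Q s → Q' s) : Runs B ω p s T' Q' := by
  obtain ⟨t, s', h1, h2, h3⟩ := h
  exact ⟨t, s', h1, h2.trans hT, hQ _ h3⟩

lemma runs_skip {s : State} {Q : State → Prop} (h : Q s) : Runs B ω .skip s 1 Q :=
  ⟨1, s, .skip s, le_rfl, h⟩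

lemma runs_block {os : List Op} {s : State} {Q : State → Prop} (h : blockPre B ω os Q s) :
    Runs B ω (block os) s (os.length + 1) Q := by
  induction os generalizing s with
  | nil => exact runs_skip h
  | cons o os ih =>
    obtain ⟨s', h1, h2⟩ := h
    obtain ⟨t, s'', h3, h4, h5⟩ := ih h2
    refine ⟨1 + t, s'', .seq _ _ _ _ _ _ _ (.op o s s' h1) h3, ?_, h5⟩
    simp only [List.length_cons]
    omega

lemma Runs.seq {p q : Prog} {s : State} {T₁ T₂ : ℕ} {Q₁ Q : State → Prop}
    (hp : Runs B ω p s T₁ Q₁) (hq : ∀ s', Q₁ s' → Runs B ω q s' T₂ Q) :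
    Runs B ω (.seq p q) s (T₁ + T₂) Q := by
  obtain ⟨t₁, s₁, h1, h2, h3⟩ := hp
  obtain ⟨t₂, s₂, h4, h5, h6⟩ := hq s₁ h3
  exact ⟨t₁ + t₂, s₂, .seq _ _ _ _ _ _ _ h1 h4, by omega, h6⟩

lemma runs_ite {c : Test} {p q : Prog} {s : State} {T : ℕ} {Q : State → Prop}
    (hp : c.holds s → Runs B ω p s T Q) (hq : ¬ c.holds s → Runs B ω q s T Q) :
    Runs B ω (.ite c p q) s (T + 1) Q := by
  by_cases hc : c.holds s
  · obtain ⟨t, s', h1, h2, h3⟩ := hp hc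
    exact ⟨t + 1, s', .ite_true _ _ _ _ _ _ hc h1, by omega, h3⟩
  · obtain ⟨t, s', h1, h2, h3⟩ := hq hc
    exact ⟨t + 1, s', .ite_false _ _ _ _ _ _ hc h1, by omega, h3⟩

/-- A loop that is executed exactly `N` times. -/
lemma runs_loop {c : Test} {p : Prog} (I : ℕ → State → Prop) (N : ℕ) (T : ℕ → ℕ)
    (hbody : ∀ k < N, ∀ s, I k s → c.holds s ∧ Runs B ω p s (T k) (I (k + 1)))
    (hend : ∀ s, I N s → ¬ c.holds s) {s : State} (h0 : I 0 s) :
    Runs B ω (.loop c p) s (∑ k ∈ Finset.range N, (T k + 1) + 1) (I N) := by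
  -- Induction on the number j of remaining rounds.
  have key : ∀ j ≤ N, ∀ s, I (N - j) s →
      Runs B ω (.loop c p) s (∑ k ∈ Finset.Ico (N - j) N, (T k + 1) + 1) (I N) := by
    intro j
    induction j with
    | zero =>
      intro _ s hs
      exact ⟨1, s, .loop_false c p s (hend s hs), by simp, hs⟩
    | succ j ih =>
      intro hj s hs
      obtain ⟨hc, t₁, s₁, h1, h2, h3⟩ := hbody (N - (j + 1)) (by omega) s hs
      rw [show N - (j + 1) + 1 = N - j by omega] at h3
      obtain ⟨t₂, s₂, h4, h5, h6⟩ := ih (by omega) s₁ h3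
      refine ⟨t₁ + t₂ + 1, s₂, .loop_true _ _ _ _ _ _ _ hc h1 h4, ?_, h6⟩
      rw [Finset.sum_eq_sum_Ico_succ_bot (by omega), show N - (j + 1) + 1 = N - j by omega]
      omega
  simpa using key N le_rfl s (by simpa using h0)

lemma runs_loop_const {c : Test} {p : Prog} (I : ℕ → State → Prop) (N T : ℕ)
    (hbody : ∀ k < N, ∀ s, I k s → c.holds s ∧ Runs B ω p s T (I (k + 1)))
    (hend : ∀ s, I N s → ¬ c.holds s) {s : State} (h0 : I 0 s) :
    Runs B ω (.loop c p) s (N * (T + 1) + 1) (I N) := by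
  simpa using runs_loop I N (fun _ => T) hbody hend h0

/-- A loop that is executed at most `j` times. -/
lemma runs_loop_le {c : Test} {p : Prog} (I : ℕ → State → Prop) (T : ℕ)
    (hbody : ∀ j s, I j s → c.holds s → ∃ j', j = j' + 1 ∧ Runs B ω p s T (I j'))
    (j : ℕ) {s : State} (h0 : I j s) :
    Runs B ω (.loop c p) s (j * (T + 1) + 1) (fun s => ¬ c.holds s ∧ ∃ j, I j s) := by
  induction j generalizing s with
  | zero =>
    by_cases hc : c.holds s
    · obtain ⟨j', h, -⟩ := hbody 0 s h0 hc
      omega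
    · exact ⟨1, s, .loop_false c p s hc, by omega, hc, 0, h0⟩
  | succ j ih =>
    by_cases hc : c.holds s
    · obtain ⟨j', hj, t₁, s₁, h1, h2, h3⟩ := hbody _ s h0 hc
      obtain rfl : j = j' := by omega
      obtain ⟨t₂, s₂, h4, h5, h6⟩ := ih h3
      refine ⟨t₁ + t₂ + 1, s₂, .loop_true _ _ _ _ _ _ _ hc h1 h4, ?_, h6⟩
      rw [Nat.succ_mul]
      omega
    · exact ⟨1, s, .loop_false c p s hc, by omega, hc, _, h0⟩

section Evaluation

variable {os : List Op} {Q : State → Prop} {s : State}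

lemma exists_setN {P : State → Prop} {d x : ℕ} :
    (∃ s', s.setN B d x = some s' ∧ P s') ↔
      x < B ∧ P { s with nreg := Function.update s.nreg d x } := by
  unfold State.setN
  split_ifs with h <;> simp [h]

lemma blockPre_nil : blockPre B ω [] Q s ↔ Q s := Iff.rfl

lemma blockPre_nconst {d c : ℕ} : blockPre B ω (.nconst d c :: os) Q s ↔
    c < B ∧ blockPre B ω os Q { s with nreg := Function.update s.nreg d c } := exists_setN

lemma blockPre_nadd {d a b : ℕ} : blockPre B ω (.nadd d a b :: os) Q s ↔
    s.nreg a + s.nreg b < B ∧ blockPre B ω os Q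
      { s with nreg := Function.update s.nreg d (s.nreg a + s.nreg b) } := exists_setN

lemma blockPre_nsub {d a b : ℕ} : blockPre B ω (.nsub d a b :: os) Q s ↔
    s.nreg a - s.nreg b < B ∧ blockPre B ω os Q
      { s with nreg := Function.update s.nreg d (s.nreg a - s.nreg b) } := exists_setN

lemma blockPre_nmul {d a b : ℕ} : blockPre B ω (.nmul d a b :: os) Q s ↔
    s.nreg a * s.nreg b < B ∧ blockPre B ω os Q
      { s with nreg := Function.update s.nreg d (s.nreg a * s.nreg b) } := exists_setN

lemma blockPre_ndiv {d a b : ℕ} : blockPre B ω (.ndiv d a b :: os) Q s ↔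
    s.nreg a / s.nreg b < B ∧ blockPre B ω os Q
      { s with nreg := Function.update s.nreg d (s.nreg a / s.nreg b) } := exists_setN

lemma blockPre_nload {d arr i : ℕ} : blockPre B ω (.nload d arr i :: os) Q s ↔
    s.narr arr (s.nreg i) < B ∧ blockPre B ω os Q
      { s with nreg := Function.update s.nreg d (s.narr arr (s.nreg i)) } := exists_setN

lemma blockPre_nstore {arr i a : ℕ} : blockPre B ω (.nstore arr i a :: os) Q s ↔
    blockPre B ω os Q
      { s with
        narr := Function.update s.narr arr
          (Function.update (s.narr arr) (s.nreg i) (s.nreg a)) } := by simp [blockPre, Op.eval]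

lemma blockPre_rofNat {d a : ℕ} : blockPre B ω (.rofNat d a :: os) Q s ↔
    blockPre B ω os Q { s with rreg := Function.update s.rreg d (s.nreg a : ℝ) } := by
  simp [blockPre, Op.eval, State.setR]

lemma blockPre_radd {d a b : ℕ} : blockPre B ω (.radd d a b :: os) Q s ↔
    blockPre B ω os Q { s with rreg := Function.update s.rreg d (s.rreg a + s.rreg b) } := by
  simp [blockPre, Op.eval, State.setR]

lemma blockPre_rsub {d a b : ℕ} : blockPre B ω (.rsub d a b :: os) Q s ↔
    blockPre B ω os Q { s with rreg := Function.update s.rreg d (s.rreg a - s.rreg b) } := by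
  simp [blockPre, Op.eval, State.setR]

lemma blockPre_rmul {d a b : ℕ} : blockPre B ω (.rmul d a b :: os) Q s ↔
    blockPre B ω os Q { s with rreg := Function.update s.rreg d (s.rreg a * s.rreg b) } := by
  simp [blockPre, Op.eval, State.setR]

lemma blockPre_rdiv {d a b : ℕ} : blockPre B ω (.rdiv d a b :: os) Q s ↔
    blockPre B ω os Q { s with rreg := Function.update s.rreg d (s.rreg a / s.rreg b) } := by
  simp [blockPre, Op.eval, State.setR]

lemma blockPre_rload {d arr i : ℕ} : blockPre B ω (.rload d arr i :: os) Q s ↔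
    blockPre B ω os Q
      { s with rreg := Function.update s.rreg d (s.rarr arr (s.nreg i)) } := by
  simp [blockPre, Op.eval, State.setR]

lemma blockPre_rstore {arr i a : ℕ} : blockPre B ω (.rstore arr i a :: os) Q s ↔
    blockPre B ω os Q
      { s with
        rarr := Function.update s.rarr arr
          (Function.update (s.rarr arr) (s.nreg i) (s.rreg a)) } := by simp [blockPre, Op.eval]

lemma blockPre_randReal {d : ℕ} : blockPre B ω (.randReal d :: os) Q s ↔
    blockPre B ω os Q
      { s with rreg := Function.update s.rreg d (ω s.pos : ℝ), pos := s.pos + 1 } := by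
  simp [blockPre, Op.eval, State.setR]

end Evaluation

/-! ### Sampling a neighbour by binary search -/

/-- Binary search between the addresses in registers 4 and 5 for the first prefix sum that exceeds
the real register 8. -/
def searchProg : Prog :=
  .loop (.nlt 4 5) (.seq (block [.nadd 6 4 5, .ndiv 6 6 2, .rload 9 1 6])
    (.ite (.rlt 8 9) (block [.nadd 5 6 11]) (block [.nadd 4 6 1])))

variable {n : ℕ} {M : Matrix (Fin n) (Fin n) ℝ} {ptr col : ℕ → ℕ} {val : ℕ → ℝ}

lemma runs_searchProg {s : State} {v lo hi L : ℕ} {x : ℝ}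
    (h1 : s.nreg 1 = 1) (h2 : s.nreg 2 = 2) (h11 : s.nreg 11 = 0) (hx : s.rreg 8 = x)
    (h4 : s.nreg 4 = lo) (h5 : s.nreg 5 = hi) (hlo : ptr v ≤ lo) (hhi : hi < ptr (v + 1))
    (hlt : lo ≤ searchRow ptr val v x) (hle : searchRow ptr val v x ≤ hi)
    (hx' : x < offPrefix ptr val v (searchRow ptr val v x + 1))
    (harr : ∀ j, ptr v ≤ j → j < ptr (v + 1) → s.rarr 1 j = offPrefix ptr val v (j + 1))
    (hB : 2 * ptr (v + 1) + 2 < B) (hL : hi - lo < 2 ^ L) :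
    Runs B ω searchProg s (8 * L + 1) fun s' =>
      s'.nreg 4 = searchRow ptr val v x ∧ (∀ i, i ≠ 4 → i ≠ 5 → i ≠ 6 → s'.nreg i = s.nreg i) ∧
      (∀ i, i ≠ 9 → s'.rreg i = s.rreg i) ∧ s'.narr = s.narr ∧ s'.rarr = s.rarr ∧
      s'.pos = s.pos := by
  set t := searchRow ptr val v x with ht
  have hcmp : ∀ j, ptr v ≤ j → (x < offPrefix ptr val v (j + 1) ↔ t ≤ j) := fun j hj =>
    ⟨fun h => Nat.sInf_le ⟨hj, h⟩, fun h => hx'.trans_le (offPrefix_mono v (by omega))⟩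
  -- The counter j bounds the remaining rounds: the interval from register 4 to register 5 contains
  -- the target and has length below 2^j, and each round halves this bound.
  let I : ℕ → State → Prop := fun j s' =>
    (s'.nreg 4 ≤ t ∧ t ≤ s'.nreg 5 ∧ ptr v ≤ s'.nreg 4 ∧ s'.nreg 5 < ptr (v + 1) ∧
      s'.nreg 5 - s'.nreg 4 < 2 ^ j) ∧
    (∀ i, i ≠ 4 → i ≠ 5 → i ≠ 6 → s'.nreg i = s.nreg i) ∧
    (∀ i, i ≠ 9 → s'.rreg i = s.rreg i) ∧ s'.narr = s.narr ∧ s'.rarr = s.rarr ∧ s'.pos = s.pos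
  have h0 : I L s := by
    refine ⟨⟨?_, ?_, ?_, ?_, ?_⟩, by simp, by simp, rfl, rfl, rfl⟩ <;> simp only [h4, h5] <;>
      assumption
  refine (runs_loop_le I 7 ?_ L h0).mono (by omega) ?_
  · rintro j ⟨nr, rr, na, ra, ps⟩ ⟨⟨a1, a2, a3, a4, a5⟩, a6, a7, a8, a9, a10⟩ hc
    simp only [Test.holds] at a1 a2 a3 a4 a5 a6 a7 a8 a9 a10 hc
    obtain ⟨j, rfl⟩ : ∃ j', j = j' + 1 := by
      rcases j with _ | j
      · simp at a5; omega
      · exact ⟨j, rfl⟩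
    refine ⟨j, rfl, ?_⟩
    have e1 : nr 1 = 1 := (a6 1 (by decide) (by decide) (by decide)).trans h1
    have e2 : nr 2 = 2 := (a6 2 (by decide) (by decide) (by decide)).trans h2
    have e11 : nr 11 = 0 := (a6 11 (by decide) (by decide) (by decide)).trans h11
    have e8 : rr 8 = x := (a7 8 (by decide)).trans hx
    rw [pow_succ] at a5
    have hm1 : nr 4 ≤ (nr 4 + nr 5) / 2 := by omega
    have hm2 : (nr 4 + nr 5) / 2 < nr 5 := by omega
    refine Runs.mono (Runs.seq (T₁ := 4) (T₂ := 3) (runs_block (Q := fun s' =>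
      s' = ⟨Function.update nr 6 ((nr 4 + nr 5) / 2),
        Function.update rr 9 (offPrefix ptr val v ((nr 4 + nr 5) / 2 + 1)), na, ra, ps⟩) ?_) ?_)
      le_rfl fun _ h => h
    · simp only [blockPre_nadd, blockPre_ndiv, blockPre_rload, blockPre_nil]
      refine ⟨by omega, ?_, ?_⟩
      · simp only [Function.update_self, e2, ne_eq, not_false_eq_true,
          Function.update_of_ne, Nat.reduceEqDiff]
        omega
      · simp only [Function.update_self, e2, ne_eq, Function.update_of_ne, Nat.reduceEqDiff,
          not_false_eq_true, Function.update_idem, a9]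
        rw [harr _ (by omega) (by omega)]
    · rintro _ rfl
      refine runs_ite (T := 2) (fun hc => ?_) (fun hc => ?_)
      · refine runs_block (os := [.nadd 5 6 11]) ?_
        simp only [Test.holds, Function.update_self, ne_eq, Nat.reduceEqDiff, not_false_eq_true,
          Function.update_of_ne, e8] at hc
        rw [hcmp _ (by omega)] at hc
        simp only [blockPre_nadd, blockPre_nil, I]
        simp only [Function.update_self, ne_eq, Nat.reduceEqDiff, not_false_eq_true,
          Function.update_of_ne, e11, add_zero]
        refine ⟨by omega, ⟨a1, hc, a3, by omega, by omega⟩, ?_, ?_, a8, a9, a10⟩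
        · intro i i4 i5 i6
          rw [Function.update_of_ne i5, Function.update_of_ne i6, a6 i i4 i5 i6]
        · intro i i9
          rw [Function.update_of_ne i9, a7 i i9]
      · refine runs_block (os := [.nadd 4 6 1]) ?_
        simp only [Test.holds, Function.update_self, ne_eq, Nat.reduceEqDiff, not_false_eq_true,
          Function.update_of_ne, e8] at hc
        rw [hcmp _ (by omega)] at hc
        simp only [blockPre_nadd, blockPre_nil, I]
        simp only [Function.update_self, ne_eq, Nat.reduceEqDiff, not_false_eq_true,
          Function.update_of_ne, e1]
        refine ⟨by omega, ⟨by omega, a2, by omega, a4, by omega⟩, ?_, ?_, a8, a9, a10⟩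
        · intro i i4 i5 i6
          rw [Function.update_of_ne i4, Function.update_of_ne i6, a6 i i4 i5 i6]
        · intro i i9
          rw [Function.update_of_ne i9, a7 i i9]
  · rintro s' ⟨hc, j, ⟨a1, a2, a3, a4, a5⟩, a6⟩
    refine ⟨?_, a6⟩
    simp only [Test.holds] at hc
    omega

end RealRAM

/-! ### Simulation of one step of a walk. -/

namespace RealRAM

variable {B : ℕ} {ω : ℕ → unitInterval}

lemma runs_block_seq {os : List Op} {p : Prog} {s : State} {T : ℕ} {Q : State → Prop}
    (h : blockPre B ω os (fun s' => Runs B ω p s' T Q) s) :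
    Runs B ω (.seq (block os) p) s (os.length + 1 + T) Q :=
  (runs_block h).seq fun _ h => h

/-- Move a walk that has not been killed. -/
def moveProg : Prog :=
  .seq (block [.rload 9 3 7, .rload 10 2 7, .rmul 8 8 9, .rsub 9 9 10])
    (.ite (.rlt 8 9)
      (.seq (block [.nload 4 0 7, .nadd 14 7 1, .nload 5 0 14, .nsub 5 5 1])
        (.seq searchProg (block [.nload 7 1 4])))
      (block [.nconst 8 1, .nmul 9 3 0, .nadd 9 9 7, .rload 9 4 9, .radd 9 9 12, .rstore 4 9 9]))

/-- Draw a variate and move the walk unless it has been killed. -/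
def stepProg : Prog :=
  .seq (block [.rmul 6 6 7, .randReal 8]) (.ite (.nlt 8 1) moveProg .skip)

/-- One walk from the vertex in register 3. -/
def walkProg : Prog :=
  .seq (block [.nadd 7 3 11, .nconst 8 0, .radd 6 12 13])
    (.seq (.loop (.rlt 3 6) stepProg) (block [.radd 5 5 12]))

/-- All walks from the vertex in register 3. -/
def vertexProg : Prog :=
  .seq (block [.rsub 5 5 5]) (.seq (.loop (.rlt 5 4) walkProg) (block [.nadd 3 3 1]))

/-- All walks from all vertices. -/
def walksProg : Prog :=
  .seq (.loop (.nlt 3 0) vertexProg) (block [.rstore 5 11 5])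

/-- The part of a configuration that does not change while the walks are simulated. -/
structure Ready (n : ℕ) (na : ℕ → ℕ → ℕ) (cumA sumA diagA : ℕ → ℝ) (δ Nr q : ℝ) (s : State) :
    Prop where
  n0 : s.nreg 0 = n
  n1 : s.nreg 1 = 1
  n2 : s.nreg 2 = 2
  n11 : s.nreg 11 = 0
  r3 : s.rreg 3 = δ
  r4 : s.rreg 4 = Nr
  r7 : s.rreg 7 = 1 - q
  r12 : s.rreg 12 = 1
  r13 : s.rreg 13 = 0
  narr : s.narr = na
  a1 : s.rarr 1 = cumA
  a2 : s.rarr 2 = sumA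
  a3 : s.rarr 3 = diagA

/-- The prefix sums, row sums and diagonal entries that are computed from the sparse rows. -/
structure Tables (n : ℕ) (ptr col : ℕ → ℕ) (val : ℕ → ℝ) (na : ℕ → ℕ → ℕ)
    (cumA sumA diagA : ℕ → ℝ) : Prop where
  ptr_eq : na 0 = ptr
  col_eq : na 1 = col
  cum : ∀ v : Fin n, ∀ j, ptr v ≤ j → j < ptr (v + 1) → cumA j = offPrefix ptr val v (j + 1)
  sum : ∀ v : Fin n, sumA v =
    posPrefix ptr val v (ptr (v + 1)) - offPrefix ptr val v (ptr (v + 1))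
  diag : ∀ v : Fin n, diagA v = posPrefix ptr val v (ptr (v + 1))

/-- The contribution to the cell `a` of the table of counts of a walk from `u` in state `x`. -/
noncomputable def hit (n u : ℕ) (x : Fin n × Bool) (a : ℕ) : ℝ :=
  if x.2 = true ∧ a = u * n + x.1 then 1 else 0

variable {n : ℕ} {M : Matrix (Fin n) (Fin n) ℝ} {ptr col : ℕ → ℕ} {val : ℕ → ℝ}
  {na : ℕ → ℕ → ℕ} {cumA sumA diagA : ℕ → ℝ} {δ Nr q : ℝ}

lemma Ready.of_eq {s s' : State} (h : Ready n na cumA sumA diagA δ Nr q s)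
    (n0 : s'.nreg 0 = s.nreg 0) (n1 : s'.nreg 1 = s.nreg 1) (n2 : s'.nreg 2 = s.nreg 2)
    (n11 : s'.nreg 11 = s.nreg 11) (r3 : s'.rreg 3 = s.rreg 3) (r4 : s'.rreg 4 = s.rreg 4)
    (r7 : s'.rreg 7 = s.rreg 7) (r12 : s'.rreg 12 = s.rreg 12) (r13 : s'.rreg 13 = s.rreg 13)
    (hn : s'.narr = s.narr) (a1 : s'.rarr 1 = s.rarr 1) (a2 : s'.rarr 2 = s.rarr 2)
    (a3 : s'.rarr 3 = s.rarr 3) : Ready n na cumA sumA diagA δ Nr q s' :=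
  ⟨n0.trans h.n0, n1.trans h.n1, n2.trans h.n2, n11.trans h.n11, r3.trans h.r3, r4.trans h.r4,
    r7.trans h.r7, r12.trans h.r12, r13.trans h.r13, hn.trans h.narr, a1.trans h.a1,
    a2.trans h.a2, a3.trans h.a3⟩

/-- The configuration while the `i`-th walk from `u`, now in state `x`, is simulated. -/
structure Walking (n : ℕ) (na : ℕ → ℕ → ℕ) (cumA sumA diagA : ℕ → ℝ) (δ Nr q : ℝ) (u : ℕ)
    (i p : ℝ) (x : Fin n × Bool) (ps : ℕ) (c : ℕ → ℝ) (s : State) : Prop where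
  ready : Ready n na cumA sumA diagA δ Nr q s
  n3 : s.nreg 3 = u
  r5 : s.rreg 5 = i
  r6 : s.rreg 6 = p
  n7 : s.nreg 7 = x.1
  n8 : s.nreg 8 = if x.2 then 1 else 0
  pos : s.pos = ps
  a4 : s.rarr 4 = fun a => c a + hit n u x a

/-- One machine step realises `walkStep` for the current variate. The table stays equal to the old
counts `c` plus the `hit` of the current state, so it changes exactly when the walk is killed. -/
lemma runs_stepProg (hF : IsSparseRowFormat M ptr col val) (hG : IsGroundedLaplacian M)
    (hT : Tables n ptr col val na cumA sumA diagA) {L : ℕ} (hL : n ≤ 2 ^ L)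
    (hB : 2 * ptr n + 2 < B) (hB2 : n * n < B) {u : ℕ} (hu : u < n) {i p : ℝ} {x : Fin n × Bool}
    {ps : ℕ} {c : ℕ → ℝ} {s : State}
    (hs : Walking n na cumA sumA diagA δ Nr q u i p x ps c s) :
    Runs B ω stepProg s (8 * L + 18)
      (Walking n na cumA sumA diagA δ Nr q u i (p * (1 - q))
        (walkStep (rowMove n ptr col val) x (ω ps)) (ps + 1) c) := by
  obtain ⟨nr, rr, nra, ra, pos⟩ := s
  obtain ⟨hr, n3, r5, r6, n7, n8, rfl, a4⟩ := hs
  have hr' := hr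
  obtain ⟨e0, e1, e2, e11, -, -, e7, e12, -, rfl, ea1, ea2, ea3⟩ := hr
  simp only at n3 r5 r6 n7 n8 a4 e0 e1 e2 e11 e7 e12 ea1 ea2 ea3 hT hr'
  obtain ⟨v, b⟩ := x
  simp only at n7 n8
  refine Runs.mono (runs_block_seq (T := 8 * L + 15) ?_) (by simp; omega) fun _ h => h
  simp only [blockPre_rmul, blockPre_randReal, blockPre_nil]
  refine runs_ite (T := 8 * L + 14) (fun hc => ?_) (fun hc => ?_)
  · have hb : b = false := by
      cases b
      · rfl
      · simp [Test.holds, n8, e1] at hc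
    subst hb
    have hv1 : ptr (v + 1) ≤ ptr n := ptr_mono hF v.2 le_rfl
    have hv0 : ptr v ≤ ptr (v + 1) := (hF.2 v).1
    have hvn := v.2
    have hun : u * n + v < n * n := by nlinarith
    have hun' : u * n < n * n := by nlinarith
    have hnn : n ≤ n * n := Nat.le_mul_self n
    have hx0 : 0 ≤ (ω pos : ℝ) * posPrefix ptr val v (ptr (v + 1)) := by
      rw [hF.posPrefix_eq hG]; exact mul_nonneg (ω pos).2.1 (hG.diag_pos v).le
    refine Runs.mono (runs_block_seq (T := 8 * L + 9) ?_) (by simp; omega) fun _ h => h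
    simp only [blockPre_rmul, blockPre_rload, blockPre_rsub, blockPre_nil]
    refine runs_ite (T := 8 * L + 8) (fun hc => ?_) (fun hc => ?_)
    · have hlt : (ω pos : ℝ) * posPrefix ptr val v (ptr (v + 1)) <
          offPrefix ptr val v (ptr (v + 1)) := by
        simpa [Test.holds, n7, ea2, ea3, hT.sum, hT.diag] using hc
      obtain ⟨t1, t2, t3⟩ := searchRow_spec hx0 hlt
      have hcol := hF.col_lt v t1
      have hlen := row_length_le hF v
      refine Runs.mono (runs_block_seq (T := 8 * L + 3) ?_) (by simp; omega) fun _ h => h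
      simp only [blockPre_nload, blockPre_nadd, blockPre_nsub, blockPre_nil]
      simp only [Function.update_self, ne_eq, Nat.reduceEqDiff, not_false_eq_true,
        Function.update_of_ne, n7, e1, hT.ptr_eq, ea2, ea3, hT.diag]
      refine ⟨by omega, by omega, by omega, by omega, ?_⟩
      refine Runs.mono ((runs_searchProg (v := v) (lo := ptr v) (hi := ptr (v + 1) - 1) (L := L)
        (val := val) (ptr := ptr)
        (x := (ω pos : ℝ) * posPrefix ptr val v (ptr (v + 1))) ?_ ?_ ?_ ?_ ?_ ?_ le_rfl ?_ t1.1 ?_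
        t3 ?_ ?_ ?_).seq (Q := Walking n nra cumA sumA diagA δ Nr q u i (p * (1 - q))
        (walkStep (rowMove n ptr col val) (v, false) (ω pos)) (pos + 1) c) (T₂ := 2)
        fun s' hs' => ?_) (by omega) fun _ h => h
      · simp [e1]
      · simp [e2]
      · simp [e11]
      · simp
      · simp
      · simp
      · exact Nat.sub_lt ((Nat.zero_le _).trans_lt (t1.1.trans_lt t1.2)) one_pos
      · exact Nat.le_sub_one_of_lt t1.2
      · intro j hj1 hj2
        simpa [ea1] using hT.cum v j hj1 hj2
      · omega
      · have : n ≤ 2 ^ L := hL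
        have := Nat.pos_of_ne_zero (n := n) (by omega)
        omega
      · obtain ⟨nr', rr', na', ra', ps'⟩ := s'
        obtain ⟨s1, s2, s3, s4, s5, s6⟩ := hs'
        simp only at s1 s2 s3 s4 s5 s6
        refine runs_block (os := [.nload 7 1 4]) ?_
        simp only [blockPre_nload, blockPre_nil, s1, s4, hT.col_eq]
        have hw : walkStep (rowMove n ptr col val) (v, false) (ω pos) =
            (⟨col (searchRow ptr val v ((ω pos : ℝ) * posPrefix ptr val v (ptr (v + 1)))),
              hcol⟩, false) := by
          simp [walkStep, rowMove, hlt, Nat.mod_eq_of_lt hcol]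
        refine ⟨by omega, ?_⟩
        rw [hw]
        refine ⟨hr'.of_eq ?_ ?_ ?_ ?_ ?_ ?_ ?_ ?_ ?_ ?_ ?_ ?_ ?_, ?_, ?_, ?_, ?_, ?_, ?_, ?_⟩ <;>
          simp [s2, s3, s5, s6, n3, r5, r6, e7, a4, n8, hit]
    · have hnlt : ¬ (ω pos : ℝ) * posPrefix ptr val v (ptr (v + 1)) <
          offPrefix ptr val v (ptr (v + 1)) := by
        simpa [Test.holds, n7, ea2, ea3, hT.sum, hT.diag] using hc
      refine Runs.mono (runs_block ?_) (by simp) fun _ h => h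
      simp only [blockPre_nadd, blockPre_nmul, blockPre_nconst, blockPre_rload, blockPre_radd,
        blockPre_rstore, blockPre_nil]
      simp only [Function.update_self, ne_eq, Nat.reduceEqDiff, not_false_eq_true,
        Function.update_of_ne, n7, n3, e0, e12]
      refine ⟨by omega, by omega, by omega, ?_⟩
      have hw : walkStep (rowMove n ptr col val) (v, false) (ω pos) = (v, true) := by
        simp [walkStep, rowMove, hnlt]
      rw [hw]
      refine ⟨hr'.of_eq ?_ ?_ ?_ ?_ ?_ ?_ ?_ ?_ ?_ ?_ ?_ ?_ ?_, ?_, ?_, ?_, ?_, ?_, ?_, ?_⟩ <;>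
        simp [n3, r5, r6, e7, n7]
      funext a
      by_cases ha : a = u * n + v <;> simp [ha, a4, hit]
  · have hb : b = true := by
      cases b
      · simp [Test.holds, n8, e1] at hc
      · rfl
    subst hb
    -- A killed walk stays put, but its variate has been drawn, so the tape position advances by one
    -- in every case.
    refine Runs.mono (runs_skip ?_) (by omega) fun _ h => h
    refine ⟨hr'.of_eq ?_ ?_ ?_ ?_ ?_ ?_ ?_ ?_ ?_ ?_ ?_ ?_ ?_, ?_, ?_, ?_, ?_, ?_, ?_, ?_⟩ <;>
      simp [n3, r5, r6, e7, n7, n8, walkStep, a4]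

end RealRAM

/-! ### Repeating walks and filling the table of counts. -/

namespace RealRAM

variable {B : ℕ} {ω : ℕ → unitInterval} {n : ℕ} {M : Matrix (Fin n) (Fin n) ℝ}
  {ptr col : ℕ → ℕ} {val : ℕ → ℝ} {na : ℕ → ℕ → ℕ} {cumA sumA diagA : ℕ → ℝ} {δ Nr q : ℝ}

/-- The configuration between two walks from `u`. -/
structure Counting (n : ℕ) (na : ℕ → ℕ → ℕ) (cumA sumA diagA : ℕ → ℝ) (δ Nr q : ℝ) (u : ℕ)
    (i : ℝ) (ps : ℕ) (c : ℕ → ℝ) (s : State) : Prop where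
  ready : Ready n na cumA sumA diagA δ Nr q s
  n3 : s.nreg 3 = u
  r5 : s.rreg 5 = i
  pos : s.pos = ps
  a4 : s.rarr 4 = c

/-- The length l is never computed: real register 6 holds (1-q)^k after k steps, and the loop ends
once this is at most δ. -/
lemma runs_walkProg (hF : IsSparseRowFormat M ptr col val) (hG : IsGroundedLaplacian M)
    (hT : Tables n ptr col val na cumA sumA diagA) {L l : ℕ} (hL : n ≤ 2 ^ L)
    (hB : 2 * ptr n + 2 < B) (hB2 : n * n < B) (hl : ∀ k < l, δ < (1 - q) ^ k)
    (hl' : (1 - q) ^ l ≤ δ) (u : Fin n) {i : ℝ}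
    {ps : ℕ} {c : ℕ → ℝ} {s : State}
    (hs : Counting n na cumA sumA diagA δ Nr q u i ps c s) :
    Runs B ω walkProg s (l * (8 * L + 19) + 7)
      (Counting n na cumA sumA diagA δ Nr q u (i + 1) (ps + l) fun a =>
        c a + hit n u (walk (rowMove n ptr col val) u (fun j => ω (ps + j)) l) a) := by
  obtain ⟨nr, rr, nra, ra, pos⟩ := s
  obtain ⟨hr, n3, r5, rfl, rfl⟩ := hs
  have hr' := hr
  obtain ⟨e0, e1, e2, e11, -, -, e7, e12, e13, rfl, ea1, ea2, ea3⟩ := hr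
  simp only at n3 r5 e0 e1 e2 e11 e7 e12 e13 ea1 ea2 ea3 hT hr'
  have hun := u.2
  have hnn : n ≤ n * n := Nat.le_mul_self n
  refine Runs.mono (runs_block_seq (T := l * (8 * L + 18 + 1) + 1 + 2) ?_) (le_of_eq (by simp; ring))
    fun _ h => h
  simp only [blockPre_nadd, blockPre_nconst, blockPre_radd, blockPre_nil]
  simp only [n3, e11, e12, e13]
  refine ⟨by omega, by omega, ?_⟩
  refine (runs_loop_const (fun k => Walking n nra cumA sumA diagA δ Nr q u i ((1 - q) ^ k)
    (walk (rowMove n ptr col val) u (fun j => ω (pos + j)) k) (pos + k) (ra 4)) l (8 * L + 18)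
    ?_ ?_ ?_).seq fun s hs => ?_
  · intro k hk s hs
    refine ⟨?_, ?_⟩
    · simp only [Test.holds, hs.r6, hs.ready.r3]
      exact hl k hk
    · exact (runs_stepProg hF hG hT hL hB hB2 u.2 hs).mono le_rfl fun _ h => by
        rw [pow_succ]; exact h
  · intro s hs
    simp only [Test.holds, hs.r6, hs.ready.r3, not_lt]
    exact hl'
  · refine ⟨hr'.of_eq ?_ ?_ ?_ ?_ ?_ ?_ ?_ ?_ ?_ ?_ ?_ ?_ ?_, ?_, ?_, ?_, ?_, ?_, ?_, ?_⟩ <;>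
      simp [n3, r5, walk, hit]
  · obtain ⟨nr', rr', nra', ra', pos'⟩ := s
    obtain ⟨hr1, n3', r5', -, -, -, rfl, a4'⟩ := hs
    refine runs_block (os := [.radd 5 5 12]) ?_
    simp only [blockPre_radd, blockPre_nil]
    have h12 := hr1.r12
    simp only at n3' r5' a4' h12
    refine ⟨hr1.of_eq ?_ ?_ ?_ ?_ ?_ ?_ ?_ ?_ ?_ ?_ ?_ ?_ ?_, ?_, ?_, ?_, ?_⟩ <;>
      simp [n3', r5', a4', h12]

/-- The contribution of all walks from `u` to the cell `a` of the table of counts. -/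
noncomputable def vertexHits (n : ℕ) (ptr col : ℕ → ℕ) (val : ℕ → ℝ) (ω : ℕ → unitInterval)
    (N l u a : ℕ) : ℝ :=
  if h : u < n then ∑ i ∈ Finset.range N,
    hit n u (walk (rowMove n ptr col val) ⟨u, h⟩ (fun j => ω (u * (N * l) + i * l + j)) l) a
  else 0

/-- The number of walks is the first integer not below the real bound `Nr`, since the loop counter
is a real register. Each walk consumes exactly l variates, so those of u start at u(Nl). -/
lemma runs_vertexProg (hF : IsSparseRowFormat M ptr col val) (hG : IsGroundedLaplacian M)
    (hT : Tables n ptr col val na cumA sumA diagA) {L l N : ℕ} (hL : n ≤ 2 ^ L)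
    (hB : 2 * ptr n + 2 < B) (hB2 : n * n < B) (hl : ∀ k < l, δ < (1 - q) ^ k)
    (hl' : (1 - q) ^ l ≤ δ) (hN : ∀ i : ℕ, (i : ℝ) < Nr ↔ i < N) {u : ℕ} (hu : u < n) {i : ℝ}
    {c : ℕ → ℝ} {s : State}
    (hs : Counting n na cumA sumA diagA δ Nr q u i (u * (N * l)) c s) :
    Runs B ω vertexProg s (N * (l * (8 * L + 19) + 8) + 5)
      (Counting n na cumA sumA diagA δ Nr q (u + 1) N ((u + 1) * (N * l)) fun a =>
        c a + vertexHits n ptr col val ω N l u a) := by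
  obtain ⟨nr, rr, nra, ra, pos⟩ := s
  obtain ⟨hr, n3, r5, rfl, rfl⟩ := hs
  have hnn : n ≤ n * n := Nat.le_mul_self n
  have hr' := hr
  obtain ⟨e0, e1, e2, e11, -, -, e7, e12, e13, rfl, ea1, ea2, ea3⟩ := hr
  simp only at n3 r5 e0 e1 e2 e11 e7 e12 e13 ea1 ea2 ea3 hT hr'
  refine Runs.mono (runs_block_seq (T := N * (l * (8 * L + 19) + 7 + 1) + 1 + 2) ?_)
    (le_of_eq (by simp; ring)) fun _ h => h
  simp only [blockPre_rsub, blockPre_nil, sub_self]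
  refine (runs_loop_const (fun k => Counting n nra cumA sumA diagA δ Nr q u k
    (u * (N * l) + k * l) fun a => ra 4 a + ∑ i ∈ Finset.range k,
      hit n u (walk (rowMove n ptr col val) ⟨u, hu⟩ (fun j => ω (u * (N * l) + i * l + j)) l) a)
    N (l * (8 * L + 19) + 7) ?_ ?_ ?_).seq fun s hs => ?_
  · intro k hk s hs
    refine ⟨?_, ?_⟩
    · simp only [Test.holds, hs.r5, hs.ready.r4]
      exact (hN k).2 hk
    · refine (runs_walkProg hF hG hT hL hB hB2 hl hl' ⟨u, hu⟩ hs).mono le_rfl fun s' h => ?_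
      convert h using 1
      · push_cast; rfl
      · ring
      · funext a
        rw [Finset.sum_range_succ]
        ring
  · intro s hs
    simp only [Test.holds, hs.r5, hs.ready.r4, hN]
    exact lt_irrefl N
  · refine ⟨hr'.of_eq ?_ ?_ ?_ ?_ ?_ ?_ ?_ ?_ ?_ ?_ ?_ ?_ ?_, ?_, ?_, ?_, ?_⟩ <;>
      simp [n3]
  · obtain ⟨nr', rr', nra', ra', pos'⟩ := s
    obtain ⟨hr1, n3', r5', rfl, a4'⟩ := hs
    refine runs_block (os := [.nadd 3 3 1]) ?_
    simp only [blockPre_nadd, blockPre_nil]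
    have h1 := hr1.n1
    simp only at n3' r5' a4' h1
    refine ⟨by omega, hr1.of_eq ?_ ?_ ?_ ?_ ?_ ?_ ?_ ?_ ?_ ?_ ?_ ?_ ?_, ?_, ?_, ?_, ?_⟩ <;>
      simp [n3', r5', a4', h1, vertexHits, hu]
    ring

lemma runs_walksProg (hF : IsSparseRowFormat M ptr col val) (hG : IsGroundedLaplacian M)
    (hT : Tables n ptr col val na cumA sumA diagA) {L l N : ℕ} (hL : n ≤ 2 ^ L)
    (hB : 2 * ptr n + 2 < B) (hB2 : n * n < B) (hl : ∀ k < l, δ < (1 - q) ^ k)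
    (hl' : (1 - q) ^ l ≤ δ) (hN : ∀ i : ℕ, (i : ℝ) < Nr ↔ i < N) (hn : 0 < n) {i : ℝ} {s : State}
    (hs : Counting n na cumA sumA diagA δ Nr q 0 i 0 (fun _ => 0) s) :
    Runs B ω walksProg s (n * (N * (l * (8 * L + 19) + 8) + 6) + 3) fun s' =>
      s'.narr = na ∧ s'.rarr 2 = sumA ∧ s'.rarr 5 0 = N ∧
      s'.rarr 4 = fun a => ∑ u ∈ Finset.range n, vertexHits n ptr col val ω N l u a := by
  -- Real register 5 holds N only after some vertex has been processed; for n ≥ 1 this is so at the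
  -- end, where N is stored for the queries.
  refine Runs.mono ((runs_loop_const (fun u s => ∃ i : ℝ, (0 < u → i = N) ∧
    Counting n na cumA sumA diagA δ Nr q u i (u * (N * l))
      (fun a => ∑ u ∈ Finset.range u, vertexHits n ptr col val ω N l u a) s) n
      (N * (l * (8 * L + 19) + 8) + 5) ?_ ?_ ?_).seq (T₂ := 2) fun s hs => ?_) (le_of_eq (by ring))
      fun _ h => h
  · rintro u hu s ⟨i, -, hs⟩
    refine ⟨?_, ?_⟩
    · simp only [Test.holds, hs.n3, hs.ready.n0]
      exact hu
    · refine (runs_vertexProg hF hG hT hL hB hB2 hl hl' hN hu hs).mono le_rfl fun s' h => ?_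
      refine ⟨N, fun _ => rfl, ?_⟩
      simpa only [Finset.sum_range_succ] using h
  · rintro s ⟨i, -, hs⟩
    simp only [Test.holds, hs.n3, hs.ready.n0]
    exact lt_irrefl n
  · exact ⟨i, by simp, by simpa using hs⟩
  · obtain ⟨i', hi', hs⟩ := hs
    obtain rfl := hi' hn
    obtain ⟨nr', rr', nra', ra', pos'⟩ := s
    obtain ⟨hr1, n3', r5', rfl, a4'⟩ := hs
    refine runs_block (os := [.rstore 5 11 5]) ?_
    simp only [blockPre_rstore, blockPre_nil]
    have h11 := hr1.n11
    have hn := hr1.narr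
    have h2 := hr1.a2
    simp only at r5' a4' h11 hn h2
    simp [hn, h2, h11, r5', a4']

/-- The table of counts contains the numbers of walks from `u` that have been killed at `v`. -/
lemma sum_vertexHits (N l : ℕ) (u v : Fin n) :
    ∑ w ∈ Finset.range n, vertexHits n ptr col val ω N l w (u * n + v) =
      ∑ i ∈ Finset.range N,
        if walk (rowMove n ptr col val) u (fun j => ω (u * (N * l) + i * l + j)) l = (v, true)
        then (1 : ℝ) else 0 := by
  -- Quotient and remainder modulo n recover the pair from its cell.
  have hinj : ∀ (w : ℕ) (x : Fin n), u * n + v = w * n + (x : ℕ) ↔ (u : ℕ) = w ∧ v = x := by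
    intro w x
    constructor
    · intro h
      have hn : 0 < n := u.pos
      have h0 : (v : ℕ) + n * u = x + n * w := by rw [mul_comm n, mul_comm n]; omega
      have h1 := congrArg (· / n) h0
      have h2 := congrArg (· % n) h0
      simp only [Nat.add_mul_div_left _ _ hn, Nat.div_eq_of_lt v.2, Nat.div_eq_of_lt x.2,
        zero_add, Nat.add_mul_mod_self_left, Nat.mod_eq_of_lt v.2, Nat.mod_eq_of_lt x.2] at h1 h2
      exact ⟨h1, Fin.ext h2⟩
    · rintro ⟨h1, rfl⟩
      rw [h1]
  rw [Finset.sum_eq_single_of_mem (u : ℕ) (Finset.mem_range.2 u.2)]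
  · rw [vertexHits, dif_pos u.2]
    refine Finset.sum_congr rfl fun i _ => ?_
    simp only [hit, hinj, Prod.ext_iff, true_and]
    exact if_congr ⟨fun h => ⟨h.2.symm, h.1⟩, fun h => ⟨h.2, h.1.symm⟩⟩ rfl rfl
  · intro w hw hne
    rw [vertexHits, dif_pos (Finset.mem_range.1 hw)]
    refine Finset.sum_eq_zero fun i _ => ?_
    simp only [hit, hinj]
    rw [if_neg]
    rintro ⟨-, h, -⟩
    exact hne h.symm

end RealRAM

/-! ### Preprocessing of the rows, choice of parameters and queries. -/

namespace RealRAM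

variable {B : ℕ} {ω : ℕ → unitInterval} {n : ℕ} {M : Matrix (Fin n) (Fin n) ℝ}
  {ptr col : ℕ → ℕ} {val : ℕ → ℝ} {na : ℕ → ℕ → ℕ} {ε : ℝ}

/-- Set up the constants and store the dimension. -/
def initProg : Prog :=
  block [.nconst 1 1, .nconst 2 2, .rofNat 12 1, .rofNat 2 1, .nstore 2 11 0]

/-- Process one entry of the row in register 3. -/
def entryProg : Prog :=
  .seq (block [.rload 9 0 4])
    (.seq (.ite (.rlt 13 9) (block [.radd 11 11 9]) (block [.rsub 10 10 9]))
      (block [.rstore 1 4 10, .nadd 4 4 1]))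

/-- Process the row in register 3. -/
def rowProg : Prog :=
  .seq (block [.nload 4 0 3, .nadd 14 3 1, .nload 5 0 14, .rsub 10 10 10, .rsub 11 11 11])
    (.seq (.loop (.nlt 4 5) entryProg)
      (.seq (block [.rsub 9 11 10, .rstore 2 3 9, .rstore 3 3 11, .rdiv 9 9 11])
        (.seq (.ite (.rlt 9 2) (block [.radd 2 9 13]) .skip) (block [.nadd 3 3 1]))))

/-- Process all rows. -/
def rowsProg : Prog := .loop (.nlt 3 0) rowProg

/-- Compute the accuracy and the number of walks. -/
def paramProg (c : ℕ) : Prog :=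
  .seq (block [.nconst 12 0, .nconst 13 1])
    (.seq (.loop (.nlt 13 0) (block [.nadd 13 13 13, .nadd 12 12 1]))
      (block [.rmul 3 2 1, .nconst 9 16, .rofNat 9 9, .rdiv 3 3 9, .nconst 9 (c + 3),
        .nmul 9 9 12, .rofNat 4 9, .rmul 9 3 3, .rdiv 4 4 9, .rsub 7 12 2, .nconst 3 0]))

/-- The program that builds the data structure. -/
def buildProg (c : ℕ) : Prog :=
  .seq initProg (.seq rowsProg (.seq (paramProg c) walksProg))

/-- The program that answers a query. -/
def queryProg : Prog :=
  block [.nload 2 2 9, .rload 0 5 9, .nmul 3 0 2, .nmul 4 1 2, .nadd 5 3 0, .nadd 6 3 1,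
    .nadd 7 4 0, .nadd 8 4 1, .rload 1 4 5, .rload 2 4 6, .rload 3 4 7, .rload 4 4 8,
    .rload 5 2 0, .rload 6 2 1, .rdiv 1 1 0, .rdiv 2 2 0, .rdiv 3 3 0, .rdiv 4 4 0,
    .rdiv 1 1 5, .rdiv 2 2 6, .rdiv 3 3 5, .rdiv 4 4 6, .radd 1 1 4, .rsub 1 1 2, .rsub 0 1 3]

/-- The part of a configuration that does not change while the rows are processed, and the index
`u` of the current row. -/
structure Preparing (n : ℕ) (na : ℕ → ℕ → ℕ) (val : ℕ → ℝ) (ε : ℝ) (u : ℕ) (s : State) :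
    Prop where
  n0 : s.nreg 0 = n
  n1 : s.nreg 1 = 1
  n2 : s.nreg 2 = 2
  n11 : s.nreg 11 = 0
  n3 : s.nreg 3 = u
  r1 : s.rreg 1 = ε
  r12 : s.rreg 12 = 1
  r13 : s.rreg 13 = 0
  narr : s.narr = na
  a0 : s.rarr 0 = val
  a4 : s.rarr 4 = fun _ => 0
  pos : s.pos = 0

lemma Preparing.of_eq {u : ℕ} {s s' : State} (h : Preparing n na val ε u s)
    (n0 : s'.nreg 0 = s.nreg 0) (n1 : s'.nreg 1 = s.nreg 1) (n2 : s'.nreg 2 = s.nreg 2)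
    (n11 : s'.nreg 11 = s.nreg 11) (n3 : s'.nreg 3 = s.nreg 3) (r1 : s'.rreg 1 = s.rreg 1)
    (r12 : s'.rreg 12 = s.rreg 12) (r13 : s'.rreg 13 = s.rreg 13)
    (hn : s'.narr = s.narr) (a0 : s'.rarr 0 = s.rarr 0) (a4 : s'.rarr 4 = s.rarr 4)
    (hp : s'.pos = s.pos) : Preparing n na val ε u s' :=
  ⟨n0.trans h.n0, n1.trans h.n1, n2.trans h.n2, n11.trans h.n11, n3.trans h.n3, r1.trans h.r1,
    r12.trans h.r12, r13.trans h.r13, hn.trans h.narr, a0.trans h.a0, a4.trans h.a4,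
    hp.trans h.pos⟩

/-- The prefix sums of the rows up to `u` are stored at the addresses before `k`. -/
def PrefixesStored (ptr : ℕ → ℕ) (val : ℕ → ℝ) (u k : ℕ) (A : ℕ → ℝ) : Prop :=
  ∀ v ≤ u, ∀ j, ptr v ≤ j → j < ptr (v + 1) → j < k → A j = offPrefix ptr val v (j + 1)

/-- The probability that the walk is killed in a step from `v`, in terms of the stored row. -/
noncomputable def killRate (ptr : ℕ → ℕ) (val : ℕ → ℝ) (v : ℕ) : ℝ :=
  (posPrefix ptr val v (ptr (v + 1)) - offPrefix ptr val v (ptr (v + 1))) /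
    posPrefix ptr val v (ptr (v + 1))

/-- The minimum of `1` and the killing probabilities of the vertices before `u`. -/
noncomputable def minKillRate (ptr : ℕ → ℕ) (val : ℕ → ℝ) : ℕ → ℝ
  | 0 => 1
  | u + 1 => min (minKillRate ptr val u) (killRate ptr val u)

/-- The configuration while row `u` is processed. -/
structure RowScan (n : ℕ) (na : ℕ → ℕ → ℕ) (ptr : ℕ → ℕ) (val : ℕ → ℝ) (ε : ℝ) (u k : ℕ) (q : ℝ)
    (sumA diagA : ℕ → ℝ) (s : State) : Prop where
  prep : Preparing n na val ε u s
  n4 : s.nreg 4 = k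
  n5 : s.nreg 5 = ptr (u + 1)
  r10 : s.rreg 10 = offPrefix ptr val u k
  r11 : s.rreg 11 = posPrefix ptr val u k
  r2 : s.rreg 2 = q
  a1 : PrefixesStored ptr val u k (s.rarr 1)
  a2 : s.rarr 2 = sumA
  a3 : s.rarr 3 = diagA

lemma runs_entryProg (hF : IsSparseRowFormat M ptr col val) (hB : ptr n < B) {u k : ℕ} {q : ℝ}
    (hu : u < n) (hk : ptr u ≤ k) (hk' : k < ptr (u + 1)) {sumA diagA : ℕ → ℝ} {s : State}
    (hs : RowScan n na ptr val ε u k q sumA diagA s) :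
    Runs B ω entryProg s 8 (RowScan n na ptr val ε u (k + 1) q sumA diagA) := by
  obtain ⟨nr, rr, nra, ra, pos⟩ := s
  obtain ⟨hp, n4, n5, r10, r11, r2, a1, a2, a3⟩ := hs
  have e1 := hp.n1
  have e13 := hp.r13
  have ea0 := hp.a0
  simp only at n4 n5 r10 r11 r2 a1 a2 a3 e1 e13 ea0
  have hend : ptr (u + 1) ≤ ptr n := ptr_mono hF hu le_rfl
  have hst : ∀ x, x = offPrefix ptr val u (k + 1) →
      PrefixesStored ptr val u (k + 1) (Function.update (ra 1) k x) := by
    rintro x rfl v hv j h1 h2 h3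
    rcases Nat.lt_succ_iff_lt_or_eq.1 h3 with h3 | rfl
    · rw [Function.update_of_ne h3.ne]
      exact a1 v hv j h1 h2 h3
    -- Address k lies in row u only, because the rows occupy consecutive disjoint ranges.
    · have : v = u := by
        by_contra hne
        have : ptr (v + 1) ≤ ptr u := ptr_mono hF (by omega) (by omega)
        omega
      subst this
      rw [Function.update_self]
  refine Runs.mono (runs_block_seq (T := 6) ?_) (by simp) fun _ h => h
  simp only [blockPre_rload, blockPre_nil]
  refine (runs_ite (T := 2) (fun hc => ?_) (fun hc => ?_)).seq (T₂ := 3) fun _ h =>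
    runs_block (os := [.rstore 1 4 10, .nadd 4 4 1]) h
  · refine runs_block (os := [.radd 11 11 9]) ?_
    have hval : 0 < val k := by simpa [Test.holds, e13, ea0, n4] using hc
    simp only [blockPre_radd, blockPre_rstore, blockPre_nadd, blockPre_nil]
    refine ⟨by simp only [n4, e1]; omega,
      hp.of_eq ?_ ?_ ?_ ?_ ?_ ?_ ?_ ?_ ?_ ?_ ?_ ?_, ?_, ?_, ?_, ?_, ?_, ?_, ?_, ?_⟩ <;>
      simp [n4, n5, e1, r10, r11, r2, a2, a3, ea0]
    · rw [offPrefix_succ hk, max_eq_right (by linarith), add_zero]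
    · rw [posPrefix_succ hk, max_eq_left hval.le]
    · apply hst
      rw [offPrefix_succ hk, max_eq_right (by linarith), add_zero]
  · refine runs_block (os := [.rsub 10 10 9]) ?_
    have hval : val k ≤ 0 := by simpa [Test.holds, e13, ea0, n4] using hc
    simp only [blockPre_rsub, blockPre_rstore, blockPre_nadd, blockPre_nil]
    refine ⟨by simp only [n4, e1]; omega,
      hp.of_eq ?_ ?_ ?_ ?_ ?_ ?_ ?_ ?_ ?_ ?_ ?_ ?_, ?_, ?_, ?_, ?_, ?_, ?_, ?_, ?_⟩ <;>
      simp [n4, n5, e1, r10, r11, r2, a2, a3, ea0]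
    · rw [offPrefix_succ hk, max_eq_left (by linarith)]; ring
    · rw [posPrefix_succ hk, max_eq_right hval, add_zero]
    · apply hst
      rw [offPrefix_succ hk, max_eq_left (by linarith)]; ring

/-- The configuration between two rows. -/
structure RowsDone (n : ℕ) (na : ℕ → ℕ → ℕ) (ptr : ℕ → ℕ) (val : ℕ → ℝ) (ε : ℝ) (u : ℕ)
    (s : State) : Prop where
  prep : Preparing n na val ε u s
  r2 : s.rreg 2 = minKillRate ptr val u
  a1 : ∀ v < u, ∀ j, ptr v ≤ j → j < ptr (v + 1) → s.rarr 1 j = offPrefix ptr val v (j + 1)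
  a2 : ∀ v < u, s.rarr 2 v =
    posPrefix ptr val v (ptr (v + 1)) - offPrefix ptr val v (ptr (v + 1))
  a3 : ∀ v < u, s.rarr 3 v = posPrefix ptr val v (ptr (v + 1))

lemma runs_rowProg (hF : IsSparseRowFormat M ptr col val) (hna : na 0 = ptr) (hB : ptr n < B)
    (hnB : n < B) {u : ℕ} (hu : u < n) {s : State} (hs : RowsDone n na ptr val ε u s) :
    Runs B ω rowProg s ((ptr (u + 1) - ptr u) * 9 + 17) (RowsDone n na ptr val ε (u + 1)) := by
  obtain ⟨nr, rr, nra, ra, pos⟩ := s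
  obtain ⟨hp, r2, a1, a2, a3⟩ := hs
  have e1 := hp.n1
  have e3 := hp.n3
  obtain rfl := hp.narr
  simp only at r2 a1 a2 a3 e1 e3 hna hp
  have hend : ptr (u + 1) ≤ ptr n := ptr_mono hF hu le_rfl
  have hstart : ptr u ≤ ptr (u + 1) := ptr_mono hF (Nat.le_succ u) hu
  refine Runs.mono (runs_block_seq (T := ((ptr (u + 1) - ptr u) * (8 + 1) + 1) + (5 + (3 + 2))) ?_)
    (by simp; omega) fun _ h => h
  simp only [blockPre_nload, blockPre_nadd, blockPre_rsub, blockPre_nil]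
  simp only [Function.update_self, ne_eq, Nat.reduceEqDiff, not_false_eq_true,
    Function.update_of_ne, e1, e3, hna, sub_self]
  refine ⟨by omega, by omega, by omega, ?_⟩
  refine (runs_loop_const (fun i => RowScan n nra ptr val ε u (ptr u + i)
    (minKillRate ptr val u) (ra 2) (ra 3)) (ptr (u + 1) - ptr u) 8 ?_ ?_ ?_).seq fun s hs => ?_
  · intro i hi s hs
    refine ⟨?_, ?_⟩
    · simp only [Test.holds, hs.n4, hs.n5]
      omega
    · exact runs_entryProg (k := ptr u + i) hF hB hu (by omega) (by omega) hs
  · intro s hs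
    simp only [Test.holds, hs.n4, hs.n5]
    omega
  · refine ⟨hp.of_eq ?_ ?_ ?_ ?_ ?_ ?_ ?_ ?_ ?_ ?_ ?_ ?_, ?_, ?_, ?_, ?_, ?_, ?_, ?_, ?_⟩ <;>
      simp [r2, offPrefix, posPrefix]
    intro v hv j h1 h2 h3
    rcases hv.lt_or_eq with hv | rfl
    · exact a1 v hv j h1 h2
    · omega
  · rw [Nat.add_sub_cancel' hstart] at hs
    obtain ⟨nr, rr, nra, ra', pos⟩ := s
    obtain ⟨hp, n4, n5, r10, r11, r2, a1', b2, b3⟩ := hs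
    obtain ⟨p0, p1, p2, p11, p3, p_r1, p12, p13, pn, pa0, pa4, pp⟩ := hp
    simp only at n4 n5 r10 r11 r2 a1' b2 b3 p0 p1 p2 p11 p3 p_r1 p12 p13 pn pa0 pa4 pp
    rw [← b2] at a2
    rw [← b3] at a3
    refine Runs.mono (runs_block_seq (T := 3 + 2) ?_) (by simp) fun _ h => h
    simp only [blockPre_rsub, blockPre_rstore, blockPre_rdiv, blockPre_nil]
    simp only [Function.update_self, ne_eq, Nat.reduceEqDiff, not_false_eq_true,
      Function.update_of_ne, p3, r10, r11, Function.update_idem]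
    refine Runs.seq (Q₁ := fun s => ∃ rr' : ℕ → ℝ, s = ⟨nr, rr', nra,
        Function.update (Function.update ra' 2 (Function.update (ra' 2) u
          (posPrefix ptr val u (ptr (u + 1)) - offPrefix ptr val u (ptr (u + 1))))) 3
          (Function.update (ra' 3) u (posPrefix ptr val u (ptr (u + 1)))), pos⟩ ∧
      rr' 2 = minKillRate ptr val (u + 1) ∧ rr' 1 = ε ∧ rr' 12 = 1 ∧ rr' 13 = 0)
      (runs_ite (T := 2) (fun hc => runs_block (os := [.radd 2 9 13]) ?_)
      (fun hc => (runs_skip ?_).mono (by omega) fun _ h => h)) ?_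
    · have hlt : killRate ptr val u < minKillRate ptr val u := by
        simpa [Test.holds, r2, killRate] using hc
      simp only [blockPre_radd, blockPre_nil]
      refine ⟨_, rfl, ?_, ?_, ?_, ?_⟩ <;> simp [p13, p12, p_r1, minKillRate, hlt.le]
      rfl
    · have hlt : minKillRate ptr val u ≤ killRate ptr val u := by
        simpa [Test.holds, r2, killRate] using hc
      refine ⟨_, rfl, ?_, ?_, ?_, ?_⟩ <;> simp [p13, p12, p_r1, r2, minKillRate, hlt]
    · rintro _ ⟨rr', rfl, h2, h1, h12, h13⟩
      refine runs_block (os := [.nadd 3 3 1]) ?_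
      simp only [blockPre_nadd, blockPre_nil]
      refine ⟨by simp only [p1, p3]; omega,
        ⟨?_, ?_, ?_, ?_, ?_, ?_, ?_, ?_, ?_, ?_, ?_, ?_⟩, ?_, ?_, ?_, ?_⟩
      all_goals try simp [p0, p1, p2, p11, p3, pn, pa0, pa4, pp, h1, h2, h12, h13]
      · intro v hv j h1 h2
        exact a1' v hv j h1 h2
          (h2.trans_le (ptr_mono hF (by omega) (by omega)))
      · intro v hv
        rcases eq_or_ne v u with rfl | hne
        · simp
        · simp [hne, a2 v (by omega)]
      · intro v hv
        rcases eq_or_ne v u with rfl | hne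
        · simp
        · simp [hne, a3 v (by omega)]

lemma runs_rowsProg (hF : IsSparseRowFormat M ptr col val) (hna : na 0 = ptr) (hB : ptr n < B)
    (hnB : n < B) {s : State} (hs : RowsDone n na ptr val ε 0 s) :
    Runs B ω rowsProg s (9 * ptr n + 18 * n + 1) (RowsDone n na ptr val ε n) := by
  refine (runs_loop (fun u => RowsDone n na ptr val ε u) n
    (fun u => (ptr (u + 1) - ptr u) * 9 + 17) ?_ ?_ hs).mono (le_of_eq ?_) fun _ h => h
  · intro u hu s hs
    refine ⟨?_, runs_rowProg hF hna hB hnB hu hs⟩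
    simp only [Test.holds, hs.prep.n3, hs.prep.n0]
    exact hu
  · intro s hs
    simp only [Test.holds, hs.prep.n3, hs.prep.n0]
    exact lt_irrefl n
  -- The row lengths telescope, so all rows together take time linear in ptr n and n.
  · have h : ∀ k ≤ n, ∑ u ∈ Finset.range k, ((ptr (u + 1) - ptr u) * 9 + 17 + 1) =
        9 * ptr k + 18 * k := by
      intro k hk
      induction k with
      | zero => simp [hF.1]
      | succ k ih =>
        rw [Finset.sum_range_succ, ih (by omega)]
        have : ptr k ≤ ptr (k + 1) := ptr_mono hF (Nat.le_succ k) hk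
        omega
    rw [h n le_rfl]

lemma runs_paramProg {c : ℕ} (hna : na 0 = ptr) (hna1 : na 1 = col)
    (hB : 2 * n < B) (hB' : 16 < B) (hB3 : c + 3 < B) (hB2 : (c + 3) * Nat.clog 2 n < B) {s : State}
    (hs : RowsDone n na ptr val ε n s) :
    Runs B ω (paramProg c) s (Nat.clog 2 n * 4 + 16) fun s' =>
      ∃ cumA sumA diagA i, Tables n ptr col val na cumA sumA diagA ∧
        (∀ v < n, sumA v = posPrefix ptr val v (ptr (v + 1)) - offPrefix ptr val v (ptr (v + 1))) ∧
        Counting n na cumA sumA diagA (minKillRate ptr val n * ε / 16)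
          (((c + 3 : ℕ) * Nat.clog 2 n : ℕ) /
            ((minKillRate ptr val n * ε / 16) * (minKillRate ptr val n * ε / 16)))
          (minKillRate ptr val n) 0 i 0 (fun _ => 0) s' := by
  obtain ⟨nr, rr, nra, ra, pos⟩ := s
  obtain ⟨hp, r2, a1, a2, a3⟩ := hs
  obtain rfl := hp.narr
  simp only at r2 a1 a2 a3 hna hna1 hp
  have hclog : ∀ k, k < Nat.clog 2 n ↔ 2 ^ k < n := fun k => Nat.lt_clog_iff_pow_lt one_lt_two
  have hT : Tables n ptr col val nra (ra 1) (ra 2) (ra 3) :=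
    ⟨hna, hna1, fun v j => a1 v v.2 j, fun v => a2 v v.2, fun v => a3 v v.2⟩
  refine Runs.mono (runs_block_seq (T := (Nat.clog 2 n * (3 + 1) + 1) + 12) ?_)
    (by simp; omega) fun _ h => h
  simp only [blockPre_nconst, blockPre_nil]
  refine ⟨by omega, by omega, ?_⟩
  -- Doubling 2^k until it reaches n leaves k = ⌈log₂ n⌉ in register 12.
  refine (runs_loop_const (fun k s' => s' = ⟨Function.update (Function.update nr 12 k) 13 (2 ^ k),
    rr, nra, ra, pos⟩) (Nat.clog 2 n) 3 ?_ ?_ (by simp)).seq fun s hs => ?_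
  · rintro k hk _ rfl
    have hk' := (hclog k).1 hk
    have hk2 : k < 2 ^ k := Nat.lt_two_pow_self
    refine ⟨by simpa [Test.holds, show nr 0 = n from hp.n0] using hk', ?_⟩
    refine runs_block (os := [.nadd 13 13 13, .nadd 12 12 1]) ?_
    simp only [blockPre_nadd, blockPre_nil]
    simp only [Function.update_self, ne_eq, Nat.reduceEqDiff, not_false_eq_true,
      Function.update_of_ne, show nr 1 = 1 from hp.n1]
    refine ⟨by omega, by omega, ?_⟩
    congr 1
    funext i
    by_cases h12 : i = 12
    · subst h12; simp
    · by_cases h13 : i = 13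
      · subst h13; simp [pow_succ]; ring
      · simp [h12, h13]
  · rintro _ rfl
    have := (hclog (Nat.clog 2 n)).not.1 (lt_irrefl _)
    simpa [Test.holds, show nr 0 = n from hp.n0] using this
  · subst hs
    refine runs_block (os := [.rmul 3 2 1, .nconst 9 16, .rofNat 9 9, .rdiv 3 3 9,
      .nconst 9 (c + 3), .nmul 9 9 12, .rofNat 4 9, .rmul 9 3 3, .rdiv 4 4 9, .rsub 7 12 2,
      .nconst 3 0]) ?_
    simp only [blockPre_rmul, blockPre_nconst, blockPre_rofNat, blockPre_rdiv, blockPre_nmul,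
      blockPre_rsub, blockPre_nil]
    refine ⟨hB', hB3, by simpa using hB2, by omega, ra 1, ra 2, ra 3, rr 5, hT, a2,
      ⟨⟨?_, ?_, ?_, ?_, ?_, ?_, ?_, ?_, ?_, ?_, ?_, ?_, ?_⟩, ?_, ?_, ?_, ?_⟩⟩
    all_goals simp [r2, show rr 12 = 1 from hp.r12, show rr 13 = 0 from hp.r13, show pos = 0 from hp.pos, show rr 1 = ε from hp.r1,
      show ra 4 = _ from hp.a4, show nr 0 = n from hp.n0, show nr 1 = 1 from hp.n1,
      show nr 2 = 2 from hp.n2, show nr 11 = 0 from hp.n11]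

/-- The answer of a query to a table with counts `C`, row sums `S` and number of walks `N`. -/
noncomputable def queryAnswer (n : ℕ) (C S : ℕ → ℝ) (N : ℝ) (u v : ℕ) : ℝ :=
  C (u * n + u) / N / S u + C (v * n + v) / N / S v - C (u * n + v) / N / S v
    - C (v * n + u) / N / S u

lemma runs_queryProg {s : State} (hn : s.narr 2 0 = n) (hB : n * n < B) {u v : ℕ} (hu : u < n)
    (hv : v < n) :
    Runs B ω queryProg (queryState s u v) 26 fun s' => s'.narr = s.narr ∧ s'.rarr = s.rarr ∧
      s'.rreg 0 = queryAnswer n (s.rarr 4) (s.rarr 2) (s.rarr 5 0) u v := by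
  refine runs_block ?_
  have h1 : ∀ a b, a < n → b < n → a * n + b < B := fun a b ha hb => by nlinarith
  have h2 : ∀ a, a < n → a * n < B := fun a ha => by nlinarith
  have h3 : n < B := (Nat.le_mul_self n).trans_lt hB
  simp only [blockPre_nload, blockPre_rload, blockPre_nmul, blockPre_nadd, blockPre_rdiv,
    blockPre_radd, blockPre_rsub, blockPre_nil, queryState]
  simp [hn, h1, h2, h3, hu, hv, queryAnswer]

end RealRAM

/-! ### The complete build program. -/

namespace RealRAM

variable {B : ℕ} {ω : ℕ → unitInterval} {n : ℕ} {M : Matrix (Fin n) (Fin n) ℝ}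
  {ptr col : ℕ → ℕ} {val : ℕ → ℝ} {α ε : ℝ}

/-- The accuracy to which the killing probabilities are estimated. -/
noncomputable def accuracy (n : ℕ) (ptr : ℕ → ℕ) (val : ℕ → ℝ) (ε : ℝ) : ℝ :=
  minKillRate ptr val n * ε / 16

/-- The number of walks from every vertex. -/
noncomputable def walkCount (c n : ℕ) (ptr : ℕ → ℕ) (val : ℕ → ℝ) (ε : ℝ) : ℕ :=
  ⌈(((c + 3) * Nat.clog 2 n : ℕ) : ℝ) / (accuracy n ptr val ε * accuracy n ptr val ε)⌉₊

lemma runs_initProg (hB : 2 < B) : Runs B ω initProg (inputState n ptr col val α ε) 6 fun s =>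
    ∃ na : ℕ → ℕ → ℕ, na 0 = ptr ∧ na 1 = col ∧ na 2 0 = n ∧ RowsDone n na ptr val ε 0 s := by
  refine runs_block ?_
  simp only [blockPre_nconst, blockPre_rofNat, blockPre_nstore, blockPre_nil, inputState]
  refine ⟨by omega, hB, _, ?_, ?_, ?_, ⟨?_, ?_, ?_, ?_, ?_, ?_, ?_, ?_, rfl, ?_, ?_, ?_⟩,
    ?_, ?_, ?_, ?_⟩
  all_goals simp [minKillRate]

lemma runs_buildProg (hF : IsSparseRowFormat M ptr col val) (hG : IsGroundedLaplacian M)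
    (hn : 0 < n) {c l : ℕ} (hl : ∀ k < l, accuracy n ptr val ε < (1 - minKillRate ptr val n) ^ k)
    (hl' : (1 - minKillRate ptr val n) ^ l ≤ accuracy n ptr val ε)
    (hB1 : 2 * ptr n + 2 < B) (hB2 : n * n < B) (hB3 : 2 * n < B) (hB4 : 16 < B) (hB5 : c + 3 < B)
    (hB6 : (c + 3) * Nat.clog 2 n < B) :
    Runs B ω (buildProg c) (inputState n ptr col val α ε)
      (9 * ptr n + 18 * n + 4 * Nat.clog 2 n +
        n * (walkCount c n ptr val ε * (l * (8 * Nat.clog 2 n + 19) + 8) + 6) + 26) fun s =>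
      s.narr 2 0 = n ∧ (∀ u : Fin n, s.rarr 2 u = ∑ v, M u v) ∧
      s.rarr 5 0 = walkCount c n ptr val ε ∧
      ∀ u v : Fin n, s.rarr 4 (u * n + v) / walkCount c n ptr val ε =
        killFrequency (rowMove n ptr col val) (u * (walkCount c n ptr val ε * l)) l
          (walkCount c n ptr val ε) u v ω := by
  refine Runs.mono ((runs_initProg (by omega)).seq (T₂ := (9 * ptr n + 18 * n + 1) +
    ((Nat.clog 2 n * 4 + 16) + (n * (walkCount c n ptr val ε *
      (l * (8 * Nat.clog 2 n + 19) + 8) + 6) + 3))) fun s hs => ?_) (by omega) fun _ h => h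
  obtain ⟨na, h0, h1, h2, hs⟩ := hs
  refine (runs_rowsProg hF h0 (by omega) (by omega) hs).seq fun s hs => ?_
  refine (runs_paramProg h0 h1 hB3 hB4 hB5 hB6 hs).seq fun s hs => ?_
  obtain ⟨cumA, sumA, diagA, i, hT, hsum, hs⟩ := hs
  refine (runs_walksProg (N := walkCount c n ptr val ε) hF hG hT (Nat.le_pow_clog one_lt_two n)
    hB1 hB2 hl hl' (fun i => ?_) hn hs).mono le_rfl fun s hs => ?_
  -- A natural number lies below the real bound exactly when it lies below its ceiling.
  · rw [walkCount, Nat.lt_ceil]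
    rfl
  · obtain ⟨e1, e2, e3, e4⟩ := hs
    refine ⟨by rw [e1, h2], fun u => ?_, e3, fun u v => ?_⟩
    · rw [e2, hsum u u.2, hF.posPrefix_eq hG, hF.offPrefix_eq hG, sub_sub_cancel]
    · simp only [e4, killFrequency, sum_vertexHits]

lemma IsSparseRowFormat.killRate_eq (hF : IsSparseRowFormat M ptr col val)
    (hG : IsGroundedLaplacian M) (u : Fin n) :
    killRate ptr val u = (∑ v, M u v) / M u u := by
  rw [killRate, hF.posPrefix_eq hG, hF.offPrefix_eq hG, sub_sub_cancel]

lemma minKillRate_le_one (k : ℕ) : minKillRate ptr val k ≤ 1 := by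
  induction k with
  | zero => exact le_rfl
  | succ k ih => exact (min_le_left _ _).trans ih

lemma minKillRate_le {k u : ℕ} (hu : u < k) : minKillRate ptr val k ≤ killRate ptr val u := by
  induction k with
  | zero => omega
  | succ k ih =>
    rcases Nat.lt_succ_iff_lt_or_eq.1 hu with h | rfl
    · exact (min_le_left _ _).trans (ih h)
    · exact min_le_right _ _

lemma le_minKillRate {b : ℝ} (hb : b ≤ 1) {k : ℕ} (h : ∀ u < k, b ≤ killRate ptr val u) :
    b ≤ minKillRate ptr val k := by
  induction k with
  | zero => exact hb
  | succ k ih => exact le_min (ih fun u hu => h u (hu.trans k.lt_succ_self)) (h k k.lt_succ_self)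

end RealRAM

/-! ### Bounds on the killing rate, the walk length and the running time. -/

section Bounds

open RealRAM

variable {n : ℕ} {M : Matrix (Fin n) (Fin n) ℝ} {ptr col : ℕ → ℕ} {val : ℕ → ℝ} {α ε W : ℝ}

lemma IsDiagDominant.div_le_sum_div (hα : 0 < α) (hM : IsDiagDominant α M)
    (hG : IsGroundedLaplacian M) (u : Fin n) : α / (1 + α) ≤ (∑ v, M u v) / M u u := by
  have h1 := hM.2.2 u
  rw [div_le_div_iff₀ (by linarith) (hG.diag_pos u), sum_row_eq_diag_sub hM.2.1]
  linarith

lemma WeightRatioLE.one_le (hW : WeightRatioLE (laplacianCompletion M) W)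
    (hG : IsGroundedLaplacian M) (u : Fin n) : 1 ≤ W := by
  have h := laplacianGraph_adj_inl_inr (hG.sum_pos u).ne'
  have h1 := hW _ _ _ _ h h
  simp only [laplacianCompletion, Matrix.fromBlocks_apply₁₂, Matrix.of_apply, neg_neg] at h1
  have h2 := hG.sum_pos u
  by_contra! h3
  nlinarith

/-- The edge from u to x has weight s_u, so each of the other at most n - 1 edges at u weighs at
most W s_u, whence M_uu ≤ nW s_u. This bound is independent of α and keeps α out of the logarithm.
-/
lemma WeightRatioLE.inv_le_sum_div (hW : WeightRatioLE (laplacianCompletion M) W)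
    (hG : IsGroundedLaplacian M) (u : Fin n) : (n * W)⁻¹ ≤ (∑ v, M u v) / M u u := by
  have hW1 := hW.one_le hG u
  have hn : (0 : ℝ) < n := by exact_mod_cast u.pos
  have hs := hG.sum_pos u
  have hx := laplacianGraph_adj_inl_inr hs.ne'
  have hle : ∀ v ∈ Finset.univ.erase u, |M u v| ≤ W * ∑ v, M u v := by
    intro v hv
    have huv := (Finset.ne_of_mem_erase hv).symm
    by_cases h0 : M u v = 0
    · rw [h0, abs_zero]; exact mul_nonneg (by linarith) hs.le
    · have h1 := hW _ _ _ _ (laplacianGraph_adj_inl_inl huv h0) hx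
      simp only [laplacianCompletion, Matrix.fromBlocks_apply₁₂, Matrix.fromBlocks_apply₁₁,
        Matrix.of_apply, neg_neg] at h1
      rwa [abs_of_nonpos (hG.off u v huv)]
  have hsum := Finset.sum_le_card_nsmul _ _ _ hle
  rw [Finset.card_erase_of_mem (Finset.mem_univ u), Finset.card_univ, Fintype.card_fin,
    nsmul_eq_mul, Nat.cast_sub u.pos, Nat.cast_one] at hsum
  have hrow := sum_row_eq_diag_sub (u := u) hG.off
  rw [inv_le_iff_one_le_mul₀ (by positivity), div_mul_eq_mul_div, one_le_div (hG.diag_pos u)]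
  nlinarith

/-- The number of steps after which a killed walk has survived with small probability. -/
lemma exists_walkLength {q δ : ℝ} (hq : 0 < q) (hq1 : q ≤ 1) (hδ : 0 < δ) :
    ∃ l : ℕ, (∀ k < l, δ < (1 - q) ^ k) ∧ (1 - q) ^ l ≤ δ ∧
      ((1 : ℝ) ≤ δ⁻¹ → (l : ℝ) ≤ Real.log δ⁻¹ / q + 1) := by
  classical
  -- This is 1 - q ≤ exp(-q), raised to the power k.
  have key : ∀ k : ℕ, Real.log δ⁻¹ / q ≤ k → (1 - q) ^ k ≤ δ := by
    intro k hk
    rw [div_le_iff₀ hq, Real.log_inv] at hk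
    calc (1 - q) ^ k ≤ Real.exp (-q) ^ k :=
          pow_le_pow_left₀ (by linarith) (Real.one_sub_le_exp_neg q) k
      _ = Real.exp (-(k * q)) := by rw [← Real.exp_nat_mul]; ring_nf
      _ ≤ Real.exp (Real.log δ) := Real.exp_le_exp.2 (by linarith)
      _ = δ := Real.exp_log hδ
  have hex : ∃ k : ℕ, (1 - q) ^ k ≤ δ := ⟨_, key _ (Nat.le_ceil _)⟩
  refine ⟨Nat.find hex, fun k hk => not_le.1 (Nat.find_min hex hk), Nat.find_spec hex,
    fun h1 => ?_⟩
  have h2 : Nat.find hex ≤ ⌈Real.log δ⁻¹ / q⌉₊ := Nat.find_min' hex (key _ (Nat.le_ceil _))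
  have h3 := Nat.ceil_lt_add_one (div_nonneg (Real.log_nonneg h1) hq.le)
  have h4 : (Nat.find hex : ℝ) ≤ ⌈Real.log δ⁻¹ / q⌉₊ := by exact_mod_cast h2
  linarith

lemma log_le_clog (n : ℕ) (hn : 0 < n) : Real.log n ≤ Nat.clog 2 n := by
  have h1 : (n : ℝ) ≤ 2 ^ Nat.clog 2 n := by exact_mod_cast Nat.le_pow_clog one_lt_two n
  have h2 := Real.log_le_log (by exact_mod_cast hn) h1
  rw [Real.log_pow] at h2
  have h3 := Real.log_two_lt_d9
  have h4 : (0 : ℝ) ≤ Nat.clog 2 n := Nat.cast_nonneg _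
  nlinarith

lemma clog_le_three_mul_log (n : ℕ) (hn : 2 ≤ n) : (Nat.clog 2 n : ℝ) ≤ 3 * Real.log n := by
  have h0 : 0 < Nat.clog 2 n := Nat.clog_pos one_lt_two hn
  have h1 : 2 ^ (Nat.clog 2 n - 1) < n := (Nat.lt_clog_iff_pow_lt one_lt_two).1 (by omega)
  have h2 : (2 : ℝ) ^ (Nat.clog 2 n - 1) ≤ n := by exact_mod_cast h1.le
  have h3 := Real.log_le_log (by positivity) h2
  rw [Real.log_pow, Nat.cast_sub h0, Nat.cast_one] at h3
  have h4 : Real.log 2 ≤ Real.log n := Real.log_le_log (by norm_num) (by exact_mod_cast hn)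
  have h5 := Real.log_two_gt_d9
  have h6 : (1 : ℝ) ≤ Nat.clog 2 n := by exact_mod_cast h0
  nlinarith

lemma clog_le_self (n : ℕ) : Nat.clog 2 n ≤ n :=
  Nat.clog_le_of_le_pow Nat.lt_two_pow_self.le

/-- With β = α⁻¹ this is (1 + β)³ ≤ 4(1 + β³), an instance of convexity of the cube. -/
lemma inv_pow_three_le (hα : 0 < α) {q : ℝ} (hq : α / (1 + α) ≤ q) :
    (q ^ 3)⁻¹ ≤ 4 * (1 + (α ^ 3)⁻¹) := by
  have h0 : 0 < α / (1 + α) := by positivity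
  have h1 : (q ^ 3)⁻¹ ≤ ((α / (1 + α)) ^ 3)⁻¹ :=
    inv_anti₀ (by positivity) (pow_le_pow_left₀ h0.le hq 3)
  refine h1.trans ?_
  set β := α⁻¹ with hβ
  have hβ0 : 0 < β := inv_pos.2 hα
  have h2 : ((α / (1 + α)) ^ 3)⁻¹ = (1 + β) ^ 3 := by
    rw [hβ]; field_simp; ring
  have h3 : (α ^ 3)⁻¹ = β ^ 3 := by rw [hβ, inv_pow]
  rw [h2, h3]
  nlinarith [mul_nonneg (by positivity : 0 ≤ 1 + β) (sq_nonneg (1 - β))]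

/-- The number of steps taken by the simulation of the walks. -/
lemma walkTime_le {c l N : ℕ} {q : ℝ} (hn : 2 ≤ n) (hα : 0 < α) (hε : 0 < ε)
    (hε1 : ε ≤ 1) (hW : 1 ≤ W) (hq : α / (1 + α) ≤ q) (hqW : (n * W)⁻¹ ≤ q) (hq1 : q ≤ 1)
    (hN : (N : ℝ) ≤ (((c + 3) * Nat.clog 2 n : ℕ) : ℝ) / ((q * ε / 16) * (q * ε / 16)) + 1)
    (hl : (l : ℝ) ≤ Real.log (q * ε / 16)⁻¹ / q + 1) :
    (n : ℝ) * (N * (l * (8 * Nat.clog 2 n + 19) + 8)) ≤ 6000000 * (c + 3) *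
      (n * (ε ^ 2)⁻¹ * (1 + (α ^ 3)⁻¹) * Real.log n * Real.log (n * W / ε) ^ 3) := by
  set L : ℝ := (Nat.clog 2 n : ℝ)
  set lam := Real.log n
  set Lam := Real.log (n * W / ε)
  have hn2 : (2 : ℝ) ≤ n := by exact_mod_cast hn
  have hnW : (n : ℝ) ≤ n * W / ε := by
    rw [le_div_iff₀ hε]; nlinarith
  have hl2 := Real.log_two_gt_d9
  have hlam : 0.69 ≤ lam := by
    have : Real.log 2 ≤ lam := Real.log_le_log (by norm_num) hn2
    norm_num; linarith
  have hLam : lam ≤ Lam := Real.log_le_log (by linarith) hnW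
  have hL3 : L ≤ 3 * lam := clog_le_three_mul_log n hn
  have hL1 : 1 ≤ L := by
    have : 0 < Nat.clog 2 n := Nat.clog_pos one_lt_two hn
    exact Nat.one_le_cast.2 this
  have hlam0 : 0 ≤ lam := by norm_num at hlam; linarith
  have hLam0 : 0 ≤ Lam := hlam0.trans hLam
  have hq0 : 0 < q := lt_of_lt_of_le (by positivity) hq
  have hlog : Real.log (q * ε / 16)⁻¹ ≤ 5 * Lam := by
    -- As nW/ε ≥ n ≥ 2, the factor 16 = 2⁴ is absorbed by four further powers.
    have h1 : (q * ε / 16)⁻¹ ≤ (n * W / ε) ^ 5 := by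
      have h2 : q⁻¹ ≤ n * W := by
        rw [inv_le_comm₀ hq0 (by positivity)]; exact hqW
      have h3 : (q * ε / 16)⁻¹ = 16 * (q⁻¹ / ε) := by field_simp
      have h4 : q⁻¹ / ε ≤ n * W / ε := by gcongr
      have h5 : (2 : ℝ) ≤ n * W / ε := hn2.trans hnW
      rw [h3]
      calc 16 * (q⁻¹ / ε) ≤ 2 ^ 4 * (n * W / ε) := by linarith
        _ ≤ (n * W / ε) ^ 4 * (n * W / ε) := by gcongr
        _ = _ := by ring
    have h6 := Real.log_le_log (by positivity) h1
    rwa [Real.log_pow] at h6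
  -- The additive 1 is at most 2 Lam / q, since Lam ≥ log 2 > 1/2 and q ≤ 1.
  have hl' : (l : ℝ) ≤ 7 * Lam / q := by
    refine hl.trans ?_
    rw [div_add_one hq0.ne', div_le_div_iff_of_pos_right hq0]
    norm_num at hlam
    linarith
  have hstep : (l : ℝ) * (8 * L + 19) + 8 ≤ 900 * Lam ^ 3 / q := by
    norm_num at hlam
    have h1 : (l : ℝ) * (8 * L + 19) ≤ 7 * Lam / q * (27 * (3 * Lam)) :=
      mul_le_mul hl' (by linarith) (by linarith) (by positivity)
    have h2 : (8 : ℝ) ≤ 8 / q := by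
      rw [le_div_iff₀ hq0]; linarith
    have h3 : 7 * Lam / q * (27 * (3 * Lam)) + 8 / q = (567 * Lam ^ 2 + 8) / q := by
      field_simp; ring
    have h4 : (567 * Lam ^ 2 + 8) / q ≤ 900 * Lam ^ 3 / q := by
      -- The square is raised to a cube at the cost of a constant, using Lam ≥ 0.69; this is where
      -- the bound in the statement is generous.
      rw [div_le_div_iff_of_pos_right hq0]
      have h5 : 0.69 ≤ Lam := by norm_num; linarith
      norm_num at h5
      have h6 : 0.476 ≤ Lam ^ 2 := by norm_num; nlinarith
      norm_num at h6
      nlinarith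
    linarith
  have hN' : (N : ℝ) ≤ 1536 * (c + 3) * lam / (q ^ 2 * ε ^ 2) := by
    have h1 : (((c + 3) * Nat.clog 2 n : ℕ) : ℝ) / ((q * ε / 16) * (q * ε / 16)) =
        256 * (c + 3) * L / (q ^ 2 * ε ^ 2) := by
      push_cast; field_simp; norm_num; exact mul_comm _ _
    -- So rounding N up at most doubles it.
    have h2 : 1 ≤ 256 * (c + 3) * L / (q ^ 2 * ε ^ 2) := by
      rw [one_le_div (by positivity)]
      have h3 : q ^ 2 * ε ^ 2 ≤ 1 :=
        mul_le_one₀ (pow_le_one₀ hq0.le hq1) (by positivity) (pow_le_one₀ hε.le hε1)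
      have h4 : (0 : ℝ) ≤ c := Nat.cast_nonneg c
      nlinarith
    rw [h1] at hN
    have h5 : 256 * (c + 3) * L / (q ^ 2 * ε ^ 2) ≤ 768 * (c + 3) * lam / (q ^ 2 * ε ^ 2) := by
      rw [div_le_div_iff_of_pos_right (by positivity)]
      have h4 : (0 : ℝ) ≤ c := Nat.cast_nonneg c
      nlinarith
    have h6 : 1536 * (c + 3) * lam / (q ^ 2 * ε ^ 2) =
        2 * (768 * (c + 3) * lam / (q ^ 2 * ε ^ 2)) := by ring
    linarith
  calc (n : ℝ) * (N * (l * (8 * L + 19) + 8))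
      ≤ n * (1536 * (c + 3) * lam / (q ^ 2 * ε ^ 2) * (900 * Lam ^ 3 / q)) := by gcongr
    _ = 1382400 * (c + 3) * n * lam * Lam ^ 3 * (ε ^ 2)⁻¹ * (q ^ 3)⁻¹ := by
        field_simp; norm_num; exact mul_comm _ _
    _ ≤ 1382400 * (c + 3) * n * lam * Lam ^ 3 * (ε ^ 2)⁻¹ * (4 * (1 + (α ^ 3)⁻¹)) := by
        gcongr
        exact inv_pow_three_le hα hq
    _ ≤ _ := by
        have : 0 ≤ (c + 3) * (n * (ε ^ 2)⁻¹ * (1 + (α ^ 3)⁻¹) * lam * Lam ^ 3) := by positivity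
        linarith

end Bounds

/-! ### Failure probability, word size and the final theorem. -/

section Assembly

open RealRAM

variable {n m : ℕ} {M : Matrix (Fin n) (Fin n) ℝ} {ptr col : ℕ → ℕ} {val : ℕ → ℝ} {α ε W : ℝ}

lemma le_buildBound (hn : 1 ≤ n) (hα : 0 < α) (hε : 0 < ε) (hε1 : ε ≤ 1) (hW : 1 ≤ W) :
    (m : ℝ) ≤ buildBound n m α ε W := by
  have hn1 : (1 : ℝ) ≤ n := by exact_mod_cast hn
  have h1 : 0 ≤ Real.log n := Real.log_nonneg hn1
  have h2 : 0 ≤ Real.log (n * W / ε) :=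
    Real.log_nonneg (by rw [le_div_iff₀ hε]; nlinarith)
  unfold buildBound
  have : 0 ≤ n * (ε ^ 2)⁻¹ * (1 + (α ^ 3)⁻¹) * Real.log n * Real.log (n * W / ε) ^ 3 := by
    positivity
  linarith

lemma mul_sq_le_wordBound {K : ℕ} {T : ℝ} (hm : 1 ≤ m) (hT : (m : ℝ) ≤ T) (hK : 2 ≤ K) :
    K * m ^ 2 ≤ wordBound K T := by
  have hm1 : (1 : ℝ) ≤ m := by exact_mod_cast hm
  have h : ((K * m ^ 2 : ℕ) : ℝ) ≤ K * T ^ K := by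
    push_cast
    gcongr
    calc (m : ℝ) ^ 2 ≤ T ^ 2 := by gcongr
      _ ≤ T ^ K := pow_le_pow_right₀ (hm1.trans hT) hK
  exact_mod_cast h.trans (Nat.le_ceil _)

lemma buildTime_le {c l N p : ℕ} {q : ℝ} (hn : 1 ≤ n) (hp : p ≤ 2 * m) (hnm : n ≤ m) (hα : 0 < α)
    (hε : 0 < ε) (hε1 : ε ≤ 1) (hW : 1 ≤ W) (hq : α / (1 + α) ≤ q) (hqW : (n * W)⁻¹ ≤ q)
    (hq1 : q ≤ 1)
    (hN : N = ⌈(((c + 3) * Nat.clog 2 n : ℕ) : ℝ) / ((q * ε / 16) * (q * ε / 16))⌉₊)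
    (hl : (l : ℝ) ≤ Real.log (q * ε / 16)⁻¹ / q + 1) :
    ((9 * p + 18 * n + 4 * Nat.clog 2 n + n * (N * (l * (8 * Nat.clog 2 n + 19) + 8) + 6) + 26 :
      ℕ) : ℝ) ≤ (6000000 * (c + 3) + 100 : ℕ) * buildBound n m α ε W := by
  have hmT := le_buildBound (m := m) hn hα hε hε1 hW
  have hwalk : (n : ℝ) * (N * (l * (8 * Nat.clog 2 n + 19) + 8)) ≤
      6000000 * (c + 3) * (buildBound n m α ε W - m) := by
    -- For n = 1 the bound on the walks vanishes with log n, but ⌈log₂ 1⌉ = 0 and no walk is made.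
    rcases Nat.lt_or_ge n 2 with h | h
    · obtain rfl : n = 1 := by omega
      have hN0 : N = 0 := by rw [hN]; simp
      rw [hN0, Nat.cast_zero, zero_mul, mul_zero]
      have : (0 : ℝ) ≤ buildBound 1 m α ε W - m := by linarith
      positivity
    · refine (walkTime_le (c := c) h hα hε hε1 hW hq hqW hq1 ?_ hl).trans (le_of_eq ?_)
      · rw [hN]
        exact (Nat.ceil_lt_add_one (by have := mul_self_nonneg (q * ε / 16); positivity)).le
      · unfold buildBound; ring
  have h1 : (9 * p + 18 * n + 4 * Nat.clog 2 n + 6 * n + 26 : ℕ) ≤ 100 * m := by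
    have := clog_le_self n
    omega
  have h2 : ((9 * p + 18 * n + 4 * Nat.clog 2 n + 6 * n + 26 : ℕ) : ℝ) ≤ 100 * m := by
    exact_mod_cast h1
  have h3 : (0 : ℝ) ≤ 6000000 * (c + 3) * m := by positivity
  push_cast at h2 ⊢
  linarith

/-- A union bound over n² pairs, each failing with probability at most 2 n^{-(c+3)}; the product is
(2/n) n^{-c}. For n = 1 the claimed bound is 1. -/
lemma tapeLaw_exists_killFrequency (hF : IsSparseRowFormat M ptr col val)
    (hG : IsGroundedLaplacian M) (hn : 1 ≤ n) {c l N : ℕ} {δ : ℝ} (hδ : 0 < δ)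
    (hN : N = ⌈(((c + 3) * Nat.clog 2 n : ℕ) : ℝ) / (δ * δ)⌉₊) :
    tapeLaw {τ | ∃ u v : Fin n, δ <
      |killFrequency (rowMove n ptr col val) (u * (N * l)) l N u v τ - killedAt M l u v|} ≤
      ENNReal.ofReal (1 / (n : ℝ) ^ c) := by
  have : IsProbabilityMeasure tapeLaw := by unfold tapeLaw; infer_instance
  rcases Nat.lt_or_ge n 2 with h | h
  · obtain rfl : n = 1 := by omega
    simpa using prob_le_one
  have hnpos : (0 : ℝ) < n := by exact_mod_cast hn
  have hclog : 0 < Nat.clog 2 n := Nat.clog_pos one_lt_two h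
  have hNpos : 0 < N := by
    rw [hN, Nat.ceil_pos]
    have : 0 < (c + 3) * Nat.clog 2 n := by positivity
    positivity
  have hNδ : ((c : ℝ) + 3) * Real.log n ≤ N * δ ^ 2 := by
    have h1 : (((c + 3) * Nat.clog 2 n : ℕ) : ℝ) / (δ * δ) ≤ N := hN ▸ Nat.le_ceil _
    rw [div_le_iff₀ (by positivity)] at h1
    push_cast at h1
    have h2 : ((c : ℝ) + 3) * Real.log n ≤ (c + 3) * Nat.clog 2 n := by
      gcongr
      exact log_le_clog n hn
    rw [sq]
    linarith
  have hexp : Real.exp (-(2 * N * δ ^ 2)) ≤ ((n : ℝ) ^ (c + 3))⁻¹ := by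
    rw [← Real.exp_log (by positivity : 0 < ((n : ℝ) ^ (c + 3))⁻¹), Real.log_inv, Real.log_pow]
    refine Real.exp_le_exp.2 (neg_le_neg ?_)
    push_cast
    have : 0 ≤ N * δ ^ 2 := by positivity
    linarith
  rw [← ofReal_measureReal]
  refine ENNReal.ofReal_le_ofReal ?_
  have hset : {τ | ∃ u v : Fin n, δ <
      |killFrequency (rowMove n ptr col val) (u * (N * l)) l N u v τ - killedAt M l u v|} =
      ⋃ x : Fin n × Fin n, {τ | δ < |killFrequency (rowMove n ptr col val) (x.1 * (N * l)) l N
        x.1 x.2 τ - killedAt M l x.1 x.2|} := by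
    ext τ; simp
  rw [hset]
  calc _ ≤ ∑ x : Fin n × Fin n, tapeLaw.real {τ | δ < |killFrequency (rowMove n ptr col val)
        (x.1 * (N * l)) l N x.1 x.2 τ - killedAt M l x.1 x.2|} := measureReal_iUnion_fintype_le _
    _ ≤ ∑ _x : Fin n × Fin n, 2 * ((n : ℝ) ^ (c + 3))⁻¹ := by
        refine Finset.sum_le_sum fun x _ => ?_
        refine (tapeLaw_killFrequency (hF.measurable_rowMove hG) (hF.volume_rowMove_move hG)
          (hF.volume_rowMove_kill hG) _ l hNpos x.1 x.2 hδ.le).trans ?_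
        gcongr
    _ = 2 / n * (1 / (n : ℝ) ^ c) := by
        rw [Finset.sum_const, Finset.card_univ, Fintype.card_prod, Fintype.card_fin, nsmul_eq_mul]
        push_cast
        rw [pow_add]
        field_simp
    _ ≤ 1 * (1 / (n : ℝ) ^ c) := by
        gcongr
        rw [div_le_one hnpos]
        exact_mod_cast h
    _ = _ := one_mul _

theorem lemma3p8 :
    (∀ c : ℕ, ∃ (build query : RealRAM.Prog) (K : ℕ),
      ∀ (n : ℕ) (M : Matrix (Fin n) (Fin n) ℝ) (α ε W : ℝ) (ptr col : ℕ → ℕ) (val : ℕ → ℝ),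
        1 ≤ n → 0 < α → 0 < ε → ε ≤ 1 →
        IsDiagDominant α M →
        (laplacianGraph (laplacianCompletion M)).Connected →
        WeightRatioLE (laplacianCompletion M) W →
        RealRAM.IsSparseRowFormat M ptr col val →
        let T := buildBound n (edgeCount (laplacianCompletion M)) α ε W
        let B := wordBound K T
        (∀ ω, ∃ (t : ℕ) (s : RealRAM.State),
          RealRAM.Exec B ω build (RealRAM.inputState n ptr col val α ε) t s ∧
          (t : ℝ) ≤ K * T ∧
          ∀ (u v : Fin n) (ω' : ℕ → unitInterval), ∃ (t' : ℕ) (s' : RealRAM.State),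
            RealRAM.Exec B ω' query (RealRAM.queryState s u v) t' s' ∧
            (t' : ℝ) ≤ K * (1 + Real.log n) ^ K ∧
            s'.narr = s.narr ∧ s'.rarr = s.rarr) ∧
        RealRAM.tapeLaw {ω | ¬ ∃ (t : ℕ) (s : RealRAM.State),
          RealRAM.Exec B ω build (RealRAM.inputState n ptr col val α ε) t s ∧
          ∀ (u v : Fin n) (ω' : ℕ → unitInterval), ∃ (t' : ℕ) (s' : RealRAM.State),
            RealRAM.Exec B ω' query (RealRAM.queryState s u v) t' s' ∧
            IsApprox ε
              (effectiveResistance (laplacianCompletion M) (Sum.inl u) (Sum.inl v))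
              (s'.rreg 0)}
          ≤ ENNReal.ofReal (1 / (n : ℝ) ^ c)) ∧
    (∀ (n : ℕ) (hn : 2 ≤ n) (M : Matrix (Fin n) (Fin n) ℝ) (α : ℝ),
      0 < α → IsDiagDominant α M →
      (laplacianGraph (laplacianCompletion M)).Connected →
      ∃ h : (normalizedLaplacian (schurOntoLeft (laplacianCompletion M))).IsHermitian,
        α / (1 + α) ≤ secondSmallestEigenvalue hn h) := by
  -- K comes from `buildTime_le`; it also exceeds the 26 steps of a query and makes K m² a valid
  -- word size.
  refine ⟨fun c => ⟨buildProg c, queryProg, 6000000 * (c + 3) + 100, ?_⟩,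
    fun n hn M α hα hM hc => hM.div_le_secondSmallestEigenvalue hn hα hc⟩
  intro n M α ε W ptr col val hn hα hε hε1 hM hconn hWr hF T B
  have hG : IsGroundedLaplacian M := hM.isGroundedLaplacian hα hconn
  have hW : 1 ≤ W := hWr.one_le hG ⟨0, hn⟩
  have hn1 : (1 : ℝ) ≤ n := by exact_mod_cast hn
  set m := edgeCount (laplacianCompletion M) with hm
  have hnm : n ≤ m := card_le_edgeCount hconn
  have hptr : ptr n ≤ 2 * m := ptr_last_le hF hG
  set q := minKillRate ptr val n with hqdef
  -- The program computes q from the matrix and reads neither α nor W; they enter only through these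
  -- two lower bounds.
  have hqα : α / (1 + α) ≤ q := by
    refine le_minKillRate (by rw [div_le_one (by linarith)]; linarith) fun u hu => ?_
    have := hM.div_le_sum_div hα hG ⟨u, hu⟩
    rwa [← hF.killRate_eq hG] at this
  have hqW : (n * W)⁻¹ ≤ q := by
    refine le_minKillRate (inv_le_one_of_one_le₀ (by nlinarith)) fun u hu => ?_
    have := hWr.inv_le_sum_div hG ⟨u, hu⟩
    rwa [← hF.killRate_eq hG] at this
  have hq1 : q ≤ 1 := minKillRate_le_one n
  have hq0 : 0 < q := lt_of_lt_of_le (by positivity) hqα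
  have hqu : ∀ u : Fin n, q ≤ (∑ v, M u v) / M u u := fun u =>
    (hF.killRate_eq hG u) ▸ minKillRate_le u.2
  have hδ : 0 < q * ε / 16 := by positivity
  obtain ⟨l, hl1, hl2, hl3⟩ := exists_walkLength hq0 hq1 hδ
  have hl4 := hl3 ((one_le_inv₀ hδ).2 (by nlinarith))
  have hmT : (m : ℝ) ≤ T := le_buildBound hn hα hε hε1 hW
  have hB : (6000000 * (c + 3) + 100) * m ^ 2 ≤ B :=
    mul_sq_le_wordBound (hn.trans hnm) hmT (by omega)
  have hmm : m ≤ m ^ 2 := Nat.le_self_pow two_ne_zero m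
  have hm1 : 1 ≤ m := hn.trans hnm
  have hcm : c + 3 ≤ (c + 3) * m ^ 2 := Nat.le_mul_of_pos_right _ (by positivity)
  have hB' : 6000000 * ((c + 3) * m ^ 2) + 100 * m ^ 2 ≤ B := le_of_eq_of_le (by ring) hB
  have hnn : n * n ≤ m ^ 2 := by rw [sq]; gcongr
  have hcl : (c + 3) * Nat.clog 2 n ≤ (c + 3) * m ^ 2 :=
    Nat.mul_le_mul_left _ ((clog_le_self n).trans (hnm.trans hmm))
  have hBn : n * n < B := by omega
  have hbuild : ∀ ω, Runs B ω (buildProg c) (inputState n ptr col val α ε) _ _ := fun ω =>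
    runs_buildProg (c := c) (l := l) hF hG hn hl1 hl2 (by omega) hBn (by omega) (by omega)
      (by omega) (by omega)
  set N := walkCount c n ptr val ε with hNdef
  refine ⟨fun ω => ?_, ?_⟩
  · obtain ⟨t, s, hex, ht, hs, -⟩ := hbuild ω
    refine ⟨t, s, hex, (Nat.cast_le.2 ht).trans
      (buildTime_le hn hptr hnm hα hε hε1 hW hqα hqW hq1 rfl hl4), fun u v ω' => ?_⟩
    obtain ⟨t', s', hex', ht', h1, h2, -⟩ := runs_queryProg (ω := ω') hs hBn u.2 v.2
    refine ⟨t', s', hex', ?_, h1, h2⟩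
    have h3 : (t' : ℝ) ≤ 26 := by exact_mod_cast ht'
    have h4 : (1 : ℝ) ≤ (1 + Real.log n) ^ (6000000 * (c + 3) + 100) :=
      one_le_pow₀ (by linarith [Real.log_nonneg hn1])
    have h5 : (26 : ℝ) ≤ (6000000 * (c + 3) + 100 : ℕ) :=
      Nat.ofNat_le_cast.2 (by omega)
    exact h3.trans (h5.trans (le_mul_of_one_le_right (Nat.cast_nonneg _) h4))
  -- The failure set lies in the set where some frequency is off by more than δ. Monotonicity of the
  -- outer measure suffices, so the failure set need not be measurable.
  · refine (measure_mono ?_).trans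
      (tapeLaw_exists_killFrequency (l := l) hF hG hn hδ (rfl : N = _))
    intro ω hω
    by_contra hgood
    simp only [Set.mem_ofPred_eq, not_exists, not_lt] at hgood
    refine hω ?_
    obtain ⟨t, s, hex, -, hs, hsum, hN, hfreq⟩ := hbuild ω
    refine ⟨t, s, hex, fun u v ω' => ?_⟩
    obtain ⟨t', s', hex', -, -, -, h3⟩ := runs_queryProg (ω := ω') hs hBn u.2 v.2
    refine ⟨t', s', hex', ?_⟩
    rw [h3, queryAnswer, hN, hfreq, hfreq, hfreq, hfreq, hsum, hsum]
    exact hG.isApprox_effectiveResistance hq0 hqu hε hε1 hl2 hgood u v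

end Assembly
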